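/- Let $1\le i\le n$ and $m\ge 1$, and let $W=S_{n+1}$ be the Weyl group of $\mathfrak{sl}_{n+1}(\mathbb C)$, with simple reflections $s_1,\dots,s_n$, positive roots $R^+=\{\alpha_{k,j}=\epsilon_k-\epsilon_{j+1}\mid 1\le k\le j\le n\}$ and root vectors $e_\beta$ ($\beta\in R^+$). Let $w\in W^i$, i.e. $w$ is of minimal length in its coset modulo $\operatorname{Stab}_W(\omega_i)=S_i\times S_{n+1-i}$. Put $R_w^-=\{\alpha\in R^+\mid w(\alpha)<0\}$ and $$\ell_k=\max\big(\{i-1\}\cup\{j\mid i\le j\le n,\ \alpha_{k,j}\in R_w^-\}\big)\quad(1\le k\le i),\qquad \ell_k=i-1\quad (k\le 0).$$ *The variety $X_w^t$.* Let $V_w(m\omega_i)=U(\mathfrak b)v_{w(m\omega_i)}$ be the Demazure module in the simple module $V(m\omega_i)$. Order $R_w^-$ by height $j-k+1$ and, for equal height, by $k$; transport this order to $-w(R_w^-)\subseteq R^+$ along $\alpha\mapsto -w(\alpha)$, and let $\prec$ be any total order on $R^+$ extending it. Order multi-exponents $\mathbf p\in\mathbb Z_{\ge0}^{R^+}$ by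 total degree first, and then lexicographically (the larger exponent at the $\prec$-largest root where they differ wins). Let $V_w(m\omega_i)^t$ be the associated graded space of the filtration of $V_w(m\omega_i)$ whose $\mathbf p$-th subspace is spanned by the vectors $e_{\beta_1}\cdots e_{\beta_d}v_{w(m\omega_i)}$ with $\beta_1,\dots,\beta_d\in R^+$ of multi-exponent $\preceq\mathbf p$. The root vectors act on it as commuting operators, so $\mathbb U^a=\mathbb G_a^{R^+}$ acts through the exponential, and $$X_w^t=\overline{\mathbb U^a\cdot[v_{w(m\omega_i)}]}\subseteq\mathbb P(V_w(m\omega_i)^t),$$ which is a toric variety for the torus $(\mathbb C^*)^{R^+}$ that scales the component of multidegree $\mathbf p$ by $t^{\mathbf p}$. *The variety $X_w^{gt}$.* For $\lambda=m\omega_{n+1-i}$, the Gelfand–Tsetlin polytope $GT(\lambda)$ consists of the real patterns $(x_{k,j})$, $0\le k\le n$, $1\le j\le n+1-k$, with $x_{k-1,j}\ge x_{k,j}\ge x_{k-1,j+1}$ and top row $x_{0,j}=m$ for $j\le n+1-i$, $x_{0,j}=0$ for $j>n+1-i$. A set $D$ of pairs $(k,j)$ with $0\le k\le n-1$, $1\le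 j\le n-k$ defines the Kogan face $\{x_{k,j}=x_{k+1,j}\ \text{for all}\ (k,j)\in D\}$ of $GT(\lambda)$; its type is the product of the $s_{k+j}$, $(k,j)\in D$, taken from the bottom row $k=n-1$ to the top row $k=0$ and in each row from left to right. Let $w_0\in W^i$ be the minimal representative of the coset of the longest element, and let $F$ be a maximal Kogan face of type $ww_0^{-1}$ of $GT(m\omega_{n+1-i})$. Let $X_w^{gt}$ be the projective toric variety of $F$, i.e. the closure in projective space of the set of points $[t^{\mathbf u}]_{\mathbf u}$, where $\mathbf u$ runs through the lattice points of $F$ and $t$ through the torus. Then the following are equivalent: 1. $X_w^{gt}$ and $X_w^t$ are isomorphic as toric varieties (there is an isomorphism of varieties that carries the torus of one, as a group of automorphisms, onto the torus of the other); 2. $\ell_{i-2}<i+1$ or $\ell_{i-1}<i+2$; 3. $w$ has no reduced decomposition of the form $w=\cdots(s_{i-1}s_{i-2})(s_{i+1}s_is_{i-1})(s_{i+2}s_{i+1}s_i)$ (in particular there is none if $i-2<1$ or $i+2>n$). -/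

import Mathlib

noncomputable section

namespace GTSchubert

/-! ### Projective varieties, regular maps, toric varieties -/

/-- Polynomial functions on a complex vector space: the algebra generated by the linear forms. -/
def polyFun (V : Type*) [AddCommGroup V] [Module ℂ V] : Subalgebra ℂ (V → ℂ) :=
  Algebra.adjoin ℂ {f | ∃ φ : Module.Dual ℂ V, f = fun y => φ y}

/-- A polynomial map `V → W` that is homogeneous of degree `d`. -/
def IsHomogPolyMap {V W : Type*} [AddCommGroup V] [Module ℂ V] [AddCommGroup W] [Module ℂ W]
    (d : ℕ) (F : V → W) : Prop :=
  (∀ ψ : Module.Dual ℂ W, (fun y => ψ (F y)) ∈ polyFun V) ∧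
    ∀ (c : ℂ) (y : V), F (c • y) = c ^ d • F y

/-- Zariski closure of a subset of projective space: the common zeros of all homogeneous
polynomials that vanish on the subset. -/
def zariskiClosure {V : Type*} [AddCommGroup V] [Module ℂ V] (S : Set (Projectivization ℂ V)) :
    Set (Projectivization ℂ V) :=
  {z | ∀ (d : ℕ) (f : V → ℂ), IsHomogPolyMap d f → (∀ y ∈ S, f y.rep = 0) → f z.rep = 0}

/-- Regular maps between subvarieties of projective spaces: around every point, the map is given by
homogeneous polynomials of one degree without a common zero at that point. -/
def IsRegularMap {V W : Type*} [AddCommGroup V] [Module ℂ V] [AddCommGroup W] [Module ℂ W]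
    {X : Set (Projectivization ℂ V)} {Y : Set (Projectivization ℂ W)} (φ : X → Y) : Prop :=
  ∀ x : X, ∃ (d : ℕ) (F : V → W), IsHomogPolyMap d F ∧ F x.1.rep ≠ 0 ∧
    ∀ (y : X) (h : F y.1.rep ≠ 0), (φ y).1 = Projectivization.mk ℂ (F y.1.rep) h

/-- Let `X ⊆ ℙ(V)` and `Y ⊆ ℙ(W)` be projective toric varieties whose tori are the images of the
groups `G` and `H`, acting linearly through `ρ` and `σ`.  They are isomorphic as toric varieties
if there is an isomorphism of varieties `X ≃ Y` that transports the torus of `X`, as a group of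
automorphisms of `X`, onto the torus of `Y`. -/
def ToricIso {V W G H : Type*} [AddCommGroup V] [Module ℂ V] [AddCommGroup W] [Module ℂ W]
    [Group G] [Group H]
    (X : Set (Projectivization ℂ V)) (ρ : G →* LinearMap.GeneralLinearGroup ℂ V)
    (Y : Set (Projectivization ℂ W)) (σ : H →* LinearMap.GeneralLinearGroup ℂ W) : Prop :=
  ∃ φ : X ≃ Y, IsRegularMap φ ∧ IsRegularMap φ.symm ∧
    (∀ g : G, ∃ h : H, ∀ x y : X, ρ g • x.1 = y.1 → σ h • (φ x).1 = (φ y).1) ∧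
    (∀ h : H, ∃ g : G, ∀ x y : X, σ h • (φ x).1 = (φ y).1 → ρ g • x.1 = y.1)

/-! ### The toric variety of a lattice polytope -/

/-- The lattice points of a set in `ℝ^ι`. -/
abbrev LatticePt {ι : Type*} (P : Set (ι → ℝ)) : Type _ :=
  {u : ι → ℤ // (fun a => (u a : ℝ)) ∈ P}

/-- The torus `(ℂˣ)^ι` acting on `ℂ^(P ∩ ℤ^ι)`: the coordinate at `u` is multiplied by `t^u`. -/
def polytopeTorusEnd {ι : Type*} [Fintype ι] (P : Set (ι → ℝ)) :
    (ι → ℂˣ) →* Module.End ℂ (LatticePt P → ℂ) where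
  toFun t := LinearMap.pi fun u => ((∏ a, t a ^ u.1 a : ℂˣ) : ℂ) • LinearMap.proj u
  map_one' := by
    ext; simp
  map_mul' s t := by
    refine LinearMap.ext fun y => funext fun u => ?_
    simp [mul_zpow, Finset.prod_mul_distrib, mul_assoc]

/-- The torus of `polytopeVariety`. -/
def polytopeTorus {ι : Type*} [Fintype ι] (P : Set (ι → ℝ)) :
    (ι → ℂˣ) →* LinearMap.GeneralLinearGroup ℂ (LatticePt P → ℂ) :=
  (polytopeTorusEnd P).toHomUnits

/-- The projective toric variety of a normal lattice polytope `P`: the closure of the set of the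
points `[t^u]`, with `u` running through the lattice points of `P`, for `t` in the torus. -/
def polytopeVariety {ι : Type*} [Fintype ι] (P : Set (ι → ℝ)) :
    Set (Projectivization ℂ (LatticePt P → ℂ)) :=
  zariskiClosure {z | ∃ (t : ι → ℂˣ)
    (h : (fun u : LatticePt P => ((∏ a, t a ^ u.1 a : ℂˣ) : ℂ)) ≠ 0),
    z = Projectivization.mk ℂ _ h}

/-! ### The graded space of a cyclic module for a homogeneous lexicographic order

`x : R → End M` are the operators of the root vectors, indexed by the set `R` of positive roots,
`v` is a cyclic vector and `r β γ` is the total order `β ≺ γ` on `R`. -/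

/-- The multi-exponent of a word in the root vectors. -/
def wordDeg {R : Type*} [DecidableEq R] (L : List R) : R → ℕ := fun β => L.count β

/-- The homogeneous lexicographic order on monomials: first the total degree, then the exponent of
the largest root in which the two monomials differ. -/
def HomLexLT {R : Type*} [Fintype R] (r : R → R → Prop) (q p : R → ℕ) : Prop :=
  (∑ β, q β < ∑ β, p β) ∨
    ((∑ β, q β = ∑ β, p β) ∧ ∃ β, q β < p β ∧ ∀ γ, r β γ → q γ = p γ)

theorem wordDeg_cons {R : Type*} [DecidableEq R] (β : R) (L : List R) :
    wordDeg (β :: L) = wordDeg L + Pi.single β 1 := by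
  funext γ
  by_cases h : γ = β
  · subst h; simp [wordDeg]
  · simp [wordDeg, h, Ne.symm h]

theorem HomLexLT.add {R : Type*} [Fintype R] {r : R → R → Prop} {q p : R → ℕ}
    (h : HomLexLT r q p) (s : R → ℕ) : HomLexLT r (q + s) (p + s) := by
  rcases h with h | ⟨h, β, h1, h2⟩
  · left
    simpa [Finset.sum_add_distrib] using h
  · right
    refine ⟨by simp [Finset.sum_add_distrib, h], β, by simpa using h1, fun γ hγ => ?_⟩
    simp [h2 γ hγ]

section Graded

variable {R : Type*} [Fintype R] [DecidableEq R] {M : Type*} [AddCommGroup M] [Module ℂ M]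
  (r : R → R → Prop) (x : R → Module.End ℂ M) (v : M)

/-- The subspace `M^{≺ p}`. -/
def filtLT (p : R → ℕ) : Submodule ℂ M :=
  Submodule.span ℂ {y | ∃ L : List R, HomLexLT r (wordDeg L) p ∧ y = (L.map x).prod v}

/-- The subspace `M^{⪯ p}`. -/
def filtLE (p : R → ℕ) : Submodule ℂ M :=
  Submodule.span ℂ
    {y | ∃ L : List R, (HomLexLT r (wordDeg L) p ∨ wordDeg L = p) ∧ y = (L.map x).prod v}

/-- The component `M^{⪯ p} / M^{≺ p}`. -/
abbrev GrComp (p : R → ℕ) : Type _ :=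
  filtLE r x v p ⧸ (filtLT r x v p).submoduleOf (filtLE r x v p)

/-- The associated graded space `M^t`. -/
abbrev GrSpace : Type _ := DirectSum (R → ℕ) (GrComp r x v)

theorem filtLE_step (β : R) (p : R → ℕ) :
    ∀ y ∈ filtLE r x v p, x β y ∈ filtLE r x v (p + Pi.single β 1) := by
  intro y hy
  have : filtLE r x v p ≤ (filtLE r x v (p + Pi.single β 1)).comap (x β) := by
    refine Submodule.span_le.2 ?_
    rintro _ ⟨L, hL, rfl⟩
    refine Submodule.subset_span ⟨β :: L, ?_, by simp⟩
    rw [wordDeg_cons]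
    exact hL.imp (fun h => h.add _) (fun h => by rw [h])
  exact this hy

theorem filtLT_step (β : R) (p : R → ℕ) :
    ∀ y ∈ filtLT r x v p, x β y ∈ filtLT r x v (p + Pi.single β 1) := by
  intro y hy
  have : filtLT r x v p ≤ (filtLT r x v (p + Pi.single β 1)).comap (x β) := by
    refine Submodule.span_le.2 ?_
    rintro _ ⟨L, hL, rfl⟩
    refine Submodule.subset_span ⟨β :: L, ?_, by simp⟩
    rw [wordDeg_cons]
    exact hL.add _
  exact this hy

/-- The action of a root vector between two consecutive components. -/
def grStep (β : R) (p : R → ℕ) :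
    GrComp r x v p →ₗ[ℂ] GrComp r x v (p + Pi.single β 1) :=
  Submodule.mapQ _ _ ((x β).restrict (filtLE_step r x v β p))
    (fun y hy => filtLT_step r x v β p y.1 hy)

/-- The action of a root vector on `M^t`, homogeneous of multidegree the root. -/
def grOp (β : R) : Module.End ℂ (GrSpace r x v) :=
  DirectSum.toModule ℂ (R → ℕ) _ fun p =>
    DirectSum.lof ℂ (R → ℕ) (GrComp r x v) (p + Pi.single β 1) ∘ₗ grStep r x v β p

/-- The class of the cyclic vector in `M^t`. -/
def grVec : GrSpace r x v :=
  DirectSum.lof ℂ (R → ℕ) (GrComp r x v) 0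
    (Submodule.Quotient.mk ⟨v, Submodule.subset_span ⟨[], Or.inr (by funext; simp [wordDeg]),
      by simp⟩⟩)

/-- The action of an element `c` of the abelian unipotent group `𝔾_a^R` on a vector of `M^t`:
the (finite) exponential series of `∑ c_β x_β`. -/
def grExp (c : R → ℂ) (y : GrSpace r x v) : GrSpace r x v :=
  ∑ᶠ k : ℕ, ((k.factorial : ℂ)⁻¹) • ((∑ β, c β • grOp r x v β) ^ k) y

/-- The closure in `ℙ(M^t)` of the `𝔾_a^R`-orbit of the class of the cyclic vector. -/
def grVariety : Set (Projectivization ℂ (GrSpace r x v)) :=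
  zariskiClosure {z | ∃ (c : R → ℂ) (h : grExp r x v c (grVec r x v) ≠ 0),
    z = Projectivization.mk ℂ _ h}

/-- The torus `(ℂˣ)^R` acting on `M^t`: the component of multidegree `p` is scaled by `t^p`. -/
def grTorusEnd : (R → ℂˣ) →* Module.End ℂ (GrSpace r x v) where
  toFun t := DirectSum.lmap fun p => ((∏ β, t β ^ p β : ℂˣ) : ℂ) • LinearMap.id
  map_one' := by
    refine LinearMap.ext fun y => DFinsupp.ext fun p => ?_
    simp
  map_mul' s t := by
    refine LinearMap.ext fun y => DFinsupp.ext fun p => ?_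
    have h : (∏ β, (s * t) β ^ p β : ℂˣ) = (∏ β, s β ^ p β) * ∏ β, t β ^ p β := by
      simp only [Pi.mul_apply, mul_pow, Finset.prod_mul_distrib]
    simp only [DirectSum.lmap_apply, Module.End.mul_apply, LinearMap.smul_apply, LinearMap.id_apply]
    rw [h, Units.val_mul, mul_smul]

/-- The torus of `grVariety`. -/
def grTorus : (R → ℂˣ) →* LinearMap.GeneralLinearGroup ℂ (GrSpace r x v) :=
  (grTorusEnd r x v).toHomUnits

end Graded

/-! ### The symmetric group `S_{n+1}`

Permutations of `{1, …, n+1}` are permutations of `Fin (n + 1)`; the number `k` is the element of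
value `k - 1`. -/

/-- The simple reflection `s_j = (j, j+1)`, for `1 ≤ j ≤ n`. -/
def simpleRefl (n j : ℕ) : Equiv.Perm (Fin (n + 1)) :=
  if h : 1 ≤ j ∧ j ≤ n then Equiv.swap ⟨j - 1, by omega⟩ ⟨j, by omega⟩ else 1

/-- `w = s_{j_1} ⋯ s_{j_k}` for the list `[j_1, …, j_k]` of elements of `{1, …, n}`. -/
def IsWordOf (n : ℕ) (w : Equiv.Perm (Fin (n + 1))) (L : List ℕ) : Prop :=
  (∀ j ∈ L, 1 ≤ j ∧ j ≤ n) ∧ (L.map (simpleRefl n)).prod = w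

/-- The length of a permutation. -/
def length (n : ℕ) (w : Equiv.Perm (Fin (n + 1))) : ℕ :=
  sInf {k | ∃ L : List ℕ, IsWordOf n w L ∧ L.length = k}

/-- Reduced decompositions. -/
def IsReducedWordOf (n : ℕ) (w : Equiv.Perm (Fin (n + 1))) (L : List ℕ) : Prop :=
  IsWordOf n w L ∧ L.length = length n w

/-- `w ∈ W^i`: `w` is of minimal length in its coset modulo the stabilizer of `{1, …, i}`. -/
def IsMinRep (n i : ℕ) (w : Equiv.Perm (Fin (n + 1))) : Prop :=
  ∀ u : Equiv.Perm (Fin (n + 1)), (∀ k, (u k).val < i ↔ k.val < i) → length n w ≤ length n (w * u)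

/-- The minimal representative of the coset of the longest element: `k ↦ n + 1 - i + k` for
`k ≤ i` and `k ↦ k - i` for `k > i`; this is a rotation modulo `n + 1`. -/
def longestMinRep (n i : ℕ) : Equiv.Perm (Fin (n + 1)) :=
  Equiv.addRight (Fin.ofNat (n + 1) (n + 1 - i))

/-- The positive roots `α_{k,j} = ε_k - ε_{j+1}`, as pairs `(k, j+1)`. -/
abbrev PosRoot (n : ℕ) : Type := {p : Fin (n + 1) × Fin (n + 1) // p.1 < p.2}

/-- `α ∈ R_w^-`, that is, `w(α)` is a negative root. -/
def IsInv {n : ℕ} (w : Equiv.Perm (Fin (n + 1))) (α : PosRoot n) : Prop := w α.1.2 < w α.1.1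

/-- The positive root `-w(α)` for `α ∈ R_w^-`. -/
def negImage {n : ℕ} (w : Equiv.Perm (Fin (n + 1))) (α : PosRoot n) (h : IsInv w α) : PosRoot n :=
  ⟨(w α.1.2, w α.1.1), h⟩

/-- The total order `α ≺ β` on positive roots: by height, then by the first index. -/
def HeightLT {n : ℕ} (α β : PosRoot n) : Prop :=
  α.1.2.val - α.1.1.val < β.1.2.val - β.1.1.val ∨
    (α.1.2.val - α.1.1.val = β.1.2.val - β.1.1.val ∧ α.1.1 < β.1.1)

/-- `r` extends the order on `-w(R_w^-)` that is transported by `-w` from the order `HeightLT`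
on `R_w^-`. -/
def ExtendsHeightOrder {n : ℕ} (w : Equiv.Perm (Fin (n + 1)))
    (r : PosRoot n → PosRoot n → Prop) : Prop :=
  ∀ (α β : PosRoot n) (hα : IsInv w α) (hβ : IsInv w β), HeightLT α β →
    r (negImage w α hα) (negImage w β hβ)

/-- The sequence `ℓ_k = max ({i-1} ∪ {j | i ≤ j ≤ n, α_{k,j} ∈ R_w^-})`, for `1 ≤ k ≤ i`, and
`ℓ_0 = i - 1`. -/
def ell (n i : ℕ) (w : Equiv.Perm (Fin (n + 1))) (k : ℕ) : ℕ :=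
  sSup ({i - 1} ∪ {j | i ≤ j ∧ j ≤ n ∧
    ∃ α : PosRoot n, α.1.1.val + 1 = k ∧ α.1.2.val = j ∧ IsInv w α})

/-! ### Demazure modules

`V(m ω_i)` is realised in the polynomial ring in the entries of a generic matrix with `n + 1` rows
and `i` columns, on which `𝔤𝔩_{n+1}` acts by polarizations: it is the submodule generated by the
`m`-th power of the minor on the rows `1, …, i`, a highest weight vector of weight `m ω_i`. -/

/-- The polynomial ring in the entries of a generic `(n+1) × i` matrix. -/
abbrev MatPoly (n i : ℕ) : Type := MvPolynomial (Fin (n + 1) × Fin i) ℂ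

/-- The action of the matrix unit `E_{a,b}`: the derivation `∑_q x_{a,q} ∂/∂x_{b,q}`. -/
def polarization (n i : ℕ) (a b : Fin (n + 1)) : Module.End ℂ (MatPoly n i) :=
  (MvPolynomial.mkDerivation ℂ fun p : Fin (n + 1) × Fin i =>
    if p.1 = b then (MvPolynomial.X (a, p.2) : MatPoly n i) else 0).toLinearMap

/-- The extremal weight vector `v_{w(m ω_i)}`: the `m`-th power of the minor on the rows
`w(1), …, w(i)`. -/
def extremalVec (n i m : ℕ) (hin : i ≤ n) (w : Equiv.Perm (Fin (n + 1))) : MatPoly n i :=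
  (Matrix.det (Matrix.of fun k q : Fin i =>
    (MvPolynomial.X (w (Fin.castLE (by omega) k), q) : MatPoly n i))) ^ m

/-- The Demazure module `V_w(m ω_i) = U(𝔟).v_{w(m ω_i)}`. -/
def demazureModule (n i m : ℕ) (hin : i ≤ n) (w : Equiv.Perm (Fin (n + 1))) :
    Submodule ℂ (MatPoly n i) :=
  sInf {N | extremalVec n i m hin w ∈ N ∧ ∀ a b, a ≤ b → N ≤ N.comap (polarization n i a b)}

theorem demazureModule_stable (n i m : ℕ) (hin : i ≤ n) (w : Equiv.Perm (Fin (n + 1)))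
    (a b : Fin (n + 1)) (h : a ≤ b) :
    ∀ y ∈ demazureModule n i m hin w, polarization n i a b y ∈ demazureModule n i m hin w := by
  intro y hy
  refine Submodule.mem_sInf.2 fun N hN => ?_
  exact hN.2 a b h (Submodule.mem_sInf.1 hy N hN)

/-- The root vector `e_α` as an operator on the Demazure module. -/
def demazureOp (n i m : ℕ) (hin : i ≤ n) (w : Equiv.Perm (Fin (n + 1))) (α : PosRoot n) :
    Module.End ℂ (demazureModule n i m hin w) :=
  (polarization n i α.1.1 α.1.2).restrict
    (demazureModule_stable n i m hin w α.1.1 α.1.2 α.2.le)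

/-- The cyclic vector `v_{w(m ω_i)}` of the Demazure module. -/
def demazureVec (n i m : ℕ) (hin : i ≤ n) (w : Equiv.Perm (Fin (n + 1))) :
    demazureModule n i m hin w :=
  ⟨extremalVec n i m hin w, Submodule.mem_sInf.2 fun _ hN => hN.1⟩

/-- The toric degeneration `X_w^t ⊆ ℙ(V_w(m ω_i)^t)`, for the total order `r` on the positive
roots. -/
def toricSchubert (n i m : ℕ) (hin : i ≤ n) (w : Equiv.Perm (Fin (n + 1)))
    (r : PosRoot n → PosRoot n → Prop) :
    Set (Projectivization ℂ (GrSpace r (demazureOp n i m hin w) (demazureVec n i m hin w))) :=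
  grVariety r (demazureOp n i m hin w) (demazureVec n i m hin w)

/-- The torus of `toricSchubert`. -/
def toricSchubertTorus (n i m : ℕ) (hin : i ≤ n) (w : Equiv.Perm (Fin (n + 1)))
    (r : PosRoot n → PosRoot n → Prop) :
    (PosRoot n → ℂˣ) →* LinearMap.GeneralLinearGroup ℂ
      (GrSpace r (demazureOp n i m hin w) (demazureVec n i m hin w)) :=
  grTorus r (demazureOp n i m hin w) (demazureVec n i m hin w)

/-! ### Gelfand–Tsetlin polytopes and Kogan faces -/

/-- The indices `(k, j)` with `0 ≤ k ≤ n` and `1 ≤ j ≤ n + 1 - k` of a Gelfand–Tsetlin pattern. -/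
abbrev GTIndex (n : ℕ) : Type :=
  {p : Fin (n + 1) × Fin (n + 2) // 1 ≤ p.2.val ∧ p.1.val + p.2.val ≤ n + 1}

/-- The row `k` of `(k, j)`. -/
def GTIndex.row {n : ℕ} (p : GTIndex n) : ℕ := p.1.1.val

/-- The position `j` of `(k, j)`. -/
def GTIndex.col {n : ℕ} (p : GTIndex n) : ℕ := p.1.2.val

/-- The Gelfand–Tsetlin polytope of `λ = ∑ lam l • ω_l`: the top row is
`s_{0,j} = lam n + ⋯ + lam j`, and `s_{k-1,j} ≥ s_{k,j} ≥ s_{k-1,j+1}`. -/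
def gtPolytope (n : ℕ) (lam : ℕ → ℕ) : Set (GTIndex n → ℝ) :=
  {s | (∀ p : GTIndex n, p.row = 0 → s p = ∑ l ∈ Finset.Icc p.col n, (lam l : ℝ)) ∧
    (∀ p q : GTIndex n, q.row = p.row + 1 → q.col = p.col → s q ≤ s p) ∧
    (∀ p q : GTIndex n, q.row = p.row + 1 → q.col + 1 = p.col → s p ≤ s q)}

/-- The Kogan face given by the equations `A_{k,j} : x_{k,j} = x_{k+1,j}` for `(k, j) ∈ D`. -/
def koganFace (n : ℕ) (lam : ℕ → ℕ) (D : Finset (ℕ × ℕ)) : Set (GTIndex n → ℝ) :=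
  {s ∈ gtPolytope n lam | ∀ p q : GTIndex n, q.row = p.row + 1 → q.col = p.col →
    (p.row, p.col) ∈ D → s p = s q}

/-- The type of a Kogan face: the product of the `s_{k+j}` for `(k, j) ∈ D`, from the bottom row to
the top row and in each row from left to right. -/
def koganType (n : ℕ) (D : Finset (ℕ × ℕ)) : Equiv.Perm (Fin (n + 1)) :=
  ((List.range n).reverse.map fun k =>
    ((List.range (n - k)).map fun j =>
      if (k, j + 1) ∈ D then simpleRefl n (k + (j + 1)) else 1).prod).prod

/-- `F` is a maximal Kogan face of type `w w_0⁻¹` of the Gelfand–Tsetlin polytope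
`GT(m ω_{n+1-i})`, where `w_0` is the minimal representative of the longest element. -/
def IsMaximalKoganFace (n i m : ℕ) (w : Equiv.Perm (Fin (n + 1))) (F : Set (GTIndex n → ℝ)) :
    Prop :=
  Maximal (fun F' => ∃ D : Finset (ℕ × ℕ), koganType n D = w * (longestMinRep n i)⁻¹ ∧
    F' = koganFace n (fun l => if l = n + 1 - i then m else 0) D) F

end GTSchubert

end

noncomputable section

namespace GTSchubert

/-! ### Toric models -/

section Toric

variable {I A I' A' : Type*} [Fintype I] [Fintype I']
  {V W G H : Type*} [AddCommGroup V] [Module ℂ V] [AddCommGroup W] [Module ℂ W] [Group G] [Group H]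

/-! The inversions of `w ∈ W^i` form a Young diagram `D`, with the root α_{i-r, i+s} in cell (r, s),
because `w` increases on the first `i` places and on the remaining ones. Both varieties turn out to
be toric varieties attached to the poset `D`, and the theorem is a case of the comparison of order
polytopes with chain polytopes.

Gelfand–Tsetlin side. Following the type of a Kogan face row by row shows that certain entries are
forced to equal `m`, so every face of type w w₀⁻¹ lies in `schubertFace` (`koganFace_subset`). That
set is itself a Kogan face of this type (`koganType_schubertEqs`, `schubertFace_subset`), hence the
only maximal one. Its free entries sit at the cells of `D`, and the interlacing inequalities say
that they form a monotone filling with values in [0, m]: a point of the `m`-th dilate of the order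
polytope of `D`.

Demazure side. Commutators of root vectors are shorter words, so each component of the graded space
is at most a line, and the variety is determined by the exponents with nonzero class. These are the
lattice points of the `m`-th dilate of the chain polytope (`demazure_grClass_ne_zero_iff`). An
exponent with too large a sum on a chain is straightened by a rank-one substitution, under which an
`i × i` minor has degree at most 2 (`expCoeff_mem_of_chain`). The other vectors are independent: by
Cauchy–Binet their coefficients form a Gram matrix (`gram_expCoeff`), and products of minors
attached to antichains have the required lowest monomials (`hasLowest_genMinor`).

Comparison. If `D` does not contain both (1,2) and (2,1), the cells outside the first row and column
form a chain, and a transfer map built from below on one part and from above on the other is a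
unimodular equivalence (`exists_transfer`). Otherwise facets are counted. They correspond to minimal
nontrivial stabilizers, so an isomorphism bounds the number of facets of the chain polytope by that
of the order polytope (`FacetData.card_le_of_toricIso`). The order polytope has |D| facets plus one
for each inner and each maximal cell; the chain polytope has |D| plus one for each maximal chain,
which is strictly more (`card_lt_card_flag`).

The cells (2,1) and (1,2) are the failure of the two inequalities on ℓ, and the eight letters of the
forbidden suffix are the eight cells of the shape (3,3,2) that these two cells generate. -/

theorem dual_mem_polyFun (φ : Module.Dual ℂ V) : (fun y => φ y) ∈ polyFun V :=
  Algebra.subset_adjoin ⟨φ, rfl⟩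

theorem polyFun_comp {f : W → ℂ} (hf : f ∈ polyFun W) (T : V →ₗ[ℂ] W) :
    (fun y => f (T y)) ∈ polyFun V := by
  induction hf using Algebra.adjoin_induction with
  | mem f hf => obtain ⟨φ, rfl⟩ := hf; exact dual_mem_polyFun (φ ∘ₗ T)
  | algebraMap c => exact (polyFun V).algebraMap_mem c
  | add f g _ _ hf hg => exact (polyFun V).add_mem hf hg
  | mul f g _ _ hf hg => exact (polyFun V).mul_mem hf hg

theorem IsHomogPolyMap.comp_linear {d : ℕ} {f : W → ℂ} (hf : IsHomogPolyMap d f)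
    (T : V →ₗ[ℂ] W) : IsHomogPolyMap d fun y => f (T y) :=
  ⟨fun ψ => polyFun_comp (hf.1 ψ) T, fun c y => by simp [hf.2]⟩

theorem IsHomogPolyMap.mem_polyFun {d : ℕ} {f : V → ℂ} (hf : IsHomogPolyMap d f) :
    f ∈ polyFun V := hf.1 LinearMap.id

theorem isHomogPolyMap_linear (T : V →ₗ[ℂ] W) : IsHomogPolyMap 1 (fun y => T y) :=
  ⟨fun ψ => dual_mem_polyFun (ψ ∘ₗ T), fun c y => by simp⟩

theorem IsHomogPolyMap.map_smul_eq_zero {d : ℕ} {f : V → ℂ} (hf : IsHomogPolyMap d f) (c : ℂˣ)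
    (y : V) : f ((c : ℂ) • y) = 0 ↔ f y = 0 := by
  rw [hf.2]; simp

theorem IsHomogPolyMap.map_rep_eq_zero {d : ℕ} {f : V → ℂ} (hf : IsHomogPolyMap d f) {y : V}
    (hy : y ≠ 0) : f (Projectivization.mk ℂ y hy).rep = 0 ↔ f y = 0 := by
  obtain ⟨c, hc⟩ := Projectivization.exists_smul_eq_mk_rep ℂ y hy
  rw [← hc]
  exact hf.map_smul_eq_zero c y

theorem polyFun_curve [Finite A] {f : (A → ℂ) → ℂ} (hf : f ∈ polyFun (A → ℂ)) (q : A → Polynomial ℂ) :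
    ∃ Q : Polynomial ℂ, ∀ t, f (fun a => (q a).eval t) = Q.eval t := by
  have := Fintype.ofFinite A
  classical
  induction hf using Algebra.adjoin_induction with
  | mem f hf =>
    obtain ⟨φ, rfl⟩ := hf
    refine ⟨∑ a, Polynomial.C (φ (Pi.single a 1)) * q a, fun t => ?_⟩
    beta_reduce
    rw [LinearMap.pi_apply_eq_sum_univ φ]
    simp only [Polynomial.eval_finsetSum, Polynomial.eval_mul, Polynomial.eval_C, smul_eq_mul]
    refine Finset.sum_congr rfl fun a _ => ?_
    rw [mul_comm]
    congr 2
    funext b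
    simp [Pi.single_apply, eq_comm]
  | algebraMap c => exact ⟨Polynomial.C c, fun t => by simp⟩
  | add f g _ _ hf hg =>
    obtain ⟨Q, hQ⟩ := hf
    obtain ⟨Q', hQ'⟩ := hg
    exact ⟨Q + Q', fun t => by simp [hQ, hQ']⟩
  | mul f g _ _ hf hg =>
    obtain ⟨Q, hQ⟩ := hf
    obtain ⟨Q', hQ'⟩ := hg
    exact ⟨Q * Q', fun t => by simp [hQ, hQ']⟩

/-- A polynomial function that vanishes on a polynomial curve outside a finite set of parameters
vanishes on the whole curve. -/
theorem polyFun_curve_eq_zero [Finite A] {f : (A → ℂ) → ℂ} (hf : f ∈ polyFun (A → ℂ)) (q : A → Polynomial ℂ)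
    {S : Set ℂ} (hS : S.Finite) (h : ∀ t ∉ S, f (fun a => (q a).eval t) = 0) (t : ℂ) :
    f (fun a => (q a).eval t) = 0 := by
  obtain ⟨Q, hQ⟩ := polyFun_curve hf q
  have : Q = 0 := by
    refine Polynomial.eq_zero_of_infinite_isRoot Q (hS.infinite_compl.mono fun t ht => ?_)
    rw [Set.mem_ofPred_eq, Polynomial.IsRoot.def, ← hQ]
    exact h t ht
  rw [hQ, this, Polynomial.eval_zero]

/-- The Laurent monomial `h^a`. -/
def mon (h : I → ℂˣ) (a : I → ℕ) : ℂˣ := ∏ i, h i ^ a i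

/-- The affine cone over the closure of the points `[h^a]_a`. -/
def torusCone (ex : A → I → ℕ) : Set (A → ℂ) :=
  {y | ∀ (d : ℕ) (f : (A → ℂ) → ℂ), IsHomogPolyMap d f →
    (∀ h : I → ℂˣ, f (fun a => (mon h (ex a) : ℂ)) = 0) → f y = 0}

/-- A linear identification of a projective variety with torus action with the toric variety
given by the exponents `ex`. -/
structure IsToricModel (X : Set (Projectivization ℂ V))
    (ρ : G →* LinearMap.GeneralLinearGroup ℂ V) (ex : A → I → ℕ) (Ψ : V ≃ₗ[ℂ] (A → ℂ)) :
    Prop where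
  mem_iff : ∀ z, z ∈ X ↔ Ψ z.rep ∈ torusCone ex
  torus_to : ∀ g, ∃ (h : I → ℂˣ) (c : ℂˣ), ∀ y a,
    Ψ (ρ g • y) a = c * mon h (ex a) * Ψ y a
  torus_from : ∀ h : I → ℂˣ, ∃ (g : G) (c : ℂˣ), ∀ y a,
    Ψ (ρ g • y) a = c * mon h (ex a) * Ψ y a

/-- Multiplication by `h` permutes the parametrizing points, and homogeneity absorbs the scalar `c`,
which may be zero. -/
theorem smul_mem_torusCone {ex : A → I → ℕ} {y : A → ℂ} (hy : y ∈ torusCone ex) (c : ℂ)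
    (h : I → ℂˣ) : (fun a => c * mon h (ex a) * y a) ∈ torusCone ex := by
  intro d f hf hv
  let T : (A → ℂ) →ₗ[ℂ] (A → ℂ) :=
    LinearMap.pi fun a => (c * (mon h (ex a) : ℂ)) • LinearMap.proj a
  refine hy d (fun z => f (T z)) (hf.comp_linear T) fun h' => ?_
  have : T (fun a => (mon h' (ex a) : ℂ)) = c • fun a => (mon (h * h') (ex a) : ℂ) := by
    funext a
    simp [T, mon, mul_pow, Finset.prod_mul_distrib, mul_assoc]
  simp only [this, hf.2, hv, smul_zero]

theorem smul_eq_iff (g : LinearMap.GeneralLinearGroup ℂ V) (x y : Projectivization ℂ V) :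
    g • x = y ↔ ∃ c : ℂˣ, g • x.rep = c • y.rep := by
  have hx : g • x = Projectivization.mk ℂ (g • x.rep) ((smul_ne_zero_iff_ne g).mpr x.rep_nonzero) := by
    conv_lhs => rw [← x.mk_rep]
    rfl
  rw [hx]
  conv_lhs => rw [← y.mk_rep]
  rw [Projectivization.mk_eq_mk_iff]
  simp only [eq_comm]

theorem smul_eq_mk (g : LinearMap.GeneralLinearGroup ℂ V) (x : Projectivization ℂ V) :
    g • x = Projectivization.mk ℂ (g • x.rep) ((smul_ne_zero_iff_ne g).mpr x.rep_nonzero) := by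
  conv_lhs => rw [← x.mk_rep]
  rfl

/-! ### Comparison of toric models: affine bijections, stabilizers, facets -/

section Models

variable {X : Set (Projectivization ℂ V)} {ρ : G →* LinearMap.GeneralLinearGroup ℂ V}
  {ex : A → I → ℕ} {Ψ : V ≃ₗ[ℂ] (A → ℂ)}
  {Y : Set (Projectivization ℂ W)} {σ : H →* LinearMap.GeneralLinearGroup ℂ W}
  {ex' : A' → I' → ℕ} {Ψ' : W ≃ₗ[ℂ] (A' → ℂ)}

theorem IsToricModel.mk_mem_iff (hX : IsToricModel X ρ ex Ψ) {y : V} (hy : y ≠ 0) :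
    Projectivization.mk ℂ y hy ∈ X ↔ Ψ y ∈ torusCone ex := by
  rw [hX.mem_iff]
  obtain ⟨c, hc⟩ := Projectivization.exists_smul_eq_mk_rep ℂ y hy
  rw [← hc, Units.smul_def, map_smul]
  exact forall₂_congr fun d f => forall₂_congr fun hf _ => hf.map_smul_eq_zero c (Ψ y)

theorem IsToricModel.smul_mem (hX : IsToricModel X ρ ex Ψ) (g : G) {z : Projectivization ℂ V}
    (hz : z ∈ X) : ρ g • z ∈ X := by
  obtain ⟨h, c, hc⟩ := hX.torus_to g
  rw [smul_eq_mk, hX.mk_mem_iff]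
  convert smul_mem_torusCone ((hX.mem_iff z).1 hz) c h using 1
  funext a
  exact hc _ a

/-- Toric varieties whose exponents are related by an affine unimodular bijection are
isomorphic. -/
theorem ToricIso.of_models (hX : IsToricModel X ρ ex Ψ) (hY : IsToricModel Y σ ex' Ψ')
    (e : A ≃ A')
    (h₁ : ∀ h : I → ℂˣ, ∃ (h' : I' → ℂˣ) (c : ℂˣ), ∀ a, mon h (ex a) = c * mon h' (ex' (e a)))
    (h₂ : ∀ h' : I' → ℂˣ, ∃ (h : I → ℂˣ) (c : ℂˣ), ∀ a,
      mon h' (ex' (e a)) = c * mon h (ex a)) :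
    ToricIso X ρ Y σ := by
  let T : V ≃ₗ[ℂ] W := Ψ ≪≫ₗ LinearEquiv.funCongrLeft ℂ ℂ e.symm ≪≫ₗ Ψ'.symm
  have hT : ∀ y a, Ψ' (T y) (e a) = Ψ y a := fun y a => by
    simp [T, LinearEquiv.funCongrLeft, LinearMap.funLeft]
  have hT' : ∀ y a, Ψ (T.symm y) a = Ψ' y (e a) := fun y a => by
    rw [← hT, LinearEquiv.apply_symm_apply]
  have hc₁ : ∀ y, Ψ y ∈ torusCone ex → Ψ' (T y) ∈ torusCone ex' := by
    intro y hy d f hf hv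
    have := hy d (fun z => f (Ψ' (T (Ψ.symm z))))
      (hf.comp_linear ((Ψ.symm ≪≫ₗ T ≪≫ₗ Ψ').toLinearMap)) fun h => ?_
    · simpa using this
    · obtain ⟨h', c, hc⟩ := h₁ h
      have : Ψ' (T (Ψ.symm fun a => (mon h (ex a) : ℂ))) =
          (c : ℂ) • fun a => (mon h' (ex' a) : ℂ) := by
        funext a
        obtain ⟨a, rfl⟩ := e.surjective a
        simp [hT, hc]
      simp only [this, hf.2, hv, smul_zero]
  have hc₂ : ∀ y, Ψ' y ∈ torusCone ex' → Ψ (T.symm y) ∈ torusCone ex := by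
    intro y hy d f hf hv
    have := hy d (fun z => f (Ψ (T.symm (Ψ'.symm z))))
      (hf.comp_linear ((Ψ'.symm ≪≫ₗ T.symm ≪≫ₗ Ψ).toLinearMap)) fun h => ?_
    · simpa using this
    · obtain ⟨h', c, hc⟩ := h₂ h
      have : Ψ (T.symm (Ψ'.symm fun a => (mon h (ex' a) : ℂ))) =
          (c : ℂ) • fun a => (mon h' (ex a) : ℂ) := by
        funext a
        simp [hT', hc]
      simp only [this, hf.2, hv, smul_zero]
  have hm₁ : ∀ z ∈ X, z.map T.toLinearMap T.injective ∈ Y := by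
    intro z hz
    induction z using Projectivization.ind with | h y hy =>
    rw [Projectivization.map_mk, hY.mk_mem_iff]
    exact hc₁ _ ((hX.mk_mem_iff hy).1 hz)
  have hm₂ : ∀ z ∈ Y, z.map T.symm.toLinearMap T.symm.injective ∈ X := by
    intro z hz
    induction z using Projectivization.ind with | h y hy =>
    rw [Projectivization.map_mk, hX.mk_mem_iff]
    exact hc₂ _ ((hY.mk_mem_iff hy).1 hz)
  let φ : X ≃ Y :=
    { toFun := fun z => ⟨_, hm₁ z.1 z.2⟩
      invFun := fun z => ⟨_, hm₂ z.1 z.2⟩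
      left_inv := by
        rintro ⟨z, hz⟩
        induction z using Projectivization.ind with | h y hy =>
        simp [Projectivization.map_mk]
      right_inv := by
        rintro ⟨z, hz⟩
        induction z using Projectivization.ind with | h y hy =>
        simp [Projectivization.map_mk] }
  have hrep : ∀ z : Projectivization ℂ V, z.map T.toLinearMap T.injective =
      Projectivization.mk ℂ (T z.rep) (by simpa using z.rep_nonzero) := fun z => by
    conv_lhs => rw [← z.mk_rep]
    rfl
  have hrep' : ∀ z : Projectivization ℂ W, z.map T.symm.toLinearMap T.symm.injective =
      Projectivization.mk ℂ (T.symm z.rep) (by simpa using z.rep_nonzero) := fun z => by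
    conv_lhs => rw [← z.mk_rep]
    rfl
  have key : ∀ (g : G) (h : H) (c : ℂˣ), (∀ y, T (ρ g • y) = c • σ h • T y) →
      ∀ z, Projectivization.map T.toLinearMap T.injective (ρ g • z) = σ h • z.map T.toLinearMap T.injective := by
    intro g h c hc z
    induction z using Projectivization.ind with | h y hy =>
    rw [Projectivization.smul_mk, Projectivization.map_mk, Projectivization.map_mk,
      Projectivization.smul_mk, Projectivization.mk_eq_mk_iff]
    exact ⟨c, (hc y).symm⟩
  have hcomp : ∀ (g : G) (h' : H), (∃ (k : I → ℂˣ) (k' : I' → ℂˣ) (c c₁ c₂ : ℂˣ),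
      (∀ y a, Ψ (ρ g • y) a = c * mon k (ex a) * Ψ y a) ∧
      (∀ y a, Ψ' (σ h' • y) a = c₁ * mon k' (ex' a) * Ψ' y a) ∧
      (∀ a, mon k (ex a) = c₂ * mon k' (ex' (e a)))) →
      ∀ z, Projectivization.map T.toLinearMap T.injective (ρ g • z) = σ h' • z.map T.toLinearMap T.injective := by
    rintro g h' ⟨k, k', c, c₁, c₂, hk, hk', hkk⟩
    refine key g h' (c * c₂ * c₁⁻¹) fun y => Ψ'.injective (funext fun a => ?_)
    obtain ⟨a, rfl⟩ := e.surjective a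
    rw [hT, hk, hkk, Units.smul_def, map_smul, Pi.smul_apply, hk', hT]
    have := c₁.ne_zero
    push_cast
    simp only [smul_eq_mul]
    field_simp
  refine ⟨φ, fun x => ⟨1, T, isHomogPolyMap_linear T.toLinearMap, by simpa using x.1.rep_nonzero,
    fun y h => hrep y.1⟩, fun x => ⟨1, T.symm, isHomogPolyMap_linear T.symm.toLinearMap,
    by simpa using x.1.rep_nonzero, fun y h => hrep' y.1⟩, fun g => ?_, fun h => ?_⟩
  · obtain ⟨k, c, hk⟩ := hX.torus_to g
    obtain ⟨k', c₂, hkk⟩ := h₁ k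
    obtain ⟨h', c₁, hk'⟩ := hY.torus_from k'
    refine ⟨h', fun x y hxy => ?_⟩
    change σ h' • x.1.map _ T.injective = y.1.map _ T.injective
    rw [← hxy, hcomp g h' ⟨k, k', c, c₁, c₂, hk, hk', hkk⟩]
  · obtain ⟨k', c₁, hk'⟩ := hY.torus_to h
    obtain ⟨k, c₂, hkk⟩ := h₂ k'
    obtain ⟨g, c, hk⟩ := hX.torus_from k
    refine ⟨g, fun x y hxy => ?_⟩
    change σ h • x.1.map _ T.injective = y.1.map _ T.injective at hxy
    rw [← hcomp g h ⟨k, k', c, c₁, c₂⁻¹, hk, hk', fun a => by simp [hkk]⟩] at hxy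
    exact Projectivization.map_injective _ T.injective hxy

/-- `h` takes only one value on the exponents in `S`. -/
def ConstOn (ex : A → I → ℕ) (h : I → ℂˣ) (S : Set A) : Prop :=
  ∀ a ∈ S, ∀ b ∈ S, mon h (ex a) = mon h (ex b)

/-- The support of a point in the coordinates `Ψ`. -/
def pointSupport (Ψ : V ≃ₗ[ℂ] (A → ℂ)) (z : Projectivization ℂ V) : Set A := {a | Ψ z.rep a ≠ 0}

/-- The stabilizer of `x` is contained in the stabilizer of `y`. -/
def StabLE (ρ : G →* LinearMap.GeneralLinearGroup ℂ V) (x y : Projectivization ℂ V) : Prop :=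
  ∀ g, ρ g • x = x → ρ g • y = y

theorem StabLE.trans {x y z : Projectivization ℂ V} (h : StabLE ρ x y) (h' : StabLE ρ y z) :
    StabLE ρ x z := fun g hg => h' g (h g hg)

/-- A diagonal transformation fixes a point of projective space exactly when its eigenvalues agree
on the nonzero coordinates. Inclusions of stabilizers can thus be read off supports. -/
theorem smul_eq_self_iff_constOn {g : G} {h : I → ℂˣ} {c : ℂˣ}
    (hc : ∀ y a, Ψ (ρ g • y) a = c * mon h (ex a) * Ψ y a) (z : Projectivization ℂ V) :
    ρ g • z = z ↔ ConstOn ex h (pointSupport Ψ z) := by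
  rw [smul_eq_iff]
  constructor
  · rintro ⟨k, hk⟩ a ha b hb
    have key : ∀ a ∈ pointSupport Ψ z, (c : ℂ) * mon h (ex a) = k := by
      intro a ha
      have := hc z.rep a
      rw [hk, Units.smul_def, map_smul, Pi.smul_apply, smul_eq_mul] at this
      exact (mul_right_cancel₀ ha this).symm
    have := (key a ha).trans (key b hb).symm
    exact Units.ext (mul_left_cancel₀ c.ne_zero this)
  · intro hcon
    obtain ⟨a, ha⟩ : ∃ a, a ∈ pointSupport Ψ z := by
      by_contra! hne
      refine z.rep_nonzero (Ψ.injective (funext fun a => ?_))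
      simpa [pointSupport] using hne a
    refine ⟨c * mon h (ex a), Ψ.injective (funext fun b => ?_)⟩
    rw [hc, Units.smul_def, map_smul, Pi.smul_apply, smul_eq_mul]
    by_cases hb : Ψ z.rep b = 0
    · simp [hb]
    · rw [hcon a ha b hb]
      simp

theorem IsToricModel.stabLE_iff (hX : IsToricModel X ρ ex Ψ) (x y : Projectivization ℂ V) :
    StabLE ρ x y ↔
      ∀ h : I → ℂˣ, ConstOn ex h (pointSupport Ψ x) → ConstOn ex h (pointSupport Ψ y) := by
  constructor
  · intro H h hx
    obtain ⟨g, c, hc⟩ := hX.torus_from h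
    rw [← smul_eq_self_iff_constOn hc] at hx ⊢
    exact H g hx
  · intro H g hx
    obtain ⟨h, c, hc⟩ := hX.torus_to g
    rw [smul_eq_self_iff_constOn hc] at hx ⊢
    exact H h hx

/-- The element `g` matched with `h` fixes `x₁`, hence `x₂`, and the matching carries this back to
`Y`. The preorder of stabilizers is thus visible from the torus actions alone. -/
theorem stabLE_map {φ : X ≃ Y} (hY : ∀ (h : H), ∀ y ∈ Y, σ h • y ∈ Y)
    (hφ : ∀ h : H, ∃ g : G, ∀ x y : X, σ h • (φ x).1 = (φ y).1 → ρ g • x.1 = y.1) {x₁ x₂ : X}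
    (hx : StabLE ρ x₁.1 x₂.1) : StabLE σ (φ x₁).1 (φ x₂).1 := by
  intro h hh
  obtain ⟨g, hg⟩ := hφ h
  have e₁ := hx g (hg x₁ x₁ hh)
  -- `hφ` only compares points of `X`, so the translate of `φ x₂` is first pulled back to `X`.
  let y₂ : X := φ.symm ⟨σ h • (φ x₂).1, hY h _ (φ x₂).2⟩
  have e₂ : ρ g • x₂.1 = y₂.1 := hg x₂ y₂ (by simp [y₂])
  have : y₂ = x₂ := Subtype.ext (e₂.symm.trans e₁)
  have e₃ : (φ y₂).1 = σ h • (φ x₂).1 := by simp [y₂]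
  rw [← e₃, this]

/-- The facets of a lattice polytope with lattice points `ex`: `s e` is the lattice distance to the
facet `e`, and a point with positive distance to all facets involves all lattice points. -/
structure FacetData {E : Type*} (ex : A → I → ℕ) (s : E → A → ℕ) : Prop where
  cochar : ∀ e, ∃ (ν : I → ℤ) (k : ℤ), ∀ a, (s e a : ℤ) = k + ∑ i, ν i * ex a i
  zero : ∀ e, ∃ a, s e a = 0
  pos : ∀ e, ∃ a, s e a ≠ 0
  full : ∀ u : E → A, (∀ e, s e (u e) ≠ 0) → ∀ a, ∃ M N : Multiset A, a ∈ M ∧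
    (∀ b ∈ N, ∃ e, b = u e) ∧ M.card = N.card ∧ (M.map ex).sum = (N.map ex).sum

theorem mon_cochar (ν : I → ℤ) (t : ℂˣ) (a : I → ℕ) :
    mon (fun i => t ^ ν i) a = t ^ (∑ i, ν i * a i) := by
  rw [mon]
  simp only [← zpow_natCast, ← zpow_mul]
  exact (map_sum (zmultiplesHom (Additive ℂˣ) (Additive.ofMul t)) _ _).symm

theorem multiset_prod_mem_polyFun (M : Multiset A) :
    (fun y : A → ℂ => (M.map y).prod) ∈ polyFun (A → ℂ) := by
  induction M using Multiset.induction with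
  | empty =>
    simp only [Multiset.map_zero, Multiset.prod_zero]
    exact (polyFun (A → ℂ)).one_mem
  | cons a M ih =>
    simp only [Multiset.map_cons, Multiset.prod_cons]
    exact (polyFun (A → ℂ)).mul_mem (dual_mem_polyFun (LinearMap.proj (R := ℂ) (φ := fun _ : A => ℂ) a)) ih

theorem polyFun_isHomog {d : ℕ} {f : V → ℂ} (hf : f ∈ polyFun V)
    (hd : ∀ (c : ℂ) y, f (c • y) = c ^ d * f y) : IsHomogPolyMap d f := by
  refine ⟨fun ψ => ?_, hd⟩
  have : (fun y => ψ (f y)) = ψ 1 • f := by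
    funext y
    rw [Pi.smul_apply, smul_eq_mul, mul_comm, ← smul_eq_mul, ← map_smul, smul_eq_mul, mul_one]
  rw [this]
  exact (polyFun V).smul_mem hf _

theorem mon_multiset_prod (h : I → ℂˣ) (M : Multiset A) :
    (M.map fun a => mon h (ex a)).prod = mon h (M.map ex).sum := by
  induction M using Multiset.induction with
  | empty => simp [mon]
  | cons a M ih =>
    simp only [Multiset.map_cons, Multiset.prod_cons, ih, Multiset.sum_cons]
    simp only [mon, Pi.add_apply, pow_add, Finset.prod_mul_distrib]

/-- These are the binomials of the toric ideal: equal cardinalities make the difference homogeneous,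
equal sums of exponents make it vanish on the torus. -/
theorem torusCone_binomial {y : A → ℂ} (hy : y ∈ torusCone ex) {M N : Multiset A}
    (hc : M.card = N.card) (hs : (M.map ex).sum = (N.map ex).sum) :
    (M.map y).prod = (N.map y).prod := by
  have := hy M.card (fun y => (M.map y).prod - (N.map y).prod)
    (polyFun_isHomog ((polyFun _).sub_mem (multiset_prod_mem_polyFun M)
      (multiset_prod_mem_polyFun N)) fun c y => ?_) fun h => ?_
  · exact sub_eq_zero.1 this
  · have e : ∀ M : Multiset A, (M.map (c • y)).prod = c ^ M.card * (M.map y).prod := fun M => by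
      simp [Multiset.prod_map_mul]
    rw [e, e, hc, mul_sub]
  · have e : ∀ M : Multiset A, (M.map fun a => (mon h (ex a) : ℂ)).prod =
        (mon h (M.map ex).sum : ℂ) := fun M => by
      rw [← mon_multiset_prod, ← Units.coeHom_apply, map_multiset_prod, Multiset.map_map]
      rfl
    rw [e, e, hs, sub_self]

variable {E : Type*} {s : E → A → ℕ}

/-- If the support contained a point `u e` off each facet `e`, the relation in `FacetData.full`
would equate a product with the factor `y a` and a product of nonzero coordinates, so no coordinate
could vanish. -/
theorem FacetData.exists_supp_subset (hE : FacetData ex s) (hX : IsToricModel X ρ ex Ψ)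
    {z : Projectivization ℂ V} (hz : z ∈ X) (hne : pointSupport Ψ z ≠ Set.univ) :
    ∃ e, ∀ a ∈ pointSupport Ψ z, s e a = 0 := by
  by_contra! hcon
  choose u hu hu' using hcon
  refine hne (Set.eq_univ_of_forall fun a => ?_)
  obtain ⟨M, N, ha, hN, hc, hs⟩ := hE.full u hu' a
  have := torusCone_binomial ((hX.mem_iff z).1 hz) hc hs
  intro h0
  rw [Multiset.prod_eq_zero (Multiset.mem_map.2 ⟨a, ha, h0⟩)] at this
  obtain ⟨b, hb, hb0⟩ := Multiset.mem_map.1 (Multiset.prod_eq_zero_iff.1 this.symm)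
  obtain ⟨e, rfl⟩ := hN b hb
  exact hu e hb0

/-- The one-parameter subgroup normal to the facet, suitably rescaled, acts on the coordinate at `a`
by `t ^ s e a`; the indicator is its limit for t → 0. -/
theorem FacetData.indicator_mem_torusCone [Finite A] (hE : FacetData ex s) (e : E) :
    (fun a => if s e a = 0 then (1 : ℂ) else 0) ∈ torusCone ex := by
  intro d f hf hv
  obtain ⟨ν, k, hk⟩ := hE.cochar e
  have := polyFun_curve_eq_zero hf.mem_polyFun (fun a => Polynomial.X ^ s e a)
    (Set.finite_singleton 0) (fun t ht => ?_) 0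
  · convert this using 2
    funext a
    simp [zero_pow_eq]
  · lift t to ℂˣ using IsUnit.mk0 t ht
    have h := hv fun i => t ^ ν i
    have e : (fun a => Polynomial.eval (t : ℂ) (Polynomial.X ^ s e a)) =
        ((t ^ k : ℂˣ) : ℂ) • fun a => (mon (fun i => t ^ ν i) (ex a) : ℂ) := by
      funext a
      rw [Pi.smul_apply, smul_eq_mul, mon_cochar, ← Units.val_mul, ← zpow_add, ← hk]
      simp
    rw [e, hf.2, h, smul_zero]

theorem FacetData.exists_point [Finite A] (hE : FacetData ex s) (hX : IsToricModel X ρ ex Ψ)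
    (e : E) : ∃ z ∈ X, pointSupport Ψ z = {a | s e a = 0} := by
  have hne : Ψ.symm (fun a => if s e a = 0 then (1 : ℂ) else 0) ≠ 0 := by
    obtain ⟨a, ha⟩ := hE.zero e
    intro h
    simpa [ha] using congrFun ((LinearEquiv.symm_apply_eq _).1 h) a
  refine ⟨_, (hX.mk_mem_iff hne).2 ?_, ?_⟩
  · simpa using hE.indicator_mem_torusCone e
  · obtain ⟨c, hc⟩ := Projectivization.exists_smul_eq_mk_rep ℂ _ hne
    ext a
    simp [pointSupport, ← hc, Units.smul_def]

/-- The cocharacter of the facet is evaluated at 2, an element of infinite order, so that distinct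
distances give distinct values. -/
theorem FacetData.cochar_const (hE : FacetData ex s) (e : E) : ∃ h : I → ℂˣ,
    ∀ a b, mon h (ex a) = mon h (ex b) ↔ s e a = s e b := by
  obtain ⟨ν, k, hk⟩ := hE.cochar e
  refine ⟨fun i => Units.mk0 2 two_ne_zero ^ ν i, fun a b => ?_⟩
  have h2 : Function.Injective fun n : ℤ => (Units.mk0 (2 : ℂ) two_ne_zero) ^ n := by
    intro x y hxy
    have : ((2 : ℝ) : ℂ) ^ x = ((2 : ℝ) : ℂ) ^ y := by simpa using congrArg Units.val hxy
    exact zpow_right_injective₀ (a := (2 : ℝ)) (by norm_num) (by norm_num)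
      (by exact_mod_cast this)
  rw [mon_cochar, mon_cochar, h2.eq_iff]
  have := hk a
  have := hk b
  omega

theorem torusCone_one [Finite A] : (fun _ : A => (1 : ℂ)) ∈ torusCone ex := by
  intro d f hf hv
  simpa [mon] using hv 1

theorem IsToricModel.exists_generic [Finite A] [Nonempty A] (hX : IsToricModel X ρ ex Ψ) :
    ∃ z ∈ X, pointSupport Ψ z = Set.univ := by
  have hne : Ψ.symm (fun _ => (1 : ℂ)) ≠ 0 := by
    intro h
    simpa using congrFun ((LinearEquiv.symm_apply_eq _).1 h) (Classical.arbitrary A)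
  refine ⟨_, (hX.mk_mem_iff hne).2 (by simpa using torusCone_one), ?_⟩
  obtain ⟨c, hc⟩ := Projectivization.exists_smul_eq_mk_rep ℂ _ hne
  ext a
  simp [pointSupport, ← hc, Units.smul_def]

/-- The number of facets is an invariant: it is the number of minimal nontrivial stabilizers. -/
theorem FacetData.card_le_of_toricIso {E' : Type*} {s' : E' → A' → ℕ} [Fintype E] [Fintype E']
    [Finite A] [Finite A'] [Nonempty A'] (hE : FacetData ex s) (hE' : FacetData ex' s')
    (hinc : ∀ f f', f ≠ f' → ∃ a b, s' f' a = 0 ∧ s' f' b = 0 ∧ s' f a ≠ s' f b)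
    (hX : IsToricModel X ρ ex Ψ) (hY : IsToricModel Y σ ex' Ψ') (iso : ToricIso X ρ Y σ) :
    Fintype.card E' ≤ Fintype.card E := by
  obtain ⟨φ, -, -, h₁, h₂⟩ := iso
  have fwd : ∀ {x₁ x₂ : X}, StabLE ρ x₁.1 x₂.1 → StabLE σ (φ x₁).1 (φ x₂).1 :=
    stabLE_map (fun h y hy => hY.smul_mem h hy) h₂
  have bwd : ∀ {y₁ y₂ : Y}, StabLE σ y₁.1 y₂.1 → StabLE ρ (φ.symm y₁).1 (φ.symm y₂).1 :=
    stabLE_map (φ := φ.symm) (fun h y hy => hX.smul_mem h hy)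
      (fun g => (h₁ g).imp fun h hh x y hxy => by simpa using hh _ _ hxy)
  choose z hzX hz using hE.exists_point hX
  choose y hyY hy using hE'.exists_point hY
  obtain ⟨y₀, hy₀Y, hy₀⟩ := hY.exists_generic
  have hbot : ∀ y, StabLE σ y₀ y := fun y => (hY.stabLE_iff _ _).2 fun h hh a _ b _ =>
    hh a (by simp [hy₀]) b (by simp [hy₀])
  -- A stabilizer larger than the generic one forces a proper support, hence a support inside a
  -- facet, and smaller supports have larger stabilizers.
  have hminY : ∀ x ∈ Y, ¬ StabLE σ x y₀ → ∃ f, StabLE σ (y f) x := by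
    intro x hx hn
    obtain ⟨f, hf⟩ := hE'.exists_supp_subset hY hx fun hu => hn ((hY.stabLE_iff _ _).2
      fun h hh a _ b _ => hh a (by simp [hu]) b (by simp [hu]))
    exact ⟨f, (hY.stabLE_iff _ _).2 fun h hh a ha b hb =>
      hh a (by rw [hy]; exact hf a ha) b (by rw [hy]; exact hf b hb)⟩
  have hyn : ∀ f, ¬ StabLE σ (y f) y₀ := by
    intro f hf
    obtain ⟨h, hh⟩ := hE'.cochar_const f
    have := (hY.stabLE_iff _ _).1 hf h fun a ha b hb => (hh a b).2 (by
      rw [hy] at ha hb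
      exact Eq.trans ha hb.symm)
    obtain ⟨a, ha⟩ := hE'.zero f
    obtain ⟨b, hb⟩ := hE'.pos f
    have := (hh a b).1 (this a (by simp [hy₀]) b (by simp [hy₀]))
    omega
  -- The facet stabilizers of `Y` form an antichain; for those of `X` this is not needed.
  have hinc' : ∀ f f', StabLE σ (y f) (y f') → f = f' := by
    intro f f' hf
    by_contra hne
    obtain ⟨a, b, ha, hb, hab⟩ := hinc f f' hne
    obtain ⟨h, hh⟩ := hE'.cochar_const f
    refine hab ((hh a b).1 ((hY.stabLE_iff _ _).1 hf h (fun a ha b hb => (hh a b).2 (by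
      rw [hy] at ha hb
      exact Eq.trans ha hb.symm)) a (by rw [hy]; exact ha) b (by rw [hy]; exact hb)))
  -- Pulled back to `X`, the facet point of `f` has support in some facet `e`. This choice is the
  -- map to be shown injective.
  have hsub : ∀ f, ∃ e, StabLE ρ (z e) (φ.symm ⟨y f, hyY f⟩).1 := by
    intro f
    obtain ⟨e, he⟩ := hE.exists_supp_subset hX (φ.symm ⟨y f, hyY f⟩).2 fun hu => by
      have hb : StabLE ρ (φ.symm ⟨y f, hyY f⟩).1 (φ.symm ⟨y₀, hy₀Y⟩).1 :=
        (hX.stabLE_iff _ _).2 fun h hh a _ b _ => hh a (by simp [hu]) b (by simp [hu])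
      exact hyn f (by simpa using fwd hb)
    exact ⟨e, (hX.stabLE_iff _ _).2 fun h hh a ha b hb =>
      hh a (by rw [hz]; exact he a ha) b (by rw [hz]; exact he b hb)⟩
  choose ε hε using hsub
  have hzn : ∀ e, ∃ f, StabLE σ (y f) (φ ⟨z e, hzX e⟩).1 := by
    intro e
    refine hminY _ (φ _).2 fun hb => ?_
    have hb' : StabLE ρ (z e) (φ.symm ⟨y₀, hy₀Y⟩).1 := by
      simpa using bwd (y₁ := φ ⟨z e, hzX e⟩) (y₂ := ⟨y₀, hy₀Y⟩) hb
    obtain ⟨h, hh⟩ := hE.cochar_const e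
    have hall : ∀ x ∈ X, StabLE ρ (z e) x := fun x hx => hb'.trans (by
      simpa using bwd (y₁ := ⟨y₀, hy₀Y⟩) (y₂ := φ ⟨x, hx⟩) (hbot _))
    obtain ⟨a, ha⟩ := hE.zero e
    have : Nonempty A := ⟨a⟩
    obtain ⟨x, hx, hxu⟩ := hX.exists_generic
    obtain ⟨b, hb⟩ := hE.pos e
    have := (hX.stabLE_iff _ _).1 (hall x hx) h (fun a ha b hb => (hh a b).2 (by
      rw [hz] at ha hb
      exact Eq.trans ha hb.symm)) a (by simp [hxu]) b (by simp [hxu])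
    have := (hh a b).1 this
    omega
  -- The image in `Y` of the facet point of `ε f` lies above some `y g`. If `ε f = ε f'`, then `y g`
  -- lies below both `y f` and `y f'`, and the antichain property gives `f = g = f'`.
  refine Fintype.card_le_of_injective ε fun f f' hff => ?_
  obtain ⟨g, hg⟩ := hzn (ε f)
  have e₁ : StabLE σ (y g) (y f) := hg.trans (by
    simpa using fwd (x₁ := ⟨z (ε f), hzX _⟩) (hε f))
  have e₂ : StabLE σ (y g) (y f') := hg.trans (by
    rw [hff]
    simpa using fwd (x₁ := ⟨z (ε f'), hzX _⟩) (hε f'))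
  rw [← hinc' _ _ e₁, ← hinc' _ _ e₂]

end Models
end Toric
end GTSchubert

namespace GTSchubert

/-! ### Order polytopes and chain polytopes -/

/-- Duality between lattices and tori: the linear part `M` transposes to a homomorphism of tori, and
the translation `k` becomes a common scalar. -/
theorem exists_mon_of_affine {I I' A : Type*} [Fintype I] [Fintype I'] {ex : A → I → ℕ}
    {ex' : A → I' → ℕ} (k : I → ℤ) (M : I → I' → ℤ)
    (hM : ∀ a i, (ex a i : ℤ) = k i + ∑ j, M i j * ex' a j) (h : I → ℂˣ) :
    ∃ (h' : I' → ℂˣ) (c : ℂˣ), ∀ a, mon h (ex a) = c * mon h' (ex' a) := by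
  refine ⟨fun j => ∏ i, h i ^ M i j, ∏ i, h i ^ k i, fun a => ?_⟩
  have hz : ∀ (x : ℂˣ) (f : I' → ℤ), x ^ (∑ j, f j) = ∏ j, x ^ f j := fun x f =>
    map_sum (zmultiplesHom (Additive ℂˣ) (Additive.ofMul x)) f Finset.univ
  simp only [mon, ← zpow_natCast, hM, zpow_add, hz, Finset.prod_mul_distrib, zpow_mul]
  congr 1
  rw [Finset.prod_comm]
  simp only [Finset.prod_zpow]

section Poset

variable (P : Type*) [PartialOrder P] (m : ℕ)

/-- The lattice points of the `m`-th dilate of the order polytope. -/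
abbrev OrderPt : Type _ := {x : P → ℕ // Monotone x ∧ ∀ c, x c ≤ m}

/-- The condition that all chain sums are at most `m`. -/
def ChainBound (p : P → ℕ) : Prop :=
  ∀ Γ : Finset P, IsChain (· ≤ ·) (Γ : Set P) → ∑ c ∈ Γ, p c ≤ m

/-- The lattice points of the `m`-th dilate of the chain polytope. -/
abbrev ChainPt : Type _ := {p : P → ℕ // ChainBound P m p}

instance [Finite P] : Finite (OrderPt P m) := by
  refine Finite.of_injective (β := P → Fin (m + 1))
    (fun x c => ⟨x.1 c, Nat.lt_succ_of_le (x.2.2 c)⟩) fun x y h => Subtype.ext (funext fun c => ?_)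
  simpa using congrFun h c

variable {P m}

theorem ChainBound.le {p : P → ℕ} (hp : ChainBound P m p) (c : P) : p c ≤ m := by
  simpa using hp {c} (by simp)

variable (P m) in
instance [Finite P] : Finite (ChainPt P m) := by
  refine Finite.of_injective (β := P → Fin (m + 1))
    (fun x c => ⟨x.1 c, Nat.lt_succ_of_le (x.2.le c)⟩) fun x y h => Subtype.ext (funext fun c => ?_)
  simpa using congrFun h c

variable [Fintype P]

open Classical in
-- A maximal element strictly below `c` is the only element covered by `c`, since everything below
-- `c` is a chain; `none` stands for a minimal `c`.
theorem exists_pred (c : P) (hc : IsChain (· ≤ ·) (Set.Iic c)) : ∃ o : Option P,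
    Finset.univ.filter (· ≤ c) = insert c (o.elim ∅ fun d => Finset.univ.filter (· ≤ d)) ∧
      (∀ d ∈ o, d < c) := by
  by_cases h : ∃ d, d < c
  · obtain ⟨d, hd⟩ := (Set.toFinite {d | d < c}).exists_maximal h
    refine ⟨some d, ?_, ?_⟩
    · ext e
      simp only [Option.elim_some, Finset.mem_insert, Finset.mem_filter, Finset.mem_univ, true_and]
      constructor
      · intro he
        rcases he.lt_or_eq with he | he
        · rcases hc.total (Set.mem_Iic.2 he.le) (Set.mem_Iic.2 (le_of_lt hd.1)) with h | h
          · exact Or.inr h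
          · exact Or.inr (hd.2 he h)
        · exact Or.inl he
      · rintro (rfl | h)
        · exact le_rfl
        · exact h.trans (le_of_lt hd.1)
    · rintro _ ⟨⟩
      exact hd.1
  · refine ⟨none, ?_, by simp⟩
    push Not at h
    ext e
    simp only [Finset.mem_filter, Finset.mem_univ, true_and, Option.elim_none,
      insert_empty_eq, Finset.mem_singleton]
    exact ⟨fun he => he.lt_or_eq.resolve_left (h e), fun h => h.le⟩

open Classical in
theorem exists_succ (c : P) (hc : IsChain (· ≤ ·) (Set.Ici c)) : ∃ o : Option P,
    Finset.univ.filter (c ≤ ·) = insert c (o.elim ∅ fun d => Finset.univ.filter (d ≤ ·)) ∧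
      (∀ d ∈ o, c < d) :=
  exists_pred (P := Pᵒᵈ) c hc.symm

open Classical in
/-- If the elements are split into an upper set that is a chain and a lower set in which all
principal lower sets are chains, then the order polytope and the chain polytope are unimodularly
equivalent. -/
theorem exists_transfer (B : Set P) (hBu : IsUpperSet B) (hBc : IsChain (· ≤ ·) B)
    (hBl : ∀ c ∉ B, IsChain (· ≤ ·) (Set.Iic c)) :
    ∃ e : OrderPt P m ≃ ChainPt P m,
      (∀ h : P → ℂˣ, ∃ (h' : P → ℂˣ) (k : ℂˣ), ∀ a, mon h a.1 = k * mon h' (e a).1) ∧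
      (∀ h : P → ℂˣ, ∃ (h' : P → ℂˣ) (k : ℂˣ), ∀ a, mon h (e a).1 = k * mon h' a.1) := by
  have hup : ∀ c : P, ∃ o : Option P, c ∈ B →
      Finset.univ.filter (c ≤ ·) = insert c (o.elim ∅ fun d => Finset.univ.filter (d ≤ ·)) ∧
      (∀ d ∈ o, c < d) := by
    intro c
    by_cases hc : c ∈ B
    · obtain ⟨o, ho⟩ := exists_succ c (hBc.mono fun d hd => hBu hd hc)
      exact ⟨o, fun _ => ho⟩
    · exact ⟨none, fun h => absurd h hc⟩
  have hdn : ∀ c : P, ∃ o : Option P, c ∉ B →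
      Finset.univ.filter (· ≤ c) = insert c (o.elim ∅ fun d => Finset.univ.filter (· ≤ d)) ∧
      (∀ d ∈ o, d < c) := by
    intro c
    by_cases hc : c ∈ B
    · exact ⟨none, fun h => absurd hc h⟩
    · obtain ⟨o, ho⟩ := exists_pred c (hBl c hc)
      exact ⟨o, fun _ => ho⟩
  choose up hup using hup
  choose dn hdn using hdn
  have sum_dn : ∀ c ∉ B, ∀ p : P → ℕ, ∑ d with d ≤ c, p d =
      p c + (dn c).elim 0 fun d => ∑ e with e ≤ d, p e := by
    intro c hc p
    obtain ⟨h, h'⟩ := hdn c hc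
    rw [h]
    cases ho : dn c with
    | none => simp
    | some d =>
      rw [Finset.sum_insert]
      · rfl
      · simpa using (h' d ho).not_ge
  have sum_up : ∀ c ∈ B, ∀ p : P → ℕ, ∑ d with c ≤ d, p d =
      p c + (up c).elim 0 fun d => ∑ e with d ≤ e, p e := by
    intro c hc p
    obtain ⟨h, h'⟩ := hup c hc
    rw [h]
    cases ho : up c with
    | none => simp
    | some d =>
      rw [Finset.sum_insert]
      · rfl
      · simpa using (h' d ho).not_ge
  -- Stanley's transfer map, cut along `B`: sums from the bottom outside `B`, complements in `m` of
  -- sums from the top on `B`. The inverse `G` takes differences along covers, where a missing upper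
  -- neighbour has the value `m` and a missing lower one the value 0.
  let F : (P → ℕ) → P → ℕ := fun p c =>
    if c ∈ B then m - ∑ d with c ≤ d, p d else ∑ d with d ≤ c, p d
  let G : (P → ℕ) → P → ℕ := fun x c =>
    if c ∈ B then (up c).elim m x - x c else x c - (dn c).elim 0 x
  have hchB : ∀ c ∈ B, IsChain (· ≤ ·) ((Finset.univ.filter (c ≤ ·) : Finset P) : Set P) :=
    fun c hc => hBc.mono fun d hd => hBu (by simpa using hd) hc
  have hchN : ∀ c ∉ B, IsChain (· ≤ ·) ((Finset.univ.filter (· ≤ c) : Finset P) : Set P) :=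
    fun c hc => (hBl c hc).mono fun d hd => by simpa using hd
  have hF : ∀ p, ChainBound P m p → Monotone (F p) ∧ ∀ c, F p c ≤ m := by
    intro p hp
    refine ⟨fun c d hcd => ?_, fun c => ?_⟩
    · by_cases hc : c ∈ B
      · have hd := hBu hcd hc
        simp only [F, hc, hd, if_true]
        refine Nat.sub_le_sub_left (Finset.sum_le_sum_of_subset fun e he => ?_) _
        simp only [Finset.mem_filter, Finset.mem_univ, true_and] at he ⊢
        exact hcd.trans he
      · by_cases hd : d ∈ B
        · simp only [F, hc, hd, if_true, if_false]
          -- Across the cut, the elements below `c` and those above `d` together form one chain,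
          -- whose sum is at most `m`.
          refine Nat.le_sub_of_add_le ?_
          rw [← Finset.sum_union]
          · refine hp _ ?_
            intro a ha b hb hab
            simp only [Finset.coe_union, Finset.coe_filter, Finset.mem_univ, true_and,
              Set.mem_union, Set.mem_ofPred_eq] at ha hb
            rcases ha with ha | ha <;> rcases hb with hb | hb
            · exact hBl c hc ha hb hab
            · exact Or.inl (ha.trans (hcd.trans hb))
            · exact Or.inr (hb.trans (hcd.trans ha))
            · exact hBc (hBu ha hd) (hBu hb hd) hab
          · rw [Finset.disjoint_left]
            intro e he he'
            simp only [Finset.mem_filter, Finset.mem_univ, true_and] at he he'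
            exact hc (hBu he (hBu he' hd))
        · simp only [F, hc, hd, if_false]
          refine Finset.sum_le_sum_of_subset fun e he => ?_
          simp only [Finset.mem_filter, Finset.mem_univ, true_and] at he ⊢
          exact he.trans hcd
    · by_cases hc : c ∈ B
      · simp [F, hc]
      · simp only [F, hc, if_false]
        exact hp _ (hchN c hc)
  have hFG : ∀ x : P → ℕ, Monotone x → (∀ c, x c ≤ m) →
      (∀ c ∉ B, ∑ d with d ≤ c, G x d = x c) ∧ (∀ c ∈ B, ∑ d with c ≤ d, G x d = m - x c) := by
    intro x hx hxm
    constructor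
    · intro c
      induction c using (wellFounded_lt (α := P)).induction with | _ c ih =>
      intro hc
      rw [sum_dn c hc]
      have h' := (hdn c hc).2
      cases ho : dn c with
      | none => simp [G, hc, ho]
      | some d =>
        have hdc := h' d ho
        simp only [Option.elim_some]
        rw [ih d hdc fun hd => hc (hBu hdc.le hd)]
        simp only [G, hc, if_false, ho, Option.elim_some]
        have := hx hdc.le
        omega
    · intro c
      induction c using (wellFounded_gt (α := P)).induction with | _ c ih =>
      intro hc
      rw [sum_up c hc]
      have h' := (hup c hc).2
      cases ho : up c with
      | none => simp [G, hc, ho]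
      | some d =>
        have hdc := h' d ho
        simp only [Option.elim_some]
        rw [ih d hdc (hBu hdc.le hc)]
        simp only [G, hc, if_true, ho, Option.elim_some]
        have := hx hdc.le
        have := hxm d
        omega
  -- The part of a chain outside `B` telescopes to at most `x` at its top, the part in `B` to at
  -- most `m - x` at its bottom, and `x` increases from the former to the latter.
  have hG : ∀ x : P → ℕ, Monotone x → (∀ c, x c ≤ m) → ChainBound P m (G x) := by
    intro x hx hxm Γ hΓ
    obtain ⟨h₁, h₂⟩ := hFG x hx hxm
    have hB : Γ.filter (· ∈ B) = ∅ ∨ ∃ d ∈ Γ.filter (· ∈ B), ∀ e ∈ Γ.filter (· ∈ B), d ≤ e := by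
      rcases Finset.eq_empty_or_nonempty (Γ.filter (· ∈ B)) with h | h
      · exact Or.inl h
      · obtain ⟨d, hd⟩ := (Γ.filter (· ∈ B)).exists_minimal h
        refine Or.inr ⟨d, hd.1, fun e he => ?_⟩
        rcases hΓ.total (Finset.mem_filter.1 hd.1).1 (Finset.mem_filter.1 he).1 with h | h
        · exact h
        · exact hd.2 he h
    have hN : Γ.filter (· ∉ B) = ∅ ∨ ∃ d ∈ Γ.filter (· ∉ B), ∀ e ∈ Γ.filter (· ∉ B), e ≤ d := by
      rcases Finset.eq_empty_or_nonempty (Γ.filter (· ∉ B)) with h | h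
      · exact Or.inl h
      · obtain ⟨d, hd⟩ := (Γ.filter (· ∉ B)).exists_maximal h
        refine Or.inr ⟨d, hd.1, fun e he => ?_⟩
        rcases hΓ.total (Finset.mem_filter.1 he).1 (Finset.mem_filter.1 hd.1).1 with h | h
        · exact h
        · exact hd.2 he h
    have hlt : ∀ c ∉ B, ∀ d ∈ B, c ∈ Γ → d ∈ Γ → x c ≤ x d := by
      intro c hc d hd hcΓ hdΓ
      rcases hΓ.total hcΓ hdΓ with h | h
      · exact hx h
      · exact absurd (hBu h hd) hc
    have sB : ∀ d ∈ Γ.filter (· ∈ B), (∀ e ∈ Γ.filter (· ∈ B), d ≤ e) →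
        ∑ e ∈ Γ with e ∈ B, G x e ≤ m - x d := by
      intro d hd h
      rw [← h₂ d (Finset.mem_filter.1 hd).2]
      exact Finset.sum_le_sum_of_subset fun e he => by simpa using h e he
    have sN : ∀ d ∈ Γ.filter (· ∉ B), (∀ e ∈ Γ.filter (· ∉ B), e ≤ d) →
        ∑ e ∈ Γ with e ∉ B, G x e ≤ x d := by
      intro d hd h
      rw [← h₁ d (Finset.mem_filter.1 hd).2]
      exact Finset.sum_le_sum_of_subset fun e he => by simpa using h e he
    rw [← Finset.sum_filter_add_sum_filter_not Γ (· ∈ B)]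
    rcases hB with hB | ⟨d, hd, hd'⟩ <;> rcases hN with hN | ⟨c, hc, hc'⟩
    · simp [hB, hN]
    · have := sN c hc hc'
      have := hxm c
      rw [hB, Finset.sum_empty]
      omega
    · have := sB d hd hd'
      rw [hN, Finset.sum_empty]
      omega
    · have := sN c hc hc'
      have := sB d hd hd'
      have := hlt c (Finset.mem_filter.1 hc).2 d (Finset.mem_filter.1 hd).2
        (Finset.mem_filter.1 hc).1 (Finset.mem_filter.1 hd).1
      have := hxm d
      omega
  have hGF : ∀ p, ChainBound P m p → G (F p) = p := by
    intro p hp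
    funext c
    by_cases hc : c ∈ B
    · have h := sum_up c hc p
      have h' := (hup c hc).2
      have hle := hp _ (hchB c hc)
      simp only [G, hc, if_true]
      cases ho : up c with
      | none => simp only [ho, Option.elim_none, F, hc, if_true] at h ⊢; omega
      | some d =>
        have hd : d ∈ B := hBu (h' d ho).le hc
        simp only [ho, Option.elim_some, F, hc, hd, if_true] at h ⊢
        omega
    · have h := sum_dn c hc p
      have h' := (hdn c hc).2
      simp only [G, hc, if_false]
      cases ho : dn c with
      | none => simp only [ho, Option.elim_none, F, hc, if_false] at h ⊢; omega
      | some d =>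
        have hd : d ∉ B := fun hd => hc (hBu (h' d ho).le hd)
        simp only [ho, Option.elim_some, F, hc, hd, if_false] at h ⊢
        omega
  let e : OrderPt P m ≃ ChainPt P m :=
    { toFun := fun x => ⟨G x.1, hG x.1 x.2.1 x.2.2⟩
      invFun := fun p => ⟨F p.1, hF p.1 p.2⟩
      left_inv := fun x => by
        refine Subtype.ext (funext fun c => ?_)
        obtain ⟨h₁, h₂⟩ := hFG x.1 x.2.1 x.2.2
        by_cases hc : c ∈ B
        · have := x.2.2 c
          simp only [F, hc, if_true, h₂ c hc]
          omega
        · simp only [F, hc, if_false, h₁ c hc]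
      right_inv := fun p => Subtype.ext (hGF p.1 p.2) }
  refine ⟨e, fun h => ?_, fun h => ?_⟩
  · refine exists_mon_of_affine (fun c => if c ∈ B then (m : ℤ) else 0)
      (fun c d => if c ∈ B then (if c ≤ d then -1 else 0) else if d ≤ c then 1 else 0)
      (fun x c => ?_) h
    obtain ⟨h₁, h₂⟩ := hFG x.1 x.2.1 x.2.2
    by_cases hc : c ∈ B
    · have := x.2.2 c
      have h₂ := congrArg (Nat.cast : ℕ → ℤ) (h₂ c hc)
      rw [Finset.sum_filter, Nat.cast_sum, Nat.cast_sub this] at h₂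
      simp only [hc, if_true, e, Equiv.coe_fn_mk, ite_mul, neg_mul, one_mul, zero_mul]
      have h3 : ∑ j, (if c ≤ j then -(G x.1 j : ℤ) else 0) =
          - ∑ j, ((if c ≤ j then G x.1 j else 0 : ℕ) : ℤ) := by
        rw [← Finset.sum_neg_distrib]
        exact Finset.sum_congr rfl fun j _ => by split_ifs <;> simp
      rw [h3, h₂]
      ring
    · have h₁ := congrArg (Nat.cast : ℕ → ℤ) (h₁ c hc)
      rw [Finset.sum_filter, Nat.cast_sum] at h₁
      simp only [hc, if_false, e, Equiv.coe_fn_mk, ite_mul, one_mul, zero_mul, zero_add]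
      rw [← h₁]
      exact Finset.sum_congr rfl fun j _ => by split_ifs <;> simp
  · refine exists_mon_of_affine (fun c => if c ∈ B ∧ up c = none then (m : ℤ) else 0)
      (fun c d => if c ∈ B then (if up c = some d then 1 else 0) - (if d = c then 1 else 0)
        else (if d = c then 1 else 0) - (if dn c = some d then 1 else 0))
      (fun x c => ?_) h
    by_cases hc : c ∈ B
    · have h' := (hup c hc).2
      simp only [e, Equiv.coe_fn_mk, G, hc, if_true, true_and]
      cases ho : up c with
      | none =>
        simp [Nat.cast_sub (x.2.2 c)]
        ring
      | some d =>
        have hle := x.2.1 (h' d ho).le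
        simp [Nat.cast_sub hle, sub_mul, Finset.sum_sub_distrib]
    · have h' := (hdn c hc).2
      simp only [e, Equiv.coe_fn_mk, G, hc, if_false, false_and]
      cases ho : dn c with
      | none => simp
      | some d =>
        have hle := x.2.1 (h' d ho).le
        simp [Nat.cast_sub hle, sub_mul, Finset.sum_sub_distrib]

end Poset
end GTSchubert

namespace GTSchubert

/-! ### Integer decomposition of dilated chain and order polytopes -/

section Decomposition

variable {P : Type*} [PartialOrder P] {m : ℕ}

open Classical in
theorem chainBound_antichain (A : Finset P) (hA : IsAntichain (· ≤ ·) (A : Set P)) (k : ℕ) :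
    ChainBound P k (fun c => if c ∈ A then k else 0) := by
  intro Γ hΓ
  rw [← Finset.sum_filter, Finset.sum_const, smul_eq_mul]
  refine (Nat.mul_le_mul_right k (m := 1) ?_).trans_eq (one_mul k)
  rw [Finset.card_le_one]
  intro a ha b hb
  rw [Finset.mem_filter] at ha hb
  by_contra hab
  rcases hΓ.total ha.1 hb.1 with h | h
  · exact hA ha.2 hb.2 hab h
  · exact hA hb.2 ha.2 (Ne.symm hab) h

open Classical in
-- The antichain consists of the minimal elements of the support of `p`. A chain in the support of
-- the remainder can be prolonged downwards by such a minimal element, where one unit has been lost,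
-- so its sum drops below `m + 1`.
theorem ChainBound.exists_antichain [Finite P] {p : P → ℕ} (hp : ChainBound P (m + 1) p) :
    ∃ A : Finset P, IsAntichain (· ≤ ·) (A : Set P) ∧ (∀ c ∈ A, p c ≠ 0) ∧
      ChainBound P m (fun c => p c - if c ∈ A then 1 else 0) := by
  have := Fintype.ofFinite P
  refine ⟨Finset.univ.filter fun c => Minimal (fun c => p c ≠ 0) c, ?_, ?_, ?_⟩
  · simpa using setOfPred_minimal_antichain fun c => p c ≠ 0
  · intro c hc
    simp only [Finset.mem_filter, Finset.mem_univ, true_and] at hc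
    exact hc.1
  · intro Γ hΓ
    simp only [Finset.mem_filter, Finset.mem_univ, true_and]
    set q : P → ℕ := fun c => p c - if Minimal (fun c => p c ≠ 0) c then 1 else 0 with hq
    change ∑ c ∈ Γ, q c ≤ m
    rw [← Finset.sum_filter_ne_zero]
    rcases Finset.eq_empty_or_nonempty (Γ.filter fun c => q c ≠ 0) with h | h
    · simp [h]
    obtain ⟨c, hc⟩ := (Γ.filter fun c => q c ≠ 0).exists_minimal h
    have hc1 := Finset.mem_filter.1 hc.1
    have hcle : ∀ e ∈ Γ.filter fun c => q c ≠ 0, c ≤ e := fun e he => by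
      rcases hΓ.total hc1.1 (Finset.mem_filter.1 he).1 with h | h
      · exact h
      · exact hc.2 he h
    have hpc : p c ≠ 0 := fun h => hc1.2 (by simp [hq, h])
    obtain ⟨d, hdc, hd⟩ := (Set.toFinite {c | p c ≠ 0}).exists_le_minimal hpc
    have hd' : Minimal (fun c => p c ≠ 0) d := hd
    have hqle : ∀ e, q e ≤ p e := fun e => Nat.sub_le _ _
    have hqd : q d + 1 ≤ p d := by
      have : p d ≠ 0 := hd'.1
      simp only [hq, hd', if_true]
      omega
    have hch : IsChain (· ≤ ·) ((insert d (Γ.filter fun c => q c ≠ 0) : Finset P) : Set P) := by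
      rw [Finset.coe_insert]
      refine IsChain.insert (hΓ.mono fun e he => (Finset.mem_filter.1 he).1) fun e he _ =>
        Or.inl (hdc.trans (hcle e he))
    have h1 := hp _ hch
    have h2 : ∑ c ∈ Γ with q c ≠ 0, q c ≤ ∑ c ∈ insert d (Γ.filter fun c => q c ≠ 0), q c :=
      Finset.sum_le_sum_of_subset (Finset.subset_insert _ _)
    have h3 : ∑ c ∈ insert d (Γ.filter fun c => q c ≠ 0), q c <
        ∑ c ∈ insert d (Γ.filter fun c => q c ≠ 0), p c :=
      Finset.sum_lt_sum (fun e _ => hqle e) ⟨d, Finset.mem_insert_self _ _, hqd⟩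
    omega

open Classical in
/-- A point of the `m`-th dilate of the chain polytope is a sum of `m` antichains. -/
theorem ChainBound.exists_antichains [Finite P] {p : P → ℕ} (hp : ChainBound P m p) :
    ∃ f : Fin m → Finset P, (∀ j, IsAntichain (· ≤ ·) (f j : Set P)) ∧
      ∀ c, p c = ∑ j, if c ∈ f j then 1 else 0 := by
  induction m generalizing p with
  | zero => exact ⟨Fin.elim0, fun j => j.elim0, fun c => by simpa using hp.le c⟩
  | succ m ih =>
    obtain ⟨A, hA, hA0, hAp⟩ := hp.exists_antichain
    obtain ⟨f, hf, hfp⟩ := ih hAp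
    refine ⟨Fin.cons A f, fun j => ?_, fun c => ?_⟩
    · refine Fin.cases ?_ (fun j => ?_) j
      · simpa using hA
      · simpa using hf j
    · rw [Fin.sum_univ_succ]
      simp only [Fin.cons_zero, Fin.cons_succ]
      rw [← hfp c]
      by_cases hc : c ∈ A
      · have := hA0 c hc
        simp only [hc, if_true]
        omega
      · simp [hc]

open Classical in
theorem ChainBound.split [Finite P] {N : ℕ} {p : P → ℕ} (hp : ChainBound P (m + N) p) :
    ∃ p₁ p₂, p = p₁ + p₂ ∧ ChainBound P m p₁ ∧ ChainBound P N p₂ := by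
  obtain ⟨f, hf, hfp⟩ := hp.exists_antichains
  have key : ∀ (k : ℕ) (g : Fin k → Finset P), (∀ j, IsAntichain (· ≤ ·) (g j : Set P)) →
      ChainBound P k fun c => ∑ j, if c ∈ g j then 1 else 0 := by
    intro k g hg Γ hΓ
    rw [Finset.sum_comm]
    calc _ ≤ ∑ j : Fin k, 1 := Finset.sum_le_sum fun j _ => chainBound_antichain _ (hg j) 1 Γ hΓ
      _ = k := by simp
  exact ⟨_, _, funext fun c => by rw [hfp, Fin.sum_univ_add]; rfl,
    key m (fun j => f (Fin.castAdd N j)) fun j => hf _,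
    key N (fun j => f (Fin.natAdd m j)) fun j => hf _⟩

/-- Normality of the chain polytope, by splitting off `m` antichains at a time. -/
theorem ChainBound.exists_multiset [Finite P] {N : ℕ} {p : P → ℕ}
    (hp : ChainBound P (N * m) p) :
    ∃ M : Multiset (ChainPt P m), M.card = N ∧ (M.map Subtype.val).sum = p := by
  induction N generalizing p with
  | zero =>
    rw [Nat.zero_mul] at hp
    exact ⟨0, rfl, funext fun c => (Nat.le_zero.1 (hp.le c)).symm⟩
  | succ N ih =>
    rw [Nat.succ_mul, Nat.add_comm] at hp
    obtain ⟨p₁, p₂, rfl, h₁, h₂⟩ := hp.split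
    obtain ⟨M, hM, hs⟩ := ih h₂
    exact ⟨⟨p₁, h₁⟩ ::ₘ M, by simp [hM], by simp [hs]⟩

/-- Normality of the order polytope: the layer `min (x c) m` and the rest `x c - m` are both
monotone. -/
theorem exists_multiset_orderPt {N : ℕ} {x : P → ℕ} (hx : Monotone x) (hN : ∀ c, x c ≤ N * m) :
    ∃ M : Multiset (OrderPt P m), M.card = N ∧ (M.map Subtype.val).sum = x := by
  induction N generalizing x with
  | zero => exact ⟨0, rfl, funext fun c => by have := hN c; simp at this ⊢; omega⟩
  | succ N ih =>
    obtain ⟨M, hM, hs⟩ := ih (x := fun c => x c - m) (fun c d h => Nat.sub_le_sub_right (hx h) m)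
      fun c => by have := hN c; rw [Nat.succ_mul] at this; omega
    refine ⟨⟨fun c => min (x c) m, fun c d h => min_le_min_right m (hx h), fun c =>
      min_le_right _ _⟩ ::ₘ M, by simp [hM], ?_⟩
    rw [Multiset.map_cons, Multiset.sum_cons, hs]
    funext c
    simp only [Pi.add_apply]
    omega

end Decomposition

/-- This produces the relation required by `FacetData.full`. Once `m` copies of all `u e` minus `a`
decompose into `m * |E| - 1` exponents, these together with `a` balance the copies of the `u e`. -/
theorem exists_relation {A E I : Type*} [Fintype E] [Nonempty E] {ex : A → I → ℕ} {m : ℕ} (hm : 1 ≤ m)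
    (u : E → A) (a : A) (hle : ∀ c, ex a c ≤ m * ∑ e, ex (u e) c)
    (h : ∃ M : Multiset A, M.card = m * Fintype.card E - 1 ∧
      (M.map ex).sum = fun c => m * ∑ e, ex (u e) c - ex a c) :
    ∃ M N : Multiset A, a ∈ M ∧ (∀ b ∈ N, ∃ e, b = u e) ∧ M.card = N.card ∧
      (M.map ex).sum = (N.map ex).sum := by
  obtain ⟨M, hM, hs⟩ := h
  have hpos : 0 < m * Fintype.card E := Nat.mul_pos hm Fintype.card_pos
  refine ⟨a ::ₘ M, m • Finset.univ.val.map u, Multiset.mem_cons_self _ _, fun b hb => ?_, ?_, ?_⟩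
  · obtain ⟨e, -, he⟩ := Multiset.mem_map.1 (Multiset.mem_of_mem_nsmul hb)
    exact ⟨e, he.symm⟩
  · rw [Multiset.card_cons, hM, Multiset.card_nsmul, Multiset.card_map, Finset.card_val,
      Finset.card_univ]
    omega
  · rw [Multiset.map_cons, Multiset.sum_cons, hs, Multiset.map_nsmul, Multiset.sum_nsmul,
      Multiset.map_map]
    funext c
    have := hle c
    have e : (Multiset.map (ex ∘ u) Finset.univ.val).sum = ∑ e, ex (u e) := rfl
    rw [e]
    simp only [Pi.add_apply, Pi.smul_apply, Finset.sum_apply, smul_eq_mul]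
    omega

end GTSchubert

namespace GTSchubert

/-! ### Facets of the order polytope of a Young diagram -/

section Young

variable {D : Finset (ℕ × ℕ)} {m : ℕ}

/-- The cells of a diagram outside of its first row and first column. -/
abbrev InnerCell (D : Finset (ℕ × ℕ)) : Type := {c : D // 1 ≤ c.1.1 ∧ 1 ≤ c.1.2}

/-- The maximal cells of a diagram. -/
abbrev MaxCell (D : Finset (ℕ × ℕ)) : Type := {c : D // IsMax c}

/-- The value of `x` at a cell, and `0` outside of the diagram. -/
def cellVal (x : D → ℕ) (c : ℕ × ℕ) : ℕ := if h : c ∈ D then x ⟨c, h⟩ else 0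

theorem cellVal_eq_sum (x : D → ℕ) (c : ℕ × ℕ) :
    (cellVal x c : ℤ) = ∑ d : D, (if d.1 = c then 1 else 0) * (x d : ℤ) := by
  unfold cellVal
  split_ifs with h
  · rw [Finset.sum_eq_single ⟨c, h⟩]
    · simp
    · intro d _ hd
      rw [if_neg fun h => hd (Subtype.ext h), zero_mul]
    · simp
  · rw [Finset.sum_eq_zero]
    · rfl
    · intro d _
      rw [if_neg fun h' : d.1 = c => h (h' ▸ d.2), zero_mul]

/-- The value at the cell below, in a spanning tree of the diagram. -/
def treeVal (x : D → ℕ) (c : ℕ × ℕ) : ℕ :=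
  if 1 ≤ c.1 then cellVal x (c.1 - 1, c.2) else if 1 ≤ c.2 then cellVal x (0, c.2 - 1) else 0

/-- The distances to the facets of the order polytope. -/
def orderSlack (D : Finset (ℕ × ℕ)) (m : ℕ) :
    D ⊕ InnerCell D ⊕ MaxCell D → OrderPt D m → ℕ
  | .inl c, x => x.1 c - treeVal x.1 c.1
  | .inr (.inl b), x => x.1 b.1 - cellVal x.1 (b.1.1.1, b.1.1.2 - 1)
  | .inr (.inr c), x => m - x.1 c.1

theorem cell_le_iff (c d : D) : c ≤ d ↔ c.1.1 ≤ d.1.1 ∧ c.1.2 ≤ d.1.2 := Iff.rfl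

theorem cellVal_le {x : D → ℕ} (hx : Monotone x) (c : D) (d : ℕ × ℕ) (h : d ≤ c.1) :
    cellVal x d ≤ x c := by
  unfold cellVal
  split_ifs with hd
  · exact hx h
  · exact Nat.zero_le _

theorem treeVal_le {x : D → ℕ} (hx : Monotone x) (c : D) : treeVal x c.1 ≤ x c := by
  unfold treeVal
  split_ifs with h1 h2
  · exact cellVal_le hx c _ ⟨by simp, le_rfl⟩
  · exact cellVal_le hx c _ ⟨by simp, by simp⟩
  · exact Nat.zero_le _

/-- The tree contains all vertical covers and the horizontal ones in row 0; the horizontal covers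
ending at inner cells are the remaining ones. In a lower set, comparable cells are joined by covers,
so induction on the coordinate sum of the larger cell suffices. -/
theorem monotone_of_slack (hD : IsLowerSet (D : Set (ℕ × ℕ))) {y : D → ℕ}
    (h₁ : ∀ c : D, treeVal y c.1 ≤ y c)
    (h₂ : ∀ b : InnerCell D, cellVal y (b.1.1.1, b.1.1.2 - 1) ≤ y b.1) : Monotone y := by
  have key : ∀ (N : ℕ) (d : D), d.1.1 + d.1.2 = N → ∀ c : D, c ≤ d → y c ≤ y d := by
    intro N
    induction N with
    | zero =>
      intro d hd c hcd
      rw [cell_le_iff] at hcd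
      have : c = d := Subtype.ext (Prod.ext (by omega) (by omega))
      rw [this]
    | succ N ih =>
      intro d hd c hcd
      have hcd' := (cell_le_iff c d).1 hcd
      obtain ⟨⟨r, s⟩, hdD⟩ := d
      obtain ⟨⟨a, b⟩, hcD⟩ := c
      simp only at hd hcd'
      have go : ∀ (r' s' : ℕ) (hle : (r', s') ≤ (r, s)), r' + s' = N → a ≤ r' → b ≤ s' →
          cellVal y (r', s') ≤ y ⟨(r, s), hdD⟩ → y ⟨(a, b), hcD⟩ ≤ y ⟨(r, s), hdD⟩ := by
        intro r' s' hle hN ha hb hval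
        have hmem : (r', s') ∈ D := hD hle hdD
        rw [cellVal, dif_pos hmem] at hval
        exact (ih ⟨(r', s'), hmem⟩ hN _ ⟨ha, hb⟩).trans hval
      by_cases h : a = r ∧ b = s
      · obtain ⟨rfl, rfl⟩ := h
        exact le_rfl
      by_cases hr : 1 ≤ r ∧ a ≤ r - 1
      · refine go (r - 1) s ⟨by simp, le_rfl⟩ (by omega) hr.2 hcd'.2 ?_
        have := h₁ ⟨(r, s), hdD⟩
        rwa [treeVal, if_pos hr.1] at this
      · have hs : 1 ≤ s ∧ b ≤ s - 1 := by omega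
        refine go r (s - 1) ⟨le_rfl, by simp⟩ (by omega) hcd'.1 hs.2 ?_
        by_cases hr1 : 1 ≤ r
        · exact h₂ ⟨⟨(r, s), hdD⟩, hr1, hs.1⟩
        · have := h₁ ⟨(r, s), hdD⟩
          obtain rfl : r = 0 := by omega
          rwa [treeVal, if_neg (by simp), if_pos hs.1] at this
  exact fun c d h => key _ d rfl c h

theorem cellVal_sub_le {x y : D → ℕ} (c : ℕ × ℕ) : cellVal (fun d => x d - y d) c ≤ cellVal x c := by
  unfold cellVal
  split_ifs <;> simp

theorem cellVal_linear {E : Type*} [Fintype E] (m : ℕ) (u : E → D → ℕ) (c : ℕ × ℕ) :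
    cellVal (fun d => m * ∑ e, u e d) c = m * ∑ e, cellVal (u e) c := by
  unfold cellVal
  split_ifs <;> simp

theorem treeVal_sub_le {x y : D → ℕ} (c : ℕ × ℕ) : treeVal (fun d => x d - y d) c ≤ treeVal x c := by
  unfold treeVal
  split_ifs
  · exact cellVal_sub_le _
  · exact cellVal_sub_le _
  · exact le_rfl

theorem treeVal_linear {E : Type*} [Fintype E] (m : ℕ) (u : E → D → ℕ) (c : ℕ × ℕ) :
    treeVal (fun d => m * ∑ e, u e d) c = m * ∑ e, treeVal (u e) c := by
  unfold treeVal
  split_ifs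
  · exact cellVal_linear _ _ _
  · exact cellVal_linear _ _ _
  · simp

instance {P : Type*} [PartialOrder P] : Nonempty (ChainPt P m) := ⟨⟨fun _ => 0, fun _ _ => by simp⟩⟩

/-- The point of the order polytope that is `m` on the upper set generated by `c`. -/
def upperPt (m : ℕ) (c : D) : OrderPt D m :=
  ⟨fun d => if c ≤ d then m else 0, fun d e h => by
    by_cases hd : c ≤ d
    · simp [hd, hd.trans h]
    · simp [hd], fun d => by dsimp only; split_ifs <;> simp⟩

theorem cellVal_upperPt (c : D) (d : ℕ × ℕ) (h : ¬ c.1 ≤ d) : cellVal (upperPt m c).1 d = 0 := by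
  unfold cellVal
  split_ifs with hd
  · have : ¬ c ≤ ⟨d, hd⟩ := h
    simp [upperPt, this]
  · rfl

theorem treeVal_upperPt (c : D) : treeVal (upperPt m c).1 c.1 = 0 := by
  unfold treeVal
  split_ifs with h1 h2
  · exact cellVal_upperPt _ _ fun h => by have := h.1; simp at this; omega
  · exact cellVal_upperPt _ _ fun h => by have := h.2; simp at this; omega
  · rfl

open Classical in
-- The facets are the covering relations, the bound 0 at the origin and the bound `m` at the maximal
-- cells. Listing the covers by tree edges and inner cells makes their number comparable with |D|.
theorem facetData_order (hD : IsLowerSet (D : Set (ℕ × ℕ))) (hne : D.Nonempty) (hm : 1 ≤ m) :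
    FacetData (fun x : OrderPt D m => x.1) (orderSlack D m) where
  cochar := by
    have hs : ∀ (x : D → ℕ) (c : D), ((x c : ℕ) : ℤ) = ∑ d : D, (if d.1 = c.1 then 1 else 0) *
        (x d : ℤ) := fun x c => by rw [← cellVal_eq_sum]; simp [cellVal]
    have htree : ∀ c : ℕ × ℕ, ∃ ν : D → ℤ, ∀ x : D → ℕ, (treeVal x c : ℤ) = ∑ d, ν d * x d := by
      intro c
      unfold treeVal
      split_ifs
      · exact ⟨_, fun x => cellVal_eq_sum x _⟩
      · exact ⟨_, fun x => cellVal_eq_sum x _⟩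
      · exact ⟨0, fun x => by simp⟩
    rintro (c | b | c)
    · obtain ⟨ν, hν⟩ := htree c.1
      refine ⟨fun d => (if d.1 = c.1 then 1 else 0) - ν d, 0, fun x => ?_⟩
      simp only [orderSlack, Nat.cast_sub (treeVal_le x.2.1 c), sub_mul, Finset.sum_sub_distrib]
      rw [hν, hs x.1 c, zero_add]
    · refine ⟨fun d => (if d.1 = b.1.1 then 1 else 0) -
        (if d.1 = (b.1.1.1, b.1.1.2 - 1) then 1 else 0), 0, fun x => ?_⟩
      simp only [orderSlack, Nat.cast_sub (cellVal_le x.2.1 b.1 _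
        (show (b.1.1.1, b.1.1.2 - 1) ≤ b.1.1 from ⟨le_rfl, by simp⟩)), sub_mul,
        Finset.sum_sub_distrib]
      rw [cellVal_eq_sum, hs x.1 b.1, zero_add]
    · refine ⟨fun d => -(if d.1 = c.1.1 then 1 else 0), m, fun x => ?_⟩
      rw [orderSlack, Nat.cast_sub (x.2.2 c.1)]
      rw [hs x.1 c.1, sub_eq_add_neg, ← Finset.sum_neg_distrib]
      exact congrArg _ (Finset.sum_congr rfl fun d _ => (neg_mul _ _).symm)
  zero := by
    rintro (c | b | c)
    · exact ⟨⟨fun _ => 0, fun _ _ _ => le_rfl, fun _ => Nat.zero_le _⟩, by simp [orderSlack]⟩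
    · exact ⟨⟨fun _ => 0, fun _ _ _ => le_rfl, fun _ => Nat.zero_le _⟩, by simp [orderSlack]⟩
    · exact ⟨⟨fun _ => m, fun _ _ _ => le_rfl, fun _ => le_rfl⟩, by simp [orderSlack]⟩
  pos := by
    rintro (c | b | c)
    · refine ⟨upperPt m c, ?_⟩
      rw [orderSlack, treeVal_upperPt]
      simp only [upperPt, le_refl, if_true]
      omega
    · refine ⟨upperPt m b.1, ?_⟩
      rw [orderSlack, cellVal_upperPt _ _ fun h => by
        have h2 := h.2
        have := b.2.2
        dsimp only at h2
        omega]
      simp only [upperPt, le_refl, if_true]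
      omega
    · exact ⟨⟨fun _ => 0, fun _ _ _ => le_rfl, fun _ => Nat.zero_le _⟩, by
        simp [orderSlack]; omega⟩
  full := by
    intro u hu a
    obtain ⟨c₀, hc₀⟩ := hne
    have : Nonempty (D ⊕ InnerCell D ⊕ MaxCell D) := ⟨.inl ⟨c₀, hc₀⟩⟩
    have hU : ∀ c : D, ∑ e, treeVal (u e).1 c.1 + 1 ≤ ∑ e, (u e).1 c := by
      intro c
      refine Nat.succ_le_of_lt (Finset.sum_lt_sum (fun e _ => treeVal_le (u e).2.1 c)
        ⟨.inl c, Finset.mem_univ _, ?_⟩)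
      have := hu (.inl c)
      simp only [orderSlack] at this
      omega
    have hB : ∀ b : InnerCell D,
        ∑ e, cellVal (u e).1 (b.1.1.1, b.1.1.2 - 1) + 1 ≤ ∑ e, (u e).1 b.1 := by
      intro b
      refine Nat.succ_le_of_lt (Finset.sum_lt_sum (fun e _ => cellVal_le (u e).2.1 b.1 _
        (show (b.1.1.1, b.1.1.2 - 1) ≤ b.1.1 from ⟨le_rfl, by simp⟩))
        ⟨.inr (.inl b), Finset.mem_univ _, ?_⟩)
      have := hu (.inr (.inl b))
      simp only [orderSlack] at this
      omega
    -- Summed over all `u e`, every slack is at least one unit; `m` times this unit dominates each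
    -- value of `a`, so `a` can be subtracted without leaving the cone.
    have hmul : ∀ (c : D) (A B : ℕ), A + 1 ≤ B → m * A + a.1 c ≤ m * B := by
      intro c A B h
      have := Nat.mul_le_mul_left m h
      have := a.2.2 c
      rw [Nat.mul_add] at *
      omega
    have hle : ∀ c, a.1 c ≤ m * ∑ e, (u e).1 c := fun c => by
      have := hmul c _ _ (hU c)
      omega
    have hmono : Monotone fun c => m * ∑ e, (u e).1 c - a.1 c := by
      refine monotone_of_slack hD (fun c => ?_) fun b => ?_
      · refine (treeVal_sub_le c.1).trans ?_
        rw [treeVal_linear m (fun e => (u e).1)]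
        have := hmul c _ _ (hU c)
        omega
      · refine (cellVal_sub_le _).trans ?_
        rw [cellVal_linear m (fun e => (u e).1)]
        have := hmul b.1 _ _ (hB b)
        omega
    refine exists_relation hm u a hle (exists_multiset_orderPt hmono fun c => ?_)
    obtain ⟨d, hcd, hd⟩ := (Set.toFinite (Set.univ : Set D)).exists_le_maximal (Set.mem_univ c)
    have hdmax : IsMax d := fun e he => hd.2 (Set.mem_univ e) he
    refine (hmono hcd).trans ?_
    have h1 : ∑ e, (u e).1 d + 1 ≤ ∑ _e : D ⊕ InnerCell D ⊕ MaxCell D, m := by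
      refine Nat.succ_le_of_lt (Finset.sum_lt_sum (fun e _ => (u e).2.2 d)
        ⟨.inr (.inr ⟨d, hdmax⟩), Finset.mem_univ _, ?_⟩)
      have := hu (.inr (.inr ⟨d, hdmax⟩))
      simp only [orderSlack] at this
      omega
    rw [Finset.sum_const, Finset.card_univ, smul_eq_mul] at h1
    have h2 := Nat.mul_le_mul_left m h1
    rw [Nat.sub_mul, one_mul, mul_assoc, ]
    rw [Nat.mul_add, mul_one] at h2
    have : (m : ℕ) * (Fintype.card (D ⊕ InnerCell D ⊕ MaxCell D) * m) - m ≥ m * ∑ e, (u e).1 d := by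
      omega
    exact (Nat.sub_le _ _).trans this

end Young
end GTSchubert

/-! ### Maximal chains and the facets of the chain polytope -/

namespace GTSchubert

theorem flag_mem_of_comparable {P : Type*} [PartialOrder P] (Γ : Flag P) (c : P)
    (h : ∀ d ∈ Γ, c ≤ d ∨ d ≤ c) : c ∈ Γ := by
  have hc : IsChain (· ≤ ·) (insert c (Γ : Set P)) :=
    Γ.chain_le.insert fun d hd _ => h d hd
  have := Γ.maxChain.2 hc (Set.subset_insert _ _)
  have h : c ∈ (Γ : Set P) := this ▸ Set.mem_insert _ _
  exact h

theorem flag_eq_of_le {P : Type*} [PartialOrder P] {Γ Γ' : Flag P} (h : ∀ c ∈ Γ, c ∈ Γ') :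
    Γ = Γ' := SetLike.coe_injective (Γ.maxChain.2 Γ'.chain_le h)

section ChainFacets

variable {P : Type*} [PartialOrder P] [Fintype P] {m : ℕ}

instance : Finite (Flag P) := Finite.of_injective (fun Γ : Flag P => (Γ : Set P)) SetLike.coe_injective

open Classical in
/-- The distances to the facets of the chain polytope. -/
def chainSlack (P : Type*) [PartialOrder P] [Fintype P] (m : ℕ) : P ⊕ Flag P → ChainPt P m → ℕ
  | .inl c, p => p.1 c
  | .inr Γ, p => m - ∑ c with c ∈ Γ, p.1 c

open Classical in
theorem flag_isChain (Γ : Flag P) :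
    IsChain (· ≤ ·) ((Finset.univ.filter (· ∈ Γ) : Finset P) : Set P) := by
  simpa using Γ.chain_le

open Classical in
/-- The point of the chain polytope given by an antichain. -/
def antichainPt (m : ℕ) (A : Finset P) (hA : IsAntichain (· ≤ ·) (A : Set P)) : ChainPt P m :=
  ⟨_, chainBound_antichain A hA m⟩

open Classical in
theorem chainBound_of_flag {M : ℕ} {p : P → ℕ} (h : ∀ Γ : Flag P, ∑ c with c ∈ Γ, p c ≤ M) :
    ChainBound P M p := by
  intro Γ hΓ
  obtain ⟨Γ', hΓ'⟩ := hΓ.exists_subset_flag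
  refine (Finset.sum_le_sum_of_subset fun c hc => ?_).trans (h Γ')
  simpa using hΓ' hc

open Classical in
-- The facets are the coordinate hyperplanes and the inequalities of the maximal chains. For `full`,
-- the sum of the `u e` has positive coordinates and leaves a unit of slack on every maximal chain,
-- which after multiplication by `m` makes room for subtracting `a`.
theorem facetData_chain [Nonempty P] [Fintype (Flag P)] (hm : 1 ≤ m) :
    FacetData (fun p : ChainPt P m => p.1) (chainSlack P m) where
  cochar := by
    rintro (c | Γ)
    · exact ⟨fun d => if d = c then 1 else 0, 0, fun p => by simp [chainSlack]⟩
    · refine ⟨fun d => -(if d ∈ Γ then 1 else 0), m, fun p => ?_⟩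
      rw [chainSlack, Nat.cast_sub (p.2 _ (flag_isChain Γ)), sub_eq_add_neg, Finset.sum_filter,
        Nat.cast_sum, ← Finset.sum_neg_distrib]
      exact congrArg _ (Finset.sum_congr rfl fun d _ => by split_ifs with h <;> simp [h])
  zero := by
    rintro (c | Γ)
    · exact ⟨⟨fun _ => 0, fun _ _ => by simp⟩, rfl⟩
    · obtain ⟨c, hc⟩ : (Γ : Set P).Nonempty := by
        rw [← (Γ.maxChain).nonempty_iff]
        infer_instance
      refine ⟨antichainPt m {c} (by simp), ?_⟩
      have hc : c ∈ Γ := hc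
      simp [chainSlack, antichainPt, hc]
  pos := by
    rintro (c | Γ)
    · exact ⟨antichainPt m {c} (by simp), by simp [chainSlack, antichainPt]; omega⟩
    · exact ⟨⟨fun _ => 0, fun _ _ => by simp⟩, by simp [chainSlack]; omega⟩
  full := by
    intro u hu a
    have hU : ∀ c, 1 ≤ ∑ e, (u e).1 c := by
      intro c
      refine le_trans ?_ (Finset.single_le_sum (f := fun e => (u e).1 c)
        (fun _ _ => Nat.zero_le _) (Finset.mem_univ (.inl c)))
      exact Nat.one_le_iff_ne_zero.2 (hu (.inl c))
    have hle : ∀ c, a.1 c ≤ m * ∑ e, (u e).1 c := fun c =>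
      (a.2.le c).trans (Nat.le_mul_of_pos_right m (hU c))
    refine exists_relation hm u a hle (ChainBound.exists_multiset (chainBound_of_flag fun Γ => ?_))
    have h1 : ∑ e, ∑ c with c ∈ Γ, (u e).1 c + 1 ≤ ∑ _e : P ⊕ Flag P, m := by
      refine Nat.succ_le_of_lt (Finset.sum_lt_sum (fun e _ => (u e).2 _ (flag_isChain Γ))
        ⟨.inr Γ, Finset.mem_univ _, ?_⟩)
      have := hu (.inr Γ)
      simp only [chainSlack] at this
      omega
    rw [Finset.sum_comm, Finset.sum_const, Finset.card_univ, smul_eq_mul] at h1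
    calc _ ≤ ∑ c with c ∈ Γ, m * ∑ e, (u e).1 c := Finset.sum_le_sum fun c _ => Nat.sub_le _ _
      _ = m * ∑ c with c ∈ Γ, ∑ e, (u e).1 c := by rw [Finset.mul_sum]
      _ ≤ (m * Fintype.card (P ⊕ Flag P) - 1) * m := by
        have h2 := Nat.mul_le_mul_left m h1
        rw [Nat.mul_add, mul_one] at h2
        rw [Nat.sub_mul, one_mul, mul_assoc]
        omega

open Classical in
/-- No facet of the chain polytope determines a cocharacter that is constant on another one, if
the poset has a least element that is not maximal. -/
theorem chainSlack_incomparable (hm : 1 ≤ m) (b : P) (hb : ∀ c, b ≤ c) (hb' : ∃ c, b < c)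
    (f f' : P ⊕ Flag P) (hff : f ≠ f') :
    ∃ p q : ChainPt P m, chainSlack P m f' p = 0 ∧ chainSlack P m f' q = 0 ∧
      chainSlack P m f p ≠ chainSlack P m f q := by
  have hbΓ : ∀ Γ : Flag P, b ∈ Γ := fun Γ => flag_mem_of_comparable Γ b fun d _ => Or.inl (hb d)
  -- Every flag has at least two elements, since it contains the least element, which is not
  -- maximal.
  have hoth : ∀ (Γ : Flag P) (p : P), ∃ c ∈ Γ, c ≠ p := by
    intro Γ p
    by_contra! h
    obtain rfl := h b (hbΓ Γ)
    obtain ⟨c, hc⟩ := hb'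
    refine hc.ne' (h c (flag_mem_of_comparable Γ c fun d hd => Or.inr ?_))
    rw [h d hd]
    exact hc.le
  let z : ChainPt P m := ⟨fun _ => 0, fun _ _ => by simp⟩
  let s : P → ChainPt P m := fun c => antichainPt m {c} (by simp)
  have hs : ∀ (Γ : Flag P) c, ∑ d with d ∈ Γ, (s c).1 d = if c ∈ Γ then m else 0 := by
    intro Γ c
    simp [s, antichainPt]
  rcases f' with p' | Γ' <;> rcases f with p | Γ
  · refine ⟨z, s p, rfl, ?_, ?_⟩
    · have : p' ≠ p := fun h => hff (by rw [h])
      simp [chainSlack, s, antichainPt, this]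
    · simp [chainSlack, s, antichainPt, z]
      omega
  · obtain ⟨c, hc, hcp⟩ := hoth Γ p'
    refine ⟨z, s c, rfl, ?_, ?_⟩
    · simp [chainSlack, s, antichainPt, hcp.symm]
    · simp only [chainSlack, hs, hc, if_true]
      simp [z]
      omega
  · by_cases hp : p ∈ Γ'
    · obtain ⟨c, hc, hcp⟩ := hoth Γ' p
      refine ⟨s p, s c, ?_, ?_, ?_⟩
      · simp only [chainSlack, hs, hp, if_true, Nat.sub_self]
      · simp only [chainSlack, hs, hc, if_true, Nat.sub_self]
      · simp [chainSlack, s, antichainPt, hcp.symm]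
        omega
    -- Adding to `c ∈ Γ'` an incomparable element `p` outside the flag keeps the sum over `Γ'` equal
    -- to `m` while it changes the coordinate at `p`.
    · obtain ⟨c, hc, hcp⟩ : ∃ c ∈ Γ', ¬ (p ≤ c ∨ c ≤ p) := by
        by_contra! h
        exact hp (flag_mem_of_comparable Γ' p h)
      have hpc : p ≠ c := fun h => hcp (Or.inl h.le)
      have hA : IsAntichain (· ≤ ·) (({p, c} : Finset P) : Set P) := by
        intro x hx y hy hxy hle
        simp only [Finset.coe_insert, Finset.coe_singleton, Set.mem_insert_iff,
          Set.mem_singleton_iff] at hx hy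
        rcases hx with rfl | rfl <;> rcases hy with rfl | rfl
        · exact hxy rfl
        · exact hcp (Or.inl hle)
        · exact hcp (Or.inr hle)
        · exact hxy rfl
      refine ⟨antichainPt m {p, c} hA, s c, ?_, ?_, ?_⟩
      · have : ∑ d with d ∈ Γ', (antichainPt m {p, c} hA).1 d = m := by
          simp only [antichainPt]
          rw [← Finset.sum_filter, Finset.filter_filter, Finset.sum_const]
          have : (Finset.univ.filter fun a => a ∈ Γ' ∧ a ∈ ({p, c} : Finset P)) = {c} := by
            ext a
            simp only [Finset.mem_filter, Finset.mem_univ, true_and, Finset.mem_insert,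
              Finset.mem_singleton]
            constructor
            · rintro ⟨ha, rfl | rfl⟩
              · exact absurd ha hp
              · rfl
            · rintro rfl
              exact ⟨hc, Or.inr rfl⟩
          rw [this]
          simp
        simp only [chainSlack, this, Nat.sub_self]
      · simp only [chainSlack, hs, hc, if_true, Nat.sub_self]
      · simp [chainSlack, s, antichainPt, hpc]
        omega
  · obtain ⟨c, hc, hcΓ⟩ : ∃ c ∈ Γ', c ∉ Γ := by
      by_contra! h
      exact hff (by rw [flag_eq_of_le h])
    refine ⟨s b, s c, ?_, ?_, ?_⟩
    · simp only [chainSlack, hs, hbΓ, if_true, Nat.sub_self]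
    · simp only [chainSlack, hs, hc, if_true, Nat.sub_self]
    · simp only [chainSlack, hs, hbΓ, hcΓ, if_true, if_false, Nat.sub_self]
      omega

end ChainFacets

/-! ### Counting the maximal chains of a diagram -/

section Count

variable {D : Finset (ℕ × ℕ)}

theorem flag_le_or_le (Γ : Flag D) {c d : D} (hc : c ∈ Γ) (hd : d ∈ Γ) :
    (c.1.1 ≤ d.1.1 ∧ c.1.2 ≤ d.1.2) ∨ (d.1.1 ≤ c.1.1 ∧ d.1.2 ≤ c.1.2) :=
  Γ.le_or_le hc hd

/-- A flag turns right at the inner cell `(r, s)` after a vertical step or more. -/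
def TurnsAt (Γ : Flag D) (r s : ℕ) : Prop :=
  1 ≤ r ∧ 1 ≤ s ∧ (∃ c ∈ Γ, c.1 = (r, s)) ∧ ∃ c ∈ Γ, c.1 = (r, s - 1)

/-- A flag with its first right turn at `(r, s)`. -/
def FirstTurn (Γ : Flag D) (r s : ℕ) : Prop :=
  TurnsAt Γ r s ∧ ∃ c ∈ Γ, c.1 = (0, s - 1)

/-- Up to its first turn, the flag runs along row 0 to column `s - 1` and then along this column to
row `r`. Two such beginnings in one chain must coincide. -/
theorem FirstTurn.unique {Γ : Flag D} {r s r' s' : ℕ} (h : FirstTurn Γ r s)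
    (h' : FirstTurn Γ r' s') : r = r' ∧ s = s' := by
  obtain ⟨⟨hr, hs, ⟨c, hc, ec⟩, d, hd, ed⟩, e, he, ee⟩ := h
  obtain ⟨⟨hr', hs', ⟨c', hc', ec'⟩, d', hd', ed'⟩, e', he', ee'⟩ := h'
  have h1 := flag_le_or_le Γ hc he'
  have h2 := flag_le_or_le Γ hc' he
  have h3 := flag_le_or_le Γ hd he'
  have h4 := flag_le_or_le Γ hd' he
  have h5 := flag_le_or_le Γ hc hd'
  have h6 := flag_le_or_le Γ hc' hd
  simp only [ec, ed, ee, ec', ed', ee'] at h1 h2 h3 h4 h5 h6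
  omega

/-- The flag runs along row 0 to the column of `c`, stays in this column, and ends at the maximal
cell `c`. -/
theorem not_turnsAt_of_max {Γ : Flag D} {c : D} (hc : IsMax c) (hcΓ : c ∈ Γ)
    (h0 : ∃ d ∈ Γ, d.1 = (0, c.1.2)) (r s : ℕ) : ¬ TurnsAt Γ r s := by
  rintro ⟨hr, hs, ⟨a, ha, ea⟩, b, hb, eb⟩
  obtain ⟨d, hd, ed⟩ := h0
  have h1 : a ≤ c := (Γ.le_or_le ha hcΓ).elim id fun h => hc h
  have h1 := (cell_le_iff _ _).1 h1
  have h2 := flag_le_or_le Γ hb hd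
  simp only [ea, eb, ed] at h1 h2
  omega

open Classical in
/-- A diagram that contains the cells `(1, 2)` and `(2, 1)` has more maximal chains than inner and
maximal cells. -/
theorem card_lt_card_flag [Fintype (Flag D)] (hD : IsLowerSet (D : Set (ℕ × ℕ)))
    (h₁ : ((1, 2) : ℕ × ℕ) ∈ D) (h₂ : ((2, 1) : ℕ × ℕ) ∈ D) :
    Fintype.card (InnerCell D) + Fintype.card (MaxCell D) < Fintype.card (Flag D) := by
  have mem : ∀ {c : ℕ × ℕ} (d : D), c.1 ≤ d.1.1 → c.2 ≤ d.1.2 → c ∈ D := fun d h h' =>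
    hD (show _ ≤ d.1 from ⟨h, h'⟩) d.2
  have chain3 : ∀ L : List D, L.Pairwise (· ≤ ·) → ∃ Γ : Flag D, ∀ c ∈ L, c ∈ Γ := by
    intro L hL
    have : Std.Symm (fun a b : D => a ≤ b ∨ b ≤ a) := ⟨fun _ _ h => h.symm⟩
    exact (show IsChain (· ≤ ·) {c | c ∈ L} from fun a ha b hb hab =>
      (hL.imp (S := fun a b : D => a ≤ b ∨ b ≤ a) fun h => Or.inl h).forall ha hb hab).exists_subset_flag
  have hinner : ∀ b : InnerCell D, ∃ Γ : Flag D, FirstTurn Γ b.1.1.1 b.1.1.2 ∧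
      (b.1.1 = (1, 1) → (⟨(1, 2), h₁⟩ : D) ∈ Γ) := by
    rintro ⟨⟨⟨r, s⟩, hb⟩, hr, hs⟩
    dsimp only at hr hs ⊢
    have e₁ : ((0, s - 1) : ℕ × ℕ) ∈ D := mem ⟨(r, s), hb⟩ (Nat.zero_le _) (by simp)
    have e₂ : ((r, s - 1) : ℕ × ℕ) ∈ D := mem ⟨(r, s), hb⟩ le_rfl (by simp)
    by_cases h11 : (r, s) = (1, 1)
    · obtain ⟨Γ, hΓ⟩ := chain3 [⟨(0, s - 1), e₁⟩, ⟨(r, s - 1), e₂⟩, ⟨(r, s), hb⟩,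
        ⟨(1, 2), h₁⟩] (by
          obtain ⟨rfl, rfl⟩ := Prod.mk.inj h11
          simp [cell_le_iff])
      exact ⟨Γ, ⟨⟨hr, hs, ⟨_, hΓ ⟨(r, s), hb⟩ (by simp), rfl⟩, ⟨_, hΓ ⟨(r, s - 1), e₂⟩ (by simp), rfl⟩⟩,
        ⟨_, hΓ ⟨(0, s - 1), e₁⟩ (by simp), rfl⟩⟩, fun _ => hΓ _ (by simp)⟩
    · obtain ⟨Γ, hΓ⟩ := chain3 [⟨(0, s - 1), e₁⟩, ⟨(r, s - 1), e₂⟩, ⟨(r, s), hb⟩] (by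
        simp [cell_le_iff]
        omega)
      exact ⟨Γ, ⟨⟨hr, hs, ⟨_, hΓ ⟨(r, s), hb⟩ (by simp), rfl⟩, ⟨_, hΓ ⟨(r, s - 1), e₂⟩ (by simp), rfl⟩⟩,
        ⟨_, hΓ ⟨(0, s - 1), e₁⟩ (by simp), rfl⟩⟩, fun h => absurd h h11⟩
  -- The surplus chain: two flags have their first turn at (1,1), one continuing through (1,2) and
  -- the other through (2,1).
  have hextra : ∃ Γ : Flag D, FirstTurn Γ 1 1 ∧ (⟨(2, 1), h₂⟩ : D) ∈ Γ := by
    have e₁ : ((0, 0) : ℕ × ℕ) ∈ D := mem ⟨_, h₁⟩ (by simp) (by simp)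
    have e₂ : ((1, 0) : ℕ × ℕ) ∈ D := mem ⟨_, h₁⟩ (by simp) (by simp)
    have e₃ : ((1, 1) : ℕ × ℕ) ∈ D := mem ⟨_, h₁⟩ (by simp) (by simp)
    obtain ⟨Γ, hΓ⟩ := chain3 [⟨_, e₁⟩, ⟨_, e₂⟩, ⟨_, e₃⟩, ⟨_, h₂⟩] (by simp [cell_le_iff])
    exact ⟨Γ, ⟨⟨le_rfl, le_rfl, ⟨_, hΓ ⟨_, e₃⟩ (by simp), rfl⟩, ⟨_, hΓ ⟨_, e₂⟩ (by simp), rfl⟩⟩,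
      ⟨_, hΓ ⟨_, e₁⟩ (by simp), rfl⟩⟩, hΓ _ (by simp)⟩
  have hmax : ∀ c : MaxCell D, ∃ Γ : Flag D, c.1 ∈ Γ ∧ ∃ d ∈ Γ, d.1 = (0, c.1.1.2) := by
    rintro ⟨c, hc⟩
    have e₁ : ((0, c.1.2) : ℕ × ℕ) ∈ D := mem c (Nat.zero_le _) le_rfl
    obtain ⟨Γ, hΓ⟩ := chain3 [⟨_, e₁⟩, c] (by simp [cell_le_iff])
    exact ⟨Γ, hΓ _ (by simp), _, hΓ ⟨_, e₁⟩ (by simp), rfl⟩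
  choose f hf hf' using hinner
  obtain ⟨g, hg, hg'⟩ := hextra
  choose k hk hk' using hmax
  let F : Option (InnerCell D ⊕ MaxCell D) → Flag D
    | none => g
    | some (.inl b) => f b
    | some (.inr c) => k c
  have hkn : ∀ c r s, ¬ FirstTurn (k c) r s := fun c r s h =>
    not_turnsAt_of_max c.2 (hk c) (hk' c) r s h.1
  have hfg : ∀ b, f b ≠ g := by
    intro b h
    have hb := (h ▸ hf b).unique hg
    have := hf' b (Prod.ext hb.1 hb.2)
    rw [h] at this
    have := flag_le_or_le g this hg'
    simp at this
  have hinj : Function.Injective F := by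
    rintro (_ | b | c) (_ | b' | c') h
    · rfl
    · exact absurd h.symm (hfg b')
    · have h : g = k c' := h
      exact absurd (h ▸ hg) (hkn c' 1 1)
    · exact absurd h (hfg b)
    · have h : f b = f b' := h
      have := (hf b).unique (h ▸ hf b')
      rw [show b = b' from Subtype.ext (Subtype.ext (Prod.ext this.1 this.2))]
    · have h : f b = k c' := h
      exact absurd (h ▸ hf b) (hkn c' _ _)
    · have h : k c = g := h
      exact absurd (h.symm ▸ hg) (hkn c 1 1)
    · have h : k c = f b' := h
      exact absurd (h.symm ▸ hf b') (hkn c _ _)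
    · have h : k c = k c' := h
      have hc := hk c
      rw [h] at hc
      have : c.1 = c'.1 := by
        rcases (k c').le_or_le hc (hk c') with hle | hle
        · exact hle.antisymm (c.2 hle)
        · exact (c'.2 hle).antisymm hle
      rw [show c = c' from Subtype.ext this]
  have := Fintype.card_le_of_injective F hinj
  rw [Fintype.card_option, Fintype.card_sum] at this
  omega

end Count
end GTSchubert

namespace GTSchubert

/-! ### Lengths and reduced words of permutations -/

section Perm

variable {n : ℕ}

/-- The one-line notation of a permutation, as a function on natural numbers. -/
def wv (w : Equiv.Perm (Fin (n + 1))) (x : ℕ) : ℕ := if h : x < n + 1 then (w ⟨x, h⟩).val else 0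

theorem wv_of_lt (w : Equiv.Perm (Fin (n + 1))) {x : ℕ} (h : x < n + 1) :
    wv w x = (w ⟨x, h⟩).val := dif_pos h

theorem wv_val (w : Equiv.Perm (Fin (n + 1))) (x : Fin (n + 1)) : wv w x.val = (w x).val :=
  wv_of_lt w x.2

theorem wv_lt (w : Equiv.Perm (Fin (n + 1))) (x : ℕ) : wv w x < n + 1 := by
  unfold wv
  split_ifs <;> omega

theorem wv_inj (w : Equiv.Perm (Fin (n + 1))) {x y : ℕ} (hx : x < n + 1) (hy : y < n + 1)
    (h : wv w x = wv w y) : x = y := by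
  rw [wv_of_lt w hx, wv_of_lt w hy] at h
  simpa using w.injective (Fin.ext h)

theorem wv_mul_simpleRefl (w : Equiv.Perm (Fin (n + 1))) {j : ℕ} (hj : 1 ≤ j ∧ j ≤ n) (x : ℕ) :
    wv (w * simpleRefl n j) x = wv w (if x = j - 1 then j else if x = j then j - 1 else x) := by
  by_cases hx : x < n + 1
  · rw [wv_of_lt _ hx, simpleRefl, dif_pos hj, Equiv.Perm.mul_apply]
    split_ifs with h1 h2
    · subst h1
      rw [Equiv.swap_apply_left, wv_of_lt]
    · subst h2
      rw [Equiv.swap_apply_right, wv_of_lt]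
    · rw [Equiv.swap_apply_of_ne_of_ne, wv_of_lt _ hx]
      · simpa [Fin.ext_iff] using h1
      · simpa [Fin.ext_iff] using h2
  · rw [if_neg (by omega), if_neg (by omega)]
    simp [wv, hx]

theorem simpleRefl_mul_self (j : ℕ) : simpleRefl n j * simpleRefl n j = 1 := by
  unfold simpleRefl
  split_ifs <;> simp

/-- The set of inversions of a permutation. -/
def invSet (w : Equiv.Perm (Fin (n + 1))) : Finset (Fin (n + 1) × Fin (n + 1)) :=
  Finset.univ.filter fun p => p.1 < p.2 ∧ w p.2 < w p.1

theorem mem_invSet {w : Equiv.Perm (Fin (n + 1))} {p : Fin (n + 1) × Fin (n + 1)} :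
    p ∈ invSet w ↔ p.1 < p.2 ∧ w p.2 < w p.1 := by
  simp [invSet]

/-- The swap of two adjacent positions preserves the order of every pair of positions other than
`(a, b)`, so it matches the remaining inversions bijectively. -/
theorem card_erase_invSet (w : Equiv.Perm (Fin (n + 1))) {a b : Fin (n + 1)}
    (hab : a.val + 1 = b.val) :
    ((invSet (w * Equiv.swap a b)).erase (a, b)).card = ((invSet w).erase (a, b)).card := by
  have key : ∀ x y : Fin (n + 1), x < y → (x, y) ≠ (a, b) →
      Equiv.swap a b x < Equiv.swap a b y ∧ (Equiv.swap a b x, Equiv.swap a b y) ≠ (a, b) := by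
    intro x y hxy hne
    have hne' : ¬ (x = a ∧ y = b) := fun h => hne (by rw [h.1, h.2])
    simp only [ne_eq, Prod.mk.injEq, Equiv.swap_apply_def, Fin.lt_def, Fin.ext_iff] at *
    split_ifs <;> omega
  refine Finset.card_bij (fun p _ => (Equiv.swap a b p.1, Equiv.swap a b p.2)) ?_ ?_ ?_
  · rintro ⟨x, y⟩ h
    simp only [Finset.mem_erase, mem_invSet, Equiv.Perm.mul_apply] at h ⊢
    have := key x y h.2.1 h.1
    exact ⟨this.2, this.1, h.2.2⟩
  · rintro ⟨x, y⟩ - ⟨x', y'⟩ - h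
    simpa using h
  · rintro ⟨x, y⟩ h
    simp only [Finset.mem_erase, mem_invSet] at h
    have := key x y h.2.1 h.1
    refine ⟨(Equiv.swap a b x, Equiv.swap a b y), ?_, by simp⟩
    simp only [Finset.mem_erase, mem_invSet, Equiv.Perm.mul_apply, Equiv.swap_apply_self]
    exact ⟨this.2, this.1, h.2.2⟩

theorem card_invSet_mul (w : Equiv.Perm (Fin (n + 1))) {j : ℕ} (hj : 1 ≤ j ∧ j ≤ n) :
    (wv w j < wv w (j - 1) → (invSet (w * simpleRefl n j)).card + 1 = (invSet w).card) ∧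
    (wv w (j - 1) < wv w j → (invSet (w * simpleRefl n j)).card = (invSet w).card + 1) := by
  have hs : simpleRefl n j = Equiv.swap (⟨j - 1, by omega⟩ : Fin (n + 1)) ⟨j, by omega⟩ := by
    rw [simpleRefl, dif_pos hj]
  rw [wv_of_lt w (show j < n + 1 by omega), wv_of_lt w (show j - 1 < n + 1 by omega), hs]
  set a : Fin (n + 1) := ⟨j - 1, by omega⟩
  set b : Fin (n + 1) := ⟨j, by omega⟩
  have hab : a.val + 1 = b.val := by simp only [a, b]; omega
  have hlt : a < b := by rw [Fin.lt_def]; omega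
  have h := card_erase_invSet w hab
  have m₁ : (a, b) ∈ invSet w ↔ w b < w a := by simp [mem_invSet, hlt]
  have m₂ : (a, b) ∈ invSet (w * Equiv.swap a b) ↔ w a < w b := by simp [mem_invSet, hlt]
  constructor
  · intro hw
    have hw : w b < w a := hw
    rw [Finset.erase_eq_of_notMem (fun h => (m₂.1 h).not_gt hw)] at h
    rw [h, Finset.card_erase_add_one (m₁.2 hw)]
  · intro hw
    have hw : w a < w b := hw
    rw [Finset.erase_eq_of_notMem (s := invSet w) (fun h => (m₁.1 h).not_gt hw)] at h
    rw [← h, Finset.card_erase_add_one (m₂.2 hw)]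

theorem isWordOf_append {w : Equiv.Perm (Fin (n + 1))} {L : List ℕ} {j : ℕ} :
    IsWordOf n w (L ++ [j]) ↔ (1 ≤ j ∧ j ≤ n) ∧ IsWordOf n (w * simpleRefl n j) L := by
  have : (L.map (simpleRefl n)).prod * simpleRefl n j = w ↔
      (L.map (simpleRefl n)).prod = w * simpleRefl n j := by
    constructor
    · rintro rfl
      rw [mul_assoc, simpleRefl_mul_self, mul_one]
    · intro h
      rw [h, mul_assoc, simpleRefl_mul_self, mul_one]
  simp only [IsWordOf, List.mem_append, List.mem_singleton, List.map_append, List.map_cons,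
    List.map_nil, List.prod_append, List.prod_singleton, this]
  constructor
  · rintro ⟨h, h'⟩
    exact ⟨h j (Or.inr rfl), fun k hk => h k (Or.inl hk), h'⟩
  · rintro ⟨h, h', h''⟩
    exact ⟨fun k hk => hk.elim (h' k) fun e => e ▸ h, h''⟩

theorem card_invSet_le {w : Equiv.Perm (Fin (n + 1))} {L : List ℕ} (h : IsWordOf n w L) :
    (invSet w).card ≤ L.length := by
  induction L using List.reverseRecOn generalizing w with
  | nil =>
    obtain rfl : 1 = w := h.2
    rw [List.length_nil, Nat.le_zero, Finset.card_eq_zero]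
    refine Finset.filter_eq_empty_iff.2 fun p _ hp => ?_
    exact absurd hp.1 hp.2.not_gt
  | append_singleton L j ih =>
    obtain ⟨hj, hL⟩ := isWordOf_append.1 h
    have := ih hL
    obtain ⟨h₁, h₂⟩ := card_invSet_mul w hj
    rw [List.length_append, List.length_singleton]
    rcases lt_trichotomy (wv w j) (wv w (j - 1)) with h | h | h
    · have := h₁ h
      omega
    · have := wv_inj w (by omega) (by omega) h
      omega
    · have := h₂ h
      omega

theorem exists_descent {w : Equiv.Perm (Fin (n + 1))} (hw : w ≠ 1) :
    ∃ j, (1 ≤ j ∧ j ≤ n) ∧ wv w j < wv w (j - 1) := by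
  by_contra! h
  refine hw (Equiv.ext fun x => ?_)
  have hmono : StrictMono w := by
    refine Fin.strictMono_iff_lt_succ.2 fun k => ?_
    have h1 := h (k.val + 1) ⟨by omega, by omega⟩
    rw [Nat.add_sub_cancel] at h1
    have h2 := wv_val w k.castSucc
    have h3 := wv_val w k.succ
    simp only [Fin.val_castSucc, Fin.val_succ] at h2 h3
    rw [h2, h3] at h1
    refine lt_of_le_of_ne h1 fun he => ?_
    have := w.injective he
    simp [Fin.ext_iff] at this
  exact congrFun ((hmono.range_inj strictMono_id).1 (by simp)) x

theorem exists_word (w : Equiv.Perm (Fin (n + 1))) :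
    ∃ L, IsWordOf n w L ∧ L.length = (invSet w).card := by
  induction hN : (invSet w).card generalizing w with
  | zero =>
    by_cases hw : w = 1
    · exact ⟨[], ⟨by simp, by simp [hw]⟩, rfl⟩
    · obtain ⟨j, hj, hlt⟩ := exists_descent hw
      have := (card_invSet_mul w hj).1 hlt
      omega
  | succ N ih =>
    by_cases hw : w = 1
    · have := card_invSet_le (w := w) (L := []) ⟨by simp, by simp [hw]⟩
      rw [List.length_nil] at this
      omega
    · obtain ⟨j, hj, hlt⟩ := exists_descent hw
      have := (card_invSet_mul w hj).1 hlt
      obtain ⟨L, hL, hLN⟩ := ih (w * simpleRefl n j) (by omega)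
      exact ⟨L ++ [j], isWordOf_append.2 ⟨hj, hL⟩, by simp [hLN]⟩

theorem length_eq_card_invSet (w : Equiv.Perm (Fin (n + 1))) : length n w = (invSet w).card := by
  refine le_antisymm (Nat.sInf_le (exists_word w)) ?_
  obtain ⟨L, hL, hLN⟩ := Nat.sInf_mem (s := {k | ∃ L : List ℕ, IsWordOf n w L ∧ L.length = k})
    ⟨_, exists_word w⟩
  exact (card_invSet_le hL).trans hLN.le

/-- The last letter of a reduced word is a descent. A prescribed suffix can therefore be tested one
letter at a time from the right. -/
theorem isReducedWordOf_append {w : Equiv.Perm (Fin (n + 1))} {L : List ℕ} {j : ℕ} :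
    IsReducedWordOf n w (L ++ [j]) ↔
      (1 ≤ j ∧ j ≤ n) ∧ wv w j < wv w (j - 1) ∧ IsReducedWordOf n (w * simpleRefl n j) L := by
  simp only [IsReducedWordOf, isWordOf_append, length_eq_card_invSet, List.length_append,
    List.length_singleton]
  constructor
  · rintro ⟨⟨hj, hL⟩, hlen⟩
    have h := card_invSet_le hL
    obtain ⟨h₁, h₂⟩ := card_invSet_mul w hj
    rcases lt_trichotomy (wv w j) (wv w (j - 1)) with hlt | heq | hlt
    · have := h₁ hlt
      exact ⟨hj, hlt, hL, by omega⟩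
    · have := wv_inj w (by omega) (by omega) heq
      omega
    · have := h₂ hlt
      omega
  · rintro ⟨hj, hlt, hL, hlen⟩
    have := (card_invSet_mul w hj).1 hlt
    exact ⟨⟨hj, hL⟩, by omega⟩

theorem exists_reducedWord (w : Equiv.Perm (Fin (n + 1))) : ∃ L, IsReducedWordOf n w L := by
  obtain ⟨L, hL, hLN⟩ := exists_word w
  exact ⟨L, hL, by rw [hLN, length_eq_card_invSet]⟩

/-! ### Minimal coset representatives and their diagrams -/

variable {i : ℕ} {w : Equiv.Perm (Fin (n + 1))}

theorem IsMinRep.lt_succ (hw : IsMinRep n i w) {j : ℕ} (hj : 1 ≤ j ∧ j ≤ n) (hji : j ≠ i) :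
    wv w (j - 1) < wv w j := by
  by_contra! hle
  have hlt : wv w j < wv w (j - 1) := lt_of_le_of_ne hle fun h => by
    have := wv_inj w (by omega) (by omega) h
    omega
  have h := hw (simpleRefl n j) fun k => by
    rw [simpleRefl, dif_pos hj, Equiv.swap_apply_def]
    split_ifs with h1 h2
    · simp only [h1]; omega
    · simp only [h2]; omega
    · rfl
  rw [length_eq_card_invSet, length_eq_card_invSet] at h
  have := (card_invSet_mul w hj).1 hlt
  omega

theorem IsMinRep.lt_of_lt (hw : IsMinRep n i w) {a b : ℕ} (hab : a < b) (hbn : b ≤ n)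
    (h : b < i ∨ i ≤ a) : wv w a < wv w b := by
  induction b, hab using Nat.le_induction with
  | base => simpa using hw.lt_succ (j := a + 1) (by omega) (by omega)
  | succ b hb ih =>
    have := ih (by omega) (by omega)
    have := hw.lt_succ (j := b + 1) (by omega) (by omega)
    simp only [Nat.add_sub_cancel] at this
    omega

/-- The Young diagram of the inversions of `w ∈ W^i`: the cell `(r, s)` is the root
`α_{i - r, i + s}`. -/
def diagram (n i : ℕ) (w : Equiv.Perm (Fin (n + 1))) : Finset (ℕ × ℕ) :=
  (Finset.range i ×ˢ Finset.range (n + 1 - i)).filter fun c => wv w (i + c.2) < wv w (i - 1 - c.1)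

theorem mem_diagram {c : ℕ × ℕ} : c ∈ diagram n i w ↔
    (c.1 < i ∧ i + c.2 < n + 1) ∧ wv w (i + c.2) < wv w (i - 1 - c.1) := by
  simp only [diagram, Finset.mem_filter, Finset.mem_product, Finset.mem_range]
  constructor
  · rintro ⟨⟨h, h'⟩, h''⟩
    exact ⟨⟨h, by omega⟩, h''⟩
  · rintro ⟨⟨h, h'⟩, h''⟩
    exact ⟨⟨h, by omega⟩, h''⟩

theorem IsMinRep.isLowerSet_diagram (hin : i ≤ n) (hw : IsMinRep n i w) :
    IsLowerSet (diagram n i w : Set (ℕ × ℕ)) := by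
  rintro ⟨r, s⟩ ⟨r', s'⟩ ⟨hr, hs⟩ h
  rw [Finset.mem_coe, mem_diagram] at h ⊢
  dsimp only at *
  refine ⟨by omega, ?_⟩
  have h1 : wv w (i + s') ≤ wv w (i + s) := by
    rcases hs.eq_or_lt with rfl | hs
    · exact le_rfl
    · exact (hw.lt_of_lt (by omega) (by omega) (by omega)).le
  have h2 : wv w (i - 1 - r) ≤ wv w (i - 1 - r') := by
    rcases hr.eq_or_lt with rfl | hr
    · exact le_rfl
    · exact (hw.lt_of_lt (by omega) (by omega) (by omega)).le
  omega

/-- Since `w` increases from place `i` on (counted from 0), the inversions α_{k,j} with `j ≥ i` fill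
an initial segment, so a lower bound on ℓ_k amounts to one inversion. The default `i - 1` stays
below `t`, and no root has `k = 0`. -/
theorem le_ell_iff (hin : i ≤ n) (hw : IsMinRep n i w) {k t : ℕ} (hk : k ≤ i) (ht : i ≤ t) (hi : 1 ≤ i) :
    t ≤ ell n i w k ↔ 1 ≤ k ∧ t ≤ n ∧ wv w t < wv w (k - 1) := by
  have hbdd : BddAbove ({i - 1} ∪ {j | i ≤ j ∧ j ≤ n ∧
      ∃ α : PosRoot n, α.1.1.val + 1 = k ∧ α.1.2.val = j ∧ IsInv w α}) :=
    ⟨n, by rintro j (rfl | h); exacts [by omega, h.2.1]⟩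
  constructor
  · intro h
    rcases Nat.sSup_mem ⟨i - 1, Or.inl rfl⟩ hbdd with h' | ⟨h1, h2, α, h3, h4, h5⟩
    · have h' : ell n i w k = i - 1 := h'
      omega
    · change α.1.2.val = ell n i w k at h4
      have h5 : wv w α.1.2.val < wv w α.1.1.val := by rw [wv_val, wv_val]; exact h5
      have h2 : ell n i w k ≤ n := h2
      rw [h4, show α.1.1.val = k - 1 by omega] at h5
      refine ⟨by omega, by omega, ?_⟩
      rcases h.eq_or_lt with h | h
      · rwa [h]
      · exact (hw.lt_of_lt h h2 (Or.inr ht)).trans h5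
  · rintro ⟨h1, h2, h3⟩
    refine le_csSup hbdd (Or.inr ⟨ht, h2, ⟨(⟨k - 1, by omega⟩, ⟨t, by omega⟩), ?_⟩, ?_, rfl, ?_⟩)
    · simp only [Fin.mk_lt_mk]; omega
    · simp only; omega
    · rw [wv_of_lt w (show t < n + 1 by omega), wv_of_lt w (show k - 1 < n + 1 by omega)] at h3
      exact h3

/-- The cell (2,1) is the root α_{i-2,i+1} and the cell (1,2) is α_{i-1,i+2}. If an index truncates
to 0, there is neither a root nor a cell. -/
theorem ell_condition_iff (hi : 1 ≤ i) (hin : i ≤ n) (hw : IsMinRep n i w) :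
    (ell n i w (i - 2) < i + 1 ∨ ell n i w (i - 1) < i + 2) ↔
      ¬ ((1, 2) ∈ diagram n i w ∧ (2, 1) ∈ diagram n i w) := by
  rw [← not_le, ← not_le, le_ell_iff hin hw (by omega) (by omega) hi,
    le_ell_iff hin hw (by omega) (by omega) hi, mem_diagram, mem_diagram, ← not_and_or, not_iff_not]
  dsimp only
  rw [show i - 2 - 1 = i - 1 - 2 by omega]
  constructor
  · rintro ⟨⟨h1, h2, h3⟩, h4, h5, h6⟩
    exact ⟨⟨⟨by omega, by omega⟩, h6⟩, ⟨by omega, by omega⟩, h3⟩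
  · rintro ⟨⟨⟨h1, h2⟩, h3⟩, ⟨h4, h5⟩, h6⟩
    exact ⟨⟨by omega, by omega, h6⟩, by omega, by omega, h3⟩

theorem wv_mul_simpleRefl_succ (w : Equiv.Perm (Fin (n + 1))) {j : ℕ} (hj : j + 1 ≤ n) (x : ℕ) :
    wv (w * simpleRefl n (j + 1)) x = wv w (if x = j then j + 1 else if x = j + 1 then j else x) := by
  rw [wv_mul_simpleRefl w ⟨by omega, hj⟩, Nat.add_sub_cancel]

/-- With `i = t + 3`, stripping the eight letters from the right turns the descents into inversions
of `w`, one for each cell of the shape (3,3,2). What is left after stripping always has a reduced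
word, so `L` imposes no further condition. -/
theorem reducedWord_iff_lt {t : ℕ} (ht : t + 5 ≤ n) :
    (∃ L : List ℕ, IsReducedWordOf n w (L ++ [t + 2] ++ [t + 1] ++ [t + 4] ++ [t + 3] ++ [t + 2] ++
      [t + 5] ++ [t + 4] ++ [t + 3])) ↔
      (wv w (t + 3) < wv w (t + 2) ∧ wv w (t + 4) < wv w (t + 2) ∧ wv w (t + 5) < wv w (t + 2)) ∧
      (wv w (t + 3) < wv w (t + 1) ∧ wv w (t + 4) < wv w (t + 1) ∧ wv w (t + 5) < wv w (t + 1)) ∧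
      wv w (t + 3) < wv w t ∧ wv w (t + 4) < wv w t := by
  have e₁ := fun (w : Equiv.Perm (Fin (n + 1))) x => wv_mul_simpleRefl_succ w (j := t) (by omega) x
  have e₂ := fun (w : Equiv.Perm (Fin (n + 1))) x =>
    wv_mul_simpleRefl_succ w (j := t + 1) (by omega) x
  have e₃ := fun (w : Equiv.Perm (Fin (n + 1))) x =>
    wv_mul_simpleRefl_succ w (j := t + 2) (by omega) x
  have e₄ := fun (w : Equiv.Perm (Fin (n + 1))) x =>
    wv_mul_simpleRefl_succ w (j := t + 3) (by omega) x
  have e₅ := fun (w : Equiv.Perm (Fin (n + 1))) x =>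
    wv_mul_simpleRefl_succ w (j := t + 4) (by omega) x
  have b : ∀ c, c ≤ 5 → 1 ≤ c → (1 ≤ t + c ∧ t + c ≤ n) := fun c _ _ => by omega
  have s : ∀ c, t + (c + 1) - 1 = t + c := fun c => by omega
  have d₁ := s 1
  have d₂ := s 2
  have d₃ := s 3
  have d₄ := s 4
  have d₀ : t + 1 - 1 = t := by omega
  have z : ∀ c, 1 ≤ c → ¬ t + c = t := fun c _ => by omega
  norm_num only at e₁ e₂ e₃ e₄ e₅ d₁ d₂ d₃ d₄
  simp only [Nat.add_assoc, Nat.reduceAdd] at e₁ e₂ e₃ e₄ e₅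
  simp only [isReducedWordOf_append, d₀, d₁, d₂, d₃, d₄, e₁, e₂, e₃, e₄, e₅, Nat.add_left_cancel_iff,
    Nat.left_eq_add, Nat.reduceEqDiff, if_true, if_false, b 1 (by omega) (by omega),
    b 2 (by omega) (by omega), b 3 (by omega) (by omega), b 4 (by omega) (by omega),
    b 5 (by omega) (by omega), true_and, exists_and_left, exists_reducedWord, and_true,
    z 1 (by omega), z 2 (by omega)]
  tauto

theorem reducedWord_condition_iff (hw : IsMinRep n i w) :
    (∃ L : List ℕ, IsReducedWordOf n w
        (L ++ [i - 1, i - 2, i + 1, i, i - 1, i + 2, i + 1, i])) ↔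
      (1, 2) ∈ diagram n i w ∧ (2, 1) ∈ diagram n i w := by
  by_cases h : 3 ≤ i ∧ i + 2 ≤ n
  · obtain ⟨t, rfl⟩ : ∃ t, i = t + 3 := ⟨i - 3, by omega⟩
    have split : ∀ L : List ℕ, L ++ [t + 3 - 1, t + 3 - 2, t + 3 + 1, t + 3, t + 3 - 1, t + 3 + 2,
        t + 3 + 1, t + 3] = L ++ [t + 2] ++ [t + 1] ++ [t + 4] ++ [t + 3] ++ [t + 2] ++
        [t + 5] ++ [t + 4] ++ [t + 3] := fun L => by simp
    simp only [split]
    rw [reducedWord_iff_lt (by omega), mem_diagram, mem_diagram]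
    dsimp only
    rw [show t + 3 - 1 - 1 = t + 1 by omega, show t + 3 - 1 - 2 = t by omega,
      show t + 3 + 2 = t + 5 by omega, show t + 3 + 1 = t + 4 by omega]
    have h₁ := hw.lt_of_lt (a := t) (b := t + 1) (by omega) (by omega) (by omega)
    have h₂ := hw.lt_of_lt (a := t + 1) (b := t + 2) (by omega) (by omega) (by omega)
    have h₃ := hw.lt_of_lt (a := t + 3) (b := t + 4) (by omega) (by omega) (by omega)
    have h₄ := hw.lt_of_lt (a := t + 4) (b := t + 5) (by omega) (by omega) (by omega)
    omega
  -- The letters `i - 2` and `i + 2` would have to lie between 1 and `n`; a truncated `i - 2 = 0` is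
  -- not a letter.
  · refine iff_of_false ?_ ?_
    · rintro ⟨L, hL⟩
      have h₁ := hL.1.1 (i - 2) (by simp)
      have h₂ := hL.1.1 (i + 2) (by simp)
      omega
    · simp only [mem_diagram]
      omega

end Perm
end GTSchubert

namespace GTSchubert

/-! ### The homogeneous lexicographic order -/

section Order

variable {R : Type*} [Fintype R] {r : R → R → Prop}

theorem HomLexLT.irrefl (p : R → ℕ) : ¬ HomLexLT r p p := by
  rintro (h | ⟨-, β, h, -⟩) <;> exact lt_irrefl _ h

theorem HomLexLT.trans (hr : IsStrictTotalOrder R r) {p q s : R → ℕ} (h : HomLexLT r p q)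
    (h' : HomLexLT r q s) : HomLexLT r p s := by
  rcases h with h | ⟨h, β, hβ, hβ'⟩ <;> rcases h' with h' | ⟨h', γ, hγ, hγ'⟩
  · exact Or.inl (h.trans h')
  · exact Or.inl (h' ▸ h)
  · exact Or.inl (h ▸ h')
  · refine Or.inr ⟨h.trans h', ?_⟩
    rcases trichotomous_of r β γ with hβγ | rfl | hβγ
    · exact ⟨γ, hβ' γ hβγ ▸ hγ, fun δ hδ => (hβ' δ (trans_of r hβγ hδ)).trans (hγ' δ hδ)⟩
    · exact ⟨β, hβ.trans hγ, fun δ hδ => (hβ' δ hδ).trans (hγ' δ hδ)⟩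
    · exact ⟨β, hγ' β hβγ ▸ hβ, fun δ hδ => (hβ' δ hδ).trans (hγ' δ (trans_of r hβγ hδ))⟩

theorem exists_last_ne (hr : IsStrictTotalOrder R r) {p q : R → ℕ} (h : p ≠ q) :
    ∃ β, p β ≠ q β ∧ ∀ γ, r β γ → p γ = q γ := by
  have wf : WellFounded (Function.swap r) := Finite.wellFounded_of_trans_of_irrefl _
  obtain ⟨β, hβ, hmin⟩ := wf.has_min {β | p β ≠ q β} (Function.ne_iff.1 h)
  exact ⟨β, hβ, fun γ hγ => by_contra fun hne => hmin γ hne hγ⟩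

theorem HomLexLT.sum_le {p q : R → ℕ} (h : HomLexLT r q p) : ∑ β, q β ≤ ∑ β, p β :=
  h.elim le_of_lt fun h => h.1.le

/-- The total degree is compared first, which bounds every exponent. -/
theorem finite_homLexLT (p : R → ℕ) : {q | HomLexLT r q p}.Finite := by
  classical
  refine (Set.finite_Icc 0 (fun _ : R => ∑ β, p β)).subset fun q hq =>
    ⟨fun _ => Nat.zero_le _, fun β => ?_⟩
  exact (Finset.single_le_sum (fun _ _ => Nat.zero_le _) (Finset.mem_univ β)).trans hq.sum_le

theorem wellFounded_homLexLT (hr : IsStrictTotalOrder R r) :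
    WellFounded (HomLexLT r) := by
  refine Subrelation.wf (r := fun q p => {s | HomLexLT r s q}.ncard < {s | HomLexLT r s p}.ncard)
    ?_ (measure fun p => {s | HomLexLT r s p}.ncard).wf
  intro q p h
  refine Set.ncard_lt_ncard ⟨fun s hs => HomLexLT.trans hr hs h, fun hsub => ?_⟩ (finite_homLexLT p)
  exact HomLexLT.irrefl q (hsub h)

theorem sum_wordDeg [DecidableEq R] (L : List R) : ∑ β, wordDeg L β = L.length := by
  induction L with
  | nil => simp [wordDeg]
  | cons β L ih => simp [wordDeg_cons, Finset.sum_add_distrib, ih]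

theorem exists_wordDeg_eq [DecidableEq R] (p : R → ℕ) : ∃ L : List R, wordDeg L = p := by
  refine ⟨(Finsupp.toMultiset (Finsupp.equivFunOnFinite.symm p)).toList, funext fun β => ?_⟩
  rw [wordDeg, ← Multiset.coe_count, Multiset.coe_toList, Finsupp.count_toMultiset]
  rfl

omit [Fintype R] in
theorem perm_of_wordDeg_eq [DecidableEq R] {L L' : List R} (h : wordDeg L = wordDeg L') :
    L.Perm L' := List.perm_iff_count.2 fun β => congrFun h β

end Order

/-! ### The graded space when commutators are combinations of the operators -/

section Graded

variable {R : Type*} [Fintype R] [DecidableEq R] {M : Type*} [AddCommGroup M] [Module ℂ M]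
  (r : R → R → Prop) (x : R → Module.End ℂ M) (v : M)

/-- The span of the vectors obtained from `v` by fewer than `k` operators. -/
def shortWords (k : ℕ) : Submodule ℂ M :=
  Submodule.span ℂ {y | ∃ L : List R, L.length < k ∧ y = (L.map x).prod v}

variable {x v}

theorem shortWords_le_filtLT {k : ℕ} {p : R → ℕ} (h : k ≤ ∑ β, p β) :
    shortWords x v k ≤ filtLT r x v p := by
  refine Submodule.span_mono ?_
  rintro _ ⟨L, hL, rfl⟩
  exact ⟨L, Or.inl (by rw [sum_wordDeg]; omega), rfl⟩

omit [Fintype R] [DecidableEq R] in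
theorem apply_mem_shortWords (β : R) {k : ℕ} {y : M} (hy : y ∈ shortWords x v k) :
    x β y ∈ shortWords x v (k + 1) := by
  have : shortWords x v k ≤ (shortWords x v (k + 1)).comap (x β) := by
    refine Submodule.span_le.2 ?_
    rintro _ ⟨L, hL, rfl⟩
    exact Submodule.subset_span ⟨β :: L, by simpa using hL, by simp⟩
  exact this hy

omit [Fintype R] [DecidableEq R] in
-- Exchanging two neighbouring letters costs a commutator, which is a combination of single
-- operators, so the correction has one letter fewer.
theorem word_sub_mem_shortWords
    (hcomm : ∀ β γ, x β * x γ - x γ * x β ∈ Submodule.span ℂ (Set.range x)) {L L' : List R}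
    (h : L.Perm L') : (L.map x).prod v - (L'.map x).prod v ∈ shortWords x v L.length := by
  induction h with
  | nil => simp
  | cons β h ih =>
    simp only [List.map_cons, List.prod_cons, Module.End.mul_apply, ← map_sub, List.length_cons]
    exact apply_mem_shortWords β ih
  | swap β γ L =>
    simp only [List.map_cons, List.prod_cons, Module.End.mul_apply, List.length_cons]
    have key : ∀ T ∈ Submodule.span ℂ (Set.range x),
        T ((L.map x).prod v) ∈ shortWords x v (L.length + 1 + 1) := by
      intro T hT
      induction hT using Submodule.span_induction with
      | mem T hT =>
        obtain ⟨δ, rfl⟩ := hT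
        exact Submodule.subset_span ⟨δ :: L, by simp, by simp⟩
      | zero => simp
      | add S T _ _ hS hT => exact add_mem hS hT
      | smul c T _ hT => exact Submodule.smul_mem _ c hT
    exact key _ (hcomm γ β)
  | trans h h' ih ih' =>
    rw [← h.length_eq] at ih'
    simpa using add_mem ih ih'

theorem word_sub_mem_filtLT
    (hcomm : ∀ β γ, x β * x γ - x γ * x β ∈ Submodule.span ℂ (Set.range x)) {L L' : List R}
    (h : wordDeg L = wordDeg L') : (L.map x).prod v - (L'.map x).prod v ∈ filtLT r x v (wordDeg L) :=
  shortWords_le_filtLT r (sum_wordDeg L).ge (word_sub_mem_shortWords hcomm (perm_of_wordDeg_eq h))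

/-- Modulo shorter words the letter that kills `v` can be moved to the right end. -/
theorem word_mem_filtLT_of_apply_eq_zero
    (hcomm : ∀ β γ, x β * x γ - x γ * x β ∈ Submodule.span ℂ (Set.range x)) {L : List R} {β : R}
    (hβ : β ∈ L) (h : x β v = 0) : (L.map x).prod v ∈ filtLT r x v (wordDeg L) := by
  have hp : L.Perm (L.erase β ++ [β]) :=
    (List.perm_cons_erase hβ).trans (List.perm_append_singleton _ _).symm
  have := word_sub_mem_filtLT r hcomm (v := v) (funext fun γ => hp.count_eq γ : wordDeg L = _)
  simpa [h] using this

variable (x v)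

/-- The class in `GrComp p` of the vectors of multi-exponent `p`. -/
def grClass (p : R → ℕ) : GrComp r x v p :=
  Submodule.Quotient.mk ⟨(((exists_wordDeg_eq p).choose).map x).prod v,
    Submodule.subset_span ⟨_, Or.inr (exists_wordDeg_eq p).choose_spec, rfl⟩⟩

variable {x v}

theorem grClass_eq_mk (hcomm : ∀ β γ, x β * x γ - x γ * x β ∈ Submodule.span ℂ (Set.range x))
    {L : List R} {p : R → ℕ} (h : wordDeg L = p) (hL : (L.map x).prod v ∈ filtLE r x v p) :
    grClass r x v p = Submodule.Quotient.mk ⟨(L.map x).prod v, hL⟩ := by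
  refine (Submodule.Quotient.eq _).2 ?_
  have h' := (exists_wordDeg_eq p).choose_spec
  have := word_sub_mem_filtLT r hcomm (v := v) (h'.trans h.symm)
  rwa [h'] at this

theorem grClass_eq_zero_iff (hcomm : ∀ β γ, x β * x γ - x γ * x β ∈ Submodule.span ℂ (Set.range x))
    (L : List R) : grClass r x v (wordDeg L) = 0 ↔ (L.map x).prod v ∈ filtLT r x v (wordDeg L) := by
  rw [grClass_eq_mk r hcomm rfl (Submodule.subset_span ⟨L, Or.inr rfl, rfl⟩),
    Submodule.Quotient.mk_eq_zero]
  rfl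

/-- All words of one multi-exponent agree modulo smaller terms, so each component is at most a line.
-/
theorem exists_eq_smul_grClass
    (hcomm : ∀ β γ, x β * x γ - x γ * x β ∈ Submodule.span ℂ (Set.range x)) {p : R → ℕ}
    (z : GrComp r x v p) : ∃ c : ℂ, c • grClass r x v p = z := by
  obtain ⟨⟨y, hy⟩, rfl⟩ := Submodule.Quotient.mk_surjective _ z
  suffices H : ∀ y ∈ filtLE r x v p, ∃ c : ℂ, ∀ hy : y ∈ filtLE r x v p,
      c • grClass r x v p = Submodule.Quotient.mk ⟨y, hy⟩ from (H y hy).imp fun c hc => hc hy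
  clear hy y
  intro y hy
  induction hy using Submodule.span_induction with
  | mem y hy =>
    obtain ⟨L, hL | hL, rfl⟩ := hy
    · refine ⟨0, fun hy => ?_⟩
      rw [zero_smul, eq_comm, Submodule.Quotient.mk_eq_zero]
      exact Submodule.subset_span ⟨L, hL, rfl⟩
    · exact ⟨1, fun hy => by rw [one_smul, grClass_eq_mk r hcomm hL]⟩
  | zero => exact ⟨0, fun hy => by rw [zero_smul]; rfl⟩
  | add y z hy hz h₁ h₂ =>
    obtain ⟨a, ha⟩ := h₁
    obtain ⟨b, hb⟩ := h₂
    exact ⟨a + b, fun h => by rw [add_smul, ha hy, hb hz]; rfl⟩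
  | smul c y hy h₁ =>
    obtain ⟨a, ha⟩ := h₁
    exact ⟨c * a, fun h => by rw [mul_smul, ha hy]; rfl⟩

theorem grStep_grClass (hcomm : ∀ β γ, x β * x γ - x γ * x β ∈ Submodule.span ℂ (Set.range x))
    (β : R) (p : R → ℕ) :
    grStep r x v β p (grClass r x v p) = grClass r x v (p + Pi.single β 1) := by
  obtain ⟨L, rfl⟩ := exists_wordDeg_eq p
  rw [grClass_eq_mk r hcomm rfl (Submodule.subset_span ⟨L, Or.inr rfl, rfl⟩),
    grClass_eq_mk r hcomm (wordDeg_cons β L)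
      (Submodule.subset_span ⟨β :: L, Or.inr (wordDeg_cons β L), rfl⟩)]
  rfl

variable (x v)

/-- The linear map `ℂ[X_β] → M^t` that sends `X^p` to the class of `x^p v`. -/
def grOfPoly : MvPolynomial R ℂ →ₗ[ℂ] GrSpace r x v :=
  (MvPolynomial.basisMonomials R ℂ).constr ℂ fun p =>
    DirectSum.lof ℂ (R → ℕ) (GrComp r x v) p (grClass r x v p)

theorem grOfPoly_monomial (p : R →₀ ℕ) :
    grOfPoly r x v (MvPolynomial.monomial p 1) =
      DirectSum.lof ℂ (R → ℕ) (GrComp r x v) p (grClass r x v p) := by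
  rw [← congrFun (MvPolynomial.coe_basisMonomials R ℂ) p, grOfPoly, Module.Basis.constr_basis]

variable {x v}

theorem grOfPoly_one (hcomm : ∀ β γ, x β * x γ - x γ * x β ∈ Submodule.span ℂ (Set.range x)) :
    grOfPoly r x v 1 = grVec r x v := by
  have := grOfPoly_monomial r x v 0
  rw [MvPolynomial.monomial_zero'] at this
  rw [← map_one MvPolynomial.C, this, grVec]
  rw [Finsupp.coe_zero]
  congr 1
  exact grClass_eq_mk r hcomm (L := []) (by funext; simp [wordDeg]) _

theorem grOfPoly_X_mul (hcomm : ∀ β γ, x β * x γ - x γ * x β ∈ Submodule.span ℂ (Set.range x))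
    (β : R) (f : MvPolynomial R ℂ) :
    grOfPoly r x v (MvPolynomial.X β * f) = grOp r x v β (grOfPoly r x v f) := by
  have : grOfPoly r x v ∘ₗ LinearMap.mulLeft ℂ (MvPolynomial.X β) =
      grOp r x v β ∘ₗ grOfPoly r x v := by
    refine (MvPolynomial.basisMonomials R ℂ).ext fun p => ?_
    simp only [MvPolynomial.coe_basisMonomials, LinearMap.comp_apply, LinearMap.mulLeft_apply,
      grOfPoly_monomial]
    rw [MvPolynomial.X, MvPolynomial.monomial_mul, one_mul, grOfPoly_monomial, grOp,
      DirectSum.toModule_lof, LinearMap.comp_apply, grStep_grClass r hcomm]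
    have : ((Finsupp.single β 1 + p : R →₀ ℕ) : R → ℕ) = ⇑p + Pi.single β 1 := by
      rw [add_comm, Finsupp.coe_add, Finsupp.single_eq_pi_single]
    rw [this]
  exact LinearMap.congr_fun this f

theorem grOp_pow_grVec (hcomm : ∀ β γ, x β * x γ - x γ * x β ∈ Submodule.span ℂ (Set.range x))
    (c : R → ℂ) (k : ℕ) :
    ((∑ β, c β • grOp r x v β) ^ k) (grVec r x v) =
      grOfPoly r x v ((∑ β, c β • MvPolynomial.X β) ^ k) := by
  induction k with
  | zero => rw [pow_zero, pow_zero, grOfPoly_one r hcomm]; rfl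
  | succ k ih =>
    rw [pow_succ', pow_succ', Module.End.mul_apply, ih, Finset.sum_mul, map_sum,
      LinearMap.sum_apply]
    refine Finset.sum_congr rfl fun β _ => ?_
    rw [smul_mul_assoc, map_smul, grOfPoly_X_mul r hcomm]
    rfl

end Graded
end GTSchubert

namespace GTSchubert

/-! ### Coordinates on the graded space and its toric model -/

section GradedModel

variable {R : Type*} [Fintype R] [DecidableEq R] {M : Type*} [AddCommGroup M] [Module ℂ M]
  {r : R → R → Prop} {x : R → Module.End ℂ M} {v : M} {A : Finset (R → ℕ)}

theorem grOfPoly_apply (f : MvPolynomial R ℂ) (p : R →₀ ℕ) :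
    grOfPoly r x v f p = f.coeff p • grClass r x v p := by
  induction f using MvPolynomial.induction_on' with
  | monomial q a =>
    have : MvPolynomial.monomial q a = a • MvPolynomial.monomial q (1 : ℂ) := by
      rw [MvPolynomial.smul_monomial, smul_eq_mul, mul_one]
    rw [this, map_smul, grOfPoly_monomial, MvPolynomial.coeff_smul, DirectSum.smul_apply]
    by_cases h : q = p
    · subst h
      rw [DirectSum.lof_apply]
      simp
    · rw [DirectSum.lof_eq_of, DirectSum.of_eq_of_ne _ _ _ (fun h' => h (DFunLike.coe_injective h'.symm))]
      simp [h]
  | add f g hf hg => rw [map_add, DirectSum.add_apply, hf, hg, MvPolynomial.coeff_add, add_smul]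

/-- The product of the factorials of the exponents. -/
def expFactorial (p : R → ℕ) : ℂ := ∏ β, ((p β).factorial : ℂ)

omit [DecidableEq R] in
theorem expFactorial_ne_zero (p : R → ℕ) : expFactorial p ≠ 0 :=
  Finset.prod_ne_zero_iff.2 fun _ _ => Nat.cast_ne_zero.2 (Nat.factorial_ne_zero _)

omit [DecidableEq R] in
theorem coeff_exp (c : R → ℂ) (p : R →₀ ℕ) (k : ℕ) :
    ((k.factorial : ℂ)⁻¹) * ((∑ β, c β • MvPolynomial.X β : MvPolynomial R ℂ) ^ k).coeff p =
      if ∑ β, p β = k then (expFactorial p)⁻¹ * ∏ β, c β ^ p β else 0 := by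
  rw [MvPolynomial.coeff_linearCombination_X_pow_of_fintype]
  rw [Finsupp.sum_fintype _ _ (fun _ => rfl), Finsupp.prod_fintype _ _ (fun _ => pow_zero _)]
  split_ifs with h
  · have h₁ : expFactorial p * (p.multinomial : ℂ) = (k.factorial : ℂ) := by
      rw [← h, expFactorial]
      have h₂ := Nat.multinomial_spec p.support p
      have h₃ : ∏ β, (p β).factorial = ∏ β ∈ p.support, (p β).factorial :=
        (Finset.prod_subset (Finset.subset_univ _) fun β _ hβ => by
          rw [Finsupp.notMem_support_iff.1 hβ, Nat.factorial_zero]).symm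
      have h₄ : ∑ β, p β = ∑ β ∈ p.support, p β :=
        (Finset.sum_subset (Finset.subset_univ _) fun β _ hβ => by
          rw [Finsupp.notMem_support_iff.1 hβ]).symm
      rw [h₄, ← h₂, ← h₃]
      push_cast
      rfl
    have h₂ := expFactorial_ne_zero (R := R) p
    have h₃ : (k.factorial : ℂ) ≠ 0 := Nat.cast_ne_zero.2 (Nat.factorial_ne_zero _)
    rw [← mul_assoc]
    congr 1
    field_simp
    rw [mul_comm, h₁]
  · simp

/-- Only the term of order |p| of the exponential series reaches the multidegree `p`, and the
multinomial theorem gives its coefficient. Finiteness of `A` makes the series finite, so that the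
`finsum` is a genuine sum and not the default value 0. -/
theorem grExp_grVec_apply
    (hcomm : ∀ β γ, x β * x γ - x γ * x β ∈ Submodule.span ℂ (Set.range x))
    (hA : ∀ p, grClass r x v p ≠ 0 ↔ p ∈ A) (c : R → ℂ) (p : R → ℕ) :
    grExp r x v c (grVec r x v) p =
      ((expFactorial p)⁻¹ * ∏ β, c β ^ p β) • grClass r x v p := by
  obtain ⟨p, rfl⟩ : ∃ p' : R →₀ ℕ, ⇑p' = p := ⟨Finsupp.equivFunOnFinite.symm p, rfl⟩
  have key : ∀ (k : ℕ) (q : R →₀ ℕ), (((k.factorial : ℂ)⁻¹) •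
      ((∑ β, c β • grOp r x v β) ^ k) (grVec r x v)) q =
      if ∑ β, q β = k then ((expFactorial q)⁻¹ * ∏ β, c β ^ q β) • grClass r x v q else 0 := by
    intro k q
    rw [grOp_pow_grVec r hcomm, DirectSum.smul_apply, grOfPoly_apply, smul_smul, coeff_exp,
      ite_smul, zero_smul]
  have hfin : (Function.support fun k : ℕ => ((k.factorial : ℂ)⁻¹) •
      ((∑ β, c β • grOp r x v β) ^ k) (grVec r x v)) ⊆ ↑(A.image fun q => ∑ β, q β) := by
    intro k hk
    rw [Function.mem_support] at hk
    by_contra hcon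
    refine hk (DFinsupp.ext fun q => ?_)
    obtain ⟨q, rfl⟩ : ∃ q' : R →₀ ℕ, ⇑q' = q := ⟨Finsupp.equivFunOnFinite.symm q, rfl⟩
    refine (key k q).trans ?_
    split_ifs with h
    · have : ⇑q ∉ A := fun hq => hcon (Finset.mem_coe.2 (Finset.mem_image.2 ⟨q, hq, h⟩))
      rw [not_not.1 (fun h' => this ((hA q).1 h')), smul_zero]
      rfl
    · rfl
  rw [grExp, finsum_eq_sum_of_support_subset _ hfin]
  rw [DirectSum.sum_apply]
  simp only [key]
  rw [Finset.sum_ite_eq]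
  split_ifs with h
  · rfl
  · have : ⇑p ∉ A := fun hq => h (Finset.mem_image.2 ⟨p, hq, rfl⟩)
    rw [not_not.1 (fun h' => this ((hA p).1 h')), smul_zero]

/-- The coordinate on a nonzero component of the graded space. -/
def grCompEquiv (hcomm : ∀ β γ, x β * x γ - x γ * x β ∈ Submodule.span ℂ (Set.range x))
    {p : R → ℕ} (hp : grClass r x v p ≠ 0) : ℂ ≃ₗ[ℂ] GrComp r x v p :=
  LinearEquiv.ofBijective
    (LinearMap.toSpanSingleton ℂ (GrComp r x v p) ((expFactorial p)⁻¹ • grClass r x v p))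
    ⟨(LinearMap.ker_eq_bot).1 (LinearMap.ker_toSpanSingleton ℂ
        (smul_ne_zero (inv_ne_zero (expFactorial_ne_zero p)) hp)),
      fun z => by
        obtain ⟨c, rfl⟩ := exists_eq_smul_grClass r hcomm z
        refine ⟨c * expFactorial p, ?_⟩
        rw [LinearMap.toSpanSingleton_apply, smul_smul, mul_assoc,
          mul_inv_cancel₀ (expFactorial_ne_zero p), mul_one]⟩

/-- The coordinates on the graded space. -/
def grCoords (hcomm : ∀ β γ, x β * x γ - x γ * x β ∈ Submodule.span ℂ (Set.range x))
    (hA : ∀ p, grClass r x v p ≠ 0 ↔ p ∈ A) : GrSpace r x v ≃ₗ[ℂ] (A → ℂ) where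
  toFun y a := (grCompEquiv hcomm ((hA a).2 a.2)).symm (y a)
  map_add' y z := funext fun a => by simp
  map_smul' c y := funext fun a => by
    rw [DirectSum.smul_apply, map_smul]
    rfl
  invFun f := ∑ a : A, DirectSum.lof ℂ (R → ℕ) (GrComp r x v) a
    (grCompEquiv hcomm ((hA a).2 a.2) (f a))
  left_inv y := by
    refine DFinsupp.ext fun p => ?_
    rw [DirectSum.sum_apply]
    by_cases hp : p ∈ A
    · rw [Finset.sum_eq_single (⟨p, hp⟩ : A)]
      · rw [DirectSum.lof_apply]
        simp
      · intro b _ hb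
        rw [DirectSum.lof_eq_of, DirectSum.of_eq_of_ne]
        exact fun h => hb (Subtype.ext h.symm)
      · simp
    · obtain ⟨c, hc⟩ := exists_eq_smul_grClass r hcomm (y p)
      rw [not_not.1 (fun h' => hp ((hA p).1 h')), smul_zero] at hc
      refine (Finset.sum_eq_zero fun b _ => ?_).trans hc
      rw [DirectSum.lof_eq_of, DirectSum.of_eq_of_ne]
      exact fun h => hp (h ▸ b.2)
  right_inv f := by
    funext a
    rw [LinearEquiv.symm_apply_eq, DirectSum.sum_apply, Finset.sum_eq_single a]
    · rw [DirectSum.lof_apply]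
    · intro b _ hb
      rw [DirectSum.lof_eq_of, DirectSum.of_eq_of_ne]
      exact fun h => hb (Subtype.ext h.symm)
    · simp

theorem grCoords_grExp (hcomm : ∀ β γ, x β * x γ - x γ * x β ∈ Submodule.span ℂ (Set.range x))
    (hA : ∀ p, grClass r x v p ≠ 0 ↔ p ∈ A) (c : R → ℂ) (a : A) :
    grCoords hcomm hA (grExp r x v c (grVec r x v)) a = ∏ β, c β ^ a.1 β := by
  refine (LinearEquiv.symm_apply_eq _).2 ?_
  rw [grExp_grVec_apply hcomm hA]
  rw [mul_comm, mul_smul]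
  rfl

omit [DecidableEq R] in
-- A point with vanishing coordinates is reached along the line c + t(1, …, 1), which meets the
-- coordinate hyperplanes for finitely many `t` only.
theorem vanish_of_vanish_torus {f : (A → ℂ) → ℂ} (hf : f ∈ polyFun (A → ℂ))
    (h : ∀ t : R → ℂˣ, f (fun a => (mon t a.1 : ℂ)) = 0) (c : R → ℂ) :
    f (fun a => ∏ β, c β ^ a.1 β) = 0 := by
  have := polyFun_curve_eq_zero hf
    (fun a : A => ∏ β, (Polynomial.C (c β) + Polynomial.X) ^ a.1 β)
    (Set.finite_range fun β => -c β) (fun t ht => ?_) 0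
  · simpa [Polynomial.eval_prod] using this
  · have ht : ∀ β, c β + t ≠ 0 := fun β h => ht ⟨β, by linear_combination -h⟩
    convert h fun β => Units.mk0 _ (ht β) using 2
    funext a
    simp [mon, Polynomial.eval_prod]

omit [DecidableEq R] in
-- In the coordinates `Ψ` the orbit is the monomial image of an affine space, in which the torus is
-- dense.
theorem mem_zariskiClosure_curve_iff {V : Type*} [AddCommGroup V] [Module ℂ V]
    (Ψ : V ≃ₗ[ℂ] (A → ℂ)) {e : (R → ℂ) → V} (he : ∀ c a, Ψ (e c) a = ∏ β, c β ^ a.1 β)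
    (h0 : A.Nonempty) (z : Projectivization ℂ V) :
    z ∈ zariskiClosure {z | ∃ (c : R → ℂ) (h : e c ≠ 0), z = Projectivization.mk ℂ _ h} ↔
      Ψ z.rep ∈ torusCone fun a : A => a.1 := by
  constructor
  · intro hz d f hf hv
    refine hz d (fun y => f (Ψ y)) (hf.comp_linear Ψ.toLinearMap) ?_
    rintro _ ⟨c, hc, rfl⟩
    refine ((hf.comp_linear Ψ.toLinearMap).map_rep_eq_zero hc).2 ?_
    change f (Ψ _) = 0
    rw [show Ψ (e c) = fun a => ∏ β, c β ^ a.1 β from funext fun a => he c a]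
    exact vanish_of_vanish_torus hf.mem_polyFun hv c
  · intro hz d f hf hv
    have := hz d (fun y => f (Ψ.symm y)) (hf.comp_linear Ψ.symm.toLinearMap) fun h => ?_
    · simpa using this
    · have e' : Ψ.symm (fun a => (mon h a.1 : ℂ)) = e fun β => (h β : ℂ) := by
        rw [LinearEquiv.symm_apply_eq]
        funext a
        rw [he]
        simp [mon]
      have hne : e (fun β => (h β : ℂ)) ≠ 0 := by
        rw [← e', ne_eq, LinearEquiv.map_eq_zero_iff]
        obtain ⟨a, ha⟩ := h0
        exact fun h' => (mon h a).ne_zero (congrFun h' ⟨a, ha⟩)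
      rw [e', ← hf.map_rep_eq_zero hne]
      exact hv _ ⟨_, hne, rfl⟩

theorem isToricModel_grVariety
    (hcomm : ∀ β γ, x β * x γ - x γ * x β ∈ Submodule.span ℂ (Set.range x))
    (hA : ∀ p, grClass r x v p ≠ 0 ↔ p ∈ A) (h0 : A.Nonempty) :
    IsToricModel (grVariety r x v) (grTorus r x v) (fun a : A => a.1) (grCoords hcomm hA) where
  mem_iff := mem_zariskiClosure_curve_iff _ (grCoords_grExp hcomm hA) h0
  torus_to g := by
    refine ⟨g, 1, fun y a => ?_⟩
    rw [Units.val_one, one_mul]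
    refine (LinearEquiv.symm_apply_eq _).2 ?_
    rw [← smul_eq_mul, map_smul]
    refine Eq.trans ?_ (congrArg _ (LinearEquiv.apply_symm_apply _ _).symm)
    rfl
  torus_from g := by
    refine ⟨g, 1, fun y a => ?_⟩
    rw [Units.val_one, one_mul]
    refine (LinearEquiv.symm_apply_eq _).2 ?_
    rw [← smul_eq_mul, map_smul]
    refine Eq.trans ?_ (congrArg _ (LinearEquiv.apply_symm_apply _ _).symm)
    rfl

/-- Let the vectors of multi-exponent supported on `N` be multiples of vectors `u p`, and let the
`u p` with `p ∈ A` be independent while the others are combinations of smaller ones.  Then the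
nonzero components of the graded space are those indexed by `A`. -/
theorem grClass_ne_zero_iff (hr : IsStrictTotalOrder R r)
    (hcomm : ∀ β γ, x β * x γ - x γ * x β ∈ Submodule.span ℂ (Set.range x))
    {N : Set R} (hN : ∀ β ∉ N, x β v = 0) (u : (R → ℕ) → M)
    (hu : ∀ L : List R, (∀ β ∈ L, β ∈ N) → ∃ k : ℂ, k ≠ 0 ∧ (L.map x).prod v = k • u (wordDeg L))
    (hAN : ∀ p ∈ A, ∀ β ∉ N, p β = 0)
    (hup : ∀ p, (∀ β ∉ N, p β = 0) → p ∉ A → u p ∈ Submodule.span ℂ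
      {y | ∃ q : R → ℕ, (∀ β ∉ N, q β = 0) ∧ HomLexLT r q p ∧ y = u q})
    (hli : LinearIndependent ℂ fun a : A => u a) (p : R → ℕ) :
    grClass r x v p ≠ 0 ↔ p ∈ A := by
  have hmem : ∀ L : List R, (∀ β ∉ N, wordDeg L β = 0) ↔ ∀ β ∈ L, β ∈ N := by
    intro L
    simp only [wordDeg, List.count_eq_zero]
    exact ⟨fun h β hβ => by_contra fun h' => h β h' hβ, fun h β hβ h' => hβ (h β h')⟩
  -- Well-founded induction on the exponent: a word with a killing letter, or with exponent outside
  -- `A`, is rewritten by strictly smaller ones until only exponents in `A` remain.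
  have hfilt : ∀ p, filtLT r x v p ≤ Submodule.span ℂ {y | ∃ q ∈ A, HomLexLT r q p ∧ y = u q} := by
    intro p
    induction p using (wellFounded_homLexLT hr).induction with
    | _ p ih =>
      refine Submodule.span_le.2 ?_
      rintro _ ⟨L, hL, rfl⟩
      have mono : Submodule.span ℂ {y | ∃ q ∈ A, HomLexLT r q (wordDeg L) ∧ y = u q} ≤
          Submodule.span ℂ {y | ∃ q ∈ A, HomLexLT r q p ∧ y = u q} := by
        refine Submodule.span_mono ?_
        rintro _ ⟨q, hq, hqL, rfl⟩
        exact ⟨q, hq, hqL.trans hr hL, rfl⟩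
      by_cases hLN : ∀ β ∈ L, β ∈ N
      · obtain ⟨k, hk, e⟩ := hu L hLN
        rw [e]
        refine Submodule.smul_mem _ _ ?_
        by_cases hLA : wordDeg L ∈ A
        · exact Submodule.subset_span ⟨_, hLA, hL, rfl⟩
        · refine mono ?_
          refine (Submodule.span_le.2 ?_) (hup _ ((hmem L).2 hLN) hLA)
          rintro _ ⟨q, hqN, hq, rfl⟩
          obtain ⟨L', rfl⟩ := exists_wordDeg_eq q
          obtain ⟨k', hk', e'⟩ := hu L' ((hmem L').1 hqN)
          have : u (wordDeg L') = k'⁻¹ • (L'.map x).prod v := by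
            rw [e', smul_smul, inv_mul_cancel₀ hk', one_smul]
          rw [this]
          refine Submodule.smul_mem _ _ (ih _ hL ?_)
          exact Submodule.subset_span ⟨L', hq, rfl⟩
      · push Not at hLN
        obtain ⟨β, hβ, hβN⟩ := hLN
        exact mono (ih _ hL (word_mem_filtLT_of_apply_eq_zero r hcomm hβ (hN β hβN)))
  obtain ⟨L, rfl⟩ := exists_wordDeg_eq p
  rw [ne_eq, grClass_eq_zero_iff r hcomm, not_iff_comm]
  constructor
  · intro hLA
    by_cases hLN : ∀ β ∈ L, β ∈ N
    · obtain ⟨k, hk, e⟩ := hu L hLN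
      rw [e]
      refine Submodule.smul_mem _ _ ((Submodule.span_le.2 ?_) (hup _ ((hmem L).2 hLN) hLA))
      rintro _ ⟨q, hqN, hq, rfl⟩
      obtain ⟨L', rfl⟩ := exists_wordDeg_eq q
      obtain ⟨k', hk', e'⟩ := hu L' ((hmem L').1 hqN)
      have : u (wordDeg L') = k'⁻¹ • (L'.map x).prod v := by
        rw [e', smul_smul, inv_mul_cancel₀ hk', one_smul]
      rw [this]
      exact Submodule.smul_mem _ _ (Submodule.subset_span ⟨L', hq, rfl⟩)
    · push Not at hLN
      obtain ⟨β, hβ, hβN⟩ := hLN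
      exact word_mem_filtLT_of_apply_eq_zero r hcomm hβ (hN β hβN)
  · intro hmemL hLA
    obtain ⟨k, hk, e⟩ := hu L ((hmem L).1 (hAN _ hLA))
    have h₁ := hfilt _ hmemL
    rw [e, Submodule.smul_mem_iff _ hk] at h₁
    refine hli.notMem_span_image (s := {a : A | HomLexLT r a (wordDeg L)}) (x := ⟨_, hLA⟩)
      (HomLexLT.irrefl _) ?_
    refine Submodule.span_mono ?_ h₁
    rintro _ ⟨q, hq, hqL, rfl⟩
    exact ⟨⟨q, hq⟩, hqL, rfl⟩

end GradedModel
end GTSchubert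

namespace GTSchubert

/-! ### Polarizations -/

section Polarization

open MvPolynomial

variable {n i : ℕ}

/-- The polarization as a derivation. -/
def polarDer (n i : ℕ) (a b : Fin (n + 1)) : Derivation ℂ (MatPoly n i) (MatPoly n i) :=
  mkDerivation ℂ fun p : Fin (n + 1) × Fin i => if p.1 = b then (X (a, p.2) : MatPoly n i) else 0

theorem polarization_apply (a b : Fin (n + 1)) (f : MatPoly n i) :
    polarization n i a b f = polarDer n i a b f := rfl

theorem polarDer_X (a b : Fin (n + 1)) (p : Fin (n + 1) × Fin i) :
    polarDer n i a b (X p) = if p.1 = b then X (a, p.2) else 0 := mkDerivation_X _ _ _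

theorem polarization_commutator (a b c d : Fin (n + 1)) :
    polarization n i a b * polarization n i c d - polarization n i c d * polarization n i a b =
      (if c = b then polarization n i a d else 0) - if a = d then polarization n i c b else 0 := by
  have : ⁅polarDer n i a b, polarDer n i c d⁆ =
      (if c = b then polarDer n i a d else 0) - if a = d then polarDer n i c b else 0 := by
    refine derivation_ext fun p => ?_
    simp only [Derivation.commutator_apply, polarDer_X, Derivation.sub_apply]
    have h : ∀ (P : Prop) [Decidable P] (D : Derivation ℂ (MatPoly n i) (MatPoly n i)) f,
        (if P then D else 0) f = if P then D f else 0 := fun P _ D f => by split_ifs <;> simp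
    simp only [h, polarDer_X, apply_ite (polarDer n i a b), apply_ite (polarDer n i c d), map_zero]
    split_ifs <;> simp_all
  have h := congrArg Derivation.toLinearMap this
  rw [Derivation.commutator_coe_linear_map] at h
  refine Eq.trans ?_ (h.trans ?_)
  · rfl
  · refine LinearMap.ext fun f => ?_
    split_ifs <;> rfl

open scoped Classical in
/-- The algebra homomorphism `f ↦ exp(∑_{β ∈ N} c_β e_β) f`, for a set `N` of roots no two of which
are composable, with indeterminate coefficients `c_β`. -/
def genericExp (n i : ℕ) (N : Set (PosRoot n)) :
    MatPoly n i →ₐ[ℂ] MvPolynomial (PosRoot n) (MatPoly n i) :=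
  aeval fun p => C (X p) + ∑ β, if β ∈ N ∧ β.1.2 = p.1 then X β * C (X (β.1.1, p.2)) else 0

open scoped Classical in
theorem genericExp_X (N : Set (PosRoot n)) (p : Fin (n + 1) × Fin i) :
    genericExp n i N (X p) =
      C (X p) + ∑ β, if β ∈ N ∧ β.1.2 = p.1 then X β * C (X (β.1.1, p.2)) else 0 :=
  aeval_X _ _

theorem genericExp_X_of_forall {N : Set (PosRoot n)} {p : Fin (n + 1) × Fin i}
    (h : ∀ β ∈ N, β.1.2 ≠ p.1) : genericExp n i N (X p) = C (X p) := by
  rw [genericExp_X, Finset.sum_eq_zero fun β _ => if_neg fun hβ => h β hβ.1 hβ.2, add_zero]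

theorem coeff_zero_genericExp (N : Set (PosRoot n)) (f : MatPoly n i) :
    coeff 0 (genericExp n i N f) = f := by
  induction f using MvPolynomial.induction_on with
  | C a =>
    rw [← MvPolynomial.algebraMap_eq, AlgHom.commutes, IsScalarTower.algebraMap_apply ℂ (MatPoly n i)]
    exact coeff_zero_C _
  | add f g hf hg => rw [map_add, coeff_add, hf, hg]
  | mul_X f p hf =>
    rw [map_mul, ← constantCoeff_eq, map_mul, constantCoeff_eq, hf, genericExp_X]
    congr 1
    rw [← constantCoeff_eq, map_add, constantCoeff_C, map_sum, Finset.sum_eq_zero, add_zero]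
    intro β _
    split_ifs <;> simp

/-- Since no two roots of `N` are composable, the row β.1.1 is left unchanged by the exponential,
and differentiating with respect to c_β brings down e_β. Both sides obey the same Leibniz rule along
the algebra homomorphism, so variables suffice. -/
theorem pderiv_genericExp {N : Set (PosRoot n)} (hN : ∀ β ∈ N, ∀ γ ∈ N, γ.1.2 ≠ β.1.1)
    {β : PosRoot n} (hβ : β ∈ N) (f : MatPoly n i) :
    pderiv β (genericExp n i N f) = genericExp n i N (polarization n i β.1.1 β.1.2 f) := by
  rw [polarization_apply]
  induction f using MvPolynomial.induction_on with
  | C a =>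
    rw [← MvPolynomial.algebraMap_eq, AlgHom.commutes, Derivation.map_algebraMap, map_zero,
      IsScalarTower.algebraMap_apply ℂ (MatPoly n i)]
    exact Derivation.map_algebraMap _ _
  | add f g hf hg => simp only [map_add, hf, hg]
  | mul_X f p hf =>
    have hX : pderiv β (genericExp n i N (X p)) = genericExp n i N (polarDer n i β.1.1 β.1.2 (X p)) := by
      rw [polarDer_X, genericExp_X, map_add, pderiv_C, zero_add, map_sum, Finset.sum_eq_single β]
      · by_cases h : p.1 = β.1.2
        · rw [if_pos ⟨hβ, h.symm⟩, if_pos h, mul_comm, pderiv_C_mul, pderiv_X_self, mul_one,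
            genericExp_X_of_forall (p := (β.1.1, p.2)) fun γ hγ => hN β hβ γ hγ]
        · rw [if_neg (fun h' => h h'.2.symm), if_neg h, map_zero, map_zero]
      · intro γ _ hγ
        split_ifs
        · rw [mul_comm, pderiv_C_mul, pderiv_X_of_ne hγ, mul_zero]
        · exact map_zero _
      · simp
    rw [map_mul, Derivation.leibniz, Derivation.leibniz, hf, hX]
    simp only [smul_eq_mul, map_add, map_mul]

/-- Applying a letter is differentiating the generic exponential, by `pderiv_genericExp`. The
constant term after all derivatives is a coefficient times factorials, which are nonzero. -/
theorem exists_word_eq_smul_coeff {N : Set (PosRoot n)} (hN : ∀ β ∈ N, ∀ γ ∈ N, γ.1.2 ≠ β.1.1)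
    (L : List (PosRoot n)) (hL : ∀ β ∈ L, β ∈ N) (f : MatPoly n i) :
    ∃ k : ℂ, k ≠ 0 ∧ (L.map fun β => polarization n i β.1.1 β.1.2).prod f =
      k • coeff (Finsupp.equivFunOnFinite.symm (wordDeg L)) (genericExp n i N f) := by
  have key : ∀ s : PosRoot n →₀ ℕ, ∃ k : ℂ, k ≠ 0 ∧
      coeff s (genericExp n i N ((L.map fun β => polarization n i β.1.1 β.1.2).prod f)) =
        k • coeff (s + Finsupp.equivFunOnFinite.symm (wordDeg L)) (genericExp n i N f) := by
    induction L with
    | nil =>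
      intro s
      refine ⟨1, one_ne_zero, ?_⟩
      have : Finsupp.equivFunOnFinite.symm (wordDeg ([] : List (PosRoot n))) = 0 := by
        ext; simp [wordDeg]
      rw [this, add_zero, one_smul]
      rfl
    | cons β L ih =>
      intro s
      obtain ⟨k, hk, e⟩ := ih (fun γ hγ => hL γ (List.mem_cons_of_mem _ hγ)) (s + Finsupp.single β 1)
      refine ⟨(s β + 1) * k, mul_ne_zero (Nat.cast_add_one_ne_zero _) hk, ?_⟩
      rw [List.map_cons, List.prod_cons, Module.End.mul_apply,
        ← pderiv_genericExp hN (hL β List.mem_cons_self), coeff_pderiv, e]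
      have : s + Finsupp.single β 1 + Finsupp.equivFunOnFinite.symm (wordDeg L) =
          s + Finsupp.equivFunOnFinite.symm (wordDeg (β :: L)) := by
        rw [wordDeg_cons]
        ext γ
        simp [Finsupp.single_eq_pi_single]
        ring
      rw [this, mul_smul, mul_comm, ← nsmul_one, ← one_smul ℕ (1 : MatPoly n i), nsmul_one]
      simp only [smul_eq_C_mul, map_add, map_natCast, map_one]
      push_cast
      ring
  obtain ⟨k, hk, e⟩ := key 0
  refine ⟨k, hk, ?_⟩
  rwa [coeff_zero_genericExp, zero_add] at e

/-- The `m`-th root of the extremal weight vector: the minor on the rows `w(1), …, w(i)`. -/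
def extremalMinor (n i : ℕ) (hin : i ≤ n) (w : Equiv.Perm (Fin (n + 1))) : MatPoly n i :=
  Matrix.det (Matrix.of fun k q : Fin i => (X (w (Fin.castLE (by omega) k), q) : MatPoly n i))

theorem genericExp_extremalMinor (hin : i ≤ n) (w : Equiv.Perm (Fin (n + 1)))
    (N : Set (PosRoot n)) : genericExp n i N (extremalMinor n i hin w) =
      Matrix.det (Matrix.of fun k q : Fin i =>
        genericExp n i N (X (w (Fin.castLE (by omega) k), q))) := by
  rw [extremalMinor, AlgHom.map_det]
  rfl

/-- The root vector replaces row β.1.2 by row β.1.1. Either the minor does not involve the former,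
or it involves both, and the exponential is an elementary row operation that leaves the determinant
unchanged. -/
theorem polarization_extremalVec_eq_zero (m : ℕ) (hin : i ≤ n) (w : Equiv.Perm (Fin (n + 1)))
    (β : PosRoot n) (h : ¬ ((w.symm β.1.2).val < i ∧ i ≤ (w.symm β.1.1).val)) :
    polarization n i β.1.1 β.1.2 (extremalVec n i m hin w) = 0 := by
  have hN : ∀ γ ∈ ({β} : Set (PosRoot n)), ∀ δ ∈ ({β} : Set (PosRoot n)), δ.1.2 ≠ γ.1.1 := by
    intro γ hγ δ hδ
    rw [Set.mem_singleton_iff.1 hγ, Set.mem_singleton_iff.1 hδ]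
    exact β.2.ne'
  have hdet : genericExp n i {β} (extremalMinor n i hin w) = C (extremalMinor n i hin w) := by
    rw [genericExp_extremalMinor]
    have hC : (C (extremalMinor n i hin w) : MvPolynomial (PosRoot n) (MatPoly n i)) =
        Matrix.det (Matrix.of fun k q : Fin i =>
          (C (X (w (Fin.castLE (by omega) k), q)) : MvPolynomial (PosRoot n) (MatPoly n i))) := by
      rw [extremalMinor, RingHom.map_det]
      rfl
    rw [hC]
    have hX : ∀ p : Fin (n + 1) × Fin i, genericExp n i {β} (X p) = C (X p) +
        if p.1 = β.1.2 then X β * C (X (β.1.1, p.2)) else 0 := by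
      intro p
      rw [genericExp_X, Finset.sum_eq_single β]
      · simp [eq_comm]
      · intro γ _ hγ
        exact if_neg fun h => hγ h.1
      · simp
    by_cases hb : (w.symm β.1.2).val < i
    · have ha : (w.symm β.1.1).val < i := not_le.1 fun ha => h ⟨hb, ha⟩
      set kb : Fin i := ⟨_, hb⟩ with hkb
      set ka : Fin i := ⟨_, ha⟩ with hka
      have hwb : w (Fin.castLE (by omega) kb) = β.1.2 := w.symm_apply_eq.1 (by ext; rfl) |>.symm
      have hwa : w (Fin.castLE (by omega) ka) = β.1.1 := w.symm_apply_eq.1 (by ext; rfl) |>.symm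
      have hab : kb ≠ ka := fun e => β.2.ne' (by rw [← hwa, ← hwb, e])
      rw [← Matrix.det_updateRow_add_smul_self (Matrix.of fun k q : Fin i =>
        (C (X (w (Fin.castLE (by omega) k), q)) : MvPolynomial (PosRoot n) (MatPoly n i))) hab (X β)]
      congr 1
      ext1 k q
      by_cases hk : k = kb
      · subst hk
        rw [Matrix.updateRow_self, Matrix.of_apply, hX, if_pos hwb]
        simp [hwa]
      · rw [Matrix.updateRow_ne hk, Matrix.of_apply, hX, if_neg, add_zero]
        · rfl
        · intro e
          refine hk ?_
          have := w.injective (e.trans hwb.symm)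
          simpa [Fin.ext_iff] using this
    · congr 1
      ext1 k q
      rw [Matrix.of_apply, Matrix.of_apply, hX, if_neg, add_zero]
      intro e
      have e : w (Fin.castLE (by omega) k) = β.1.2 := e
      rw [← e, Equiv.symm_apply_apply] at hb
      exact hb k.2
  obtain ⟨k, -, e⟩ := exists_word_eq_smul_coeff hN [β] (by simp) (extremalVec n i m hin w)
  have hv : extremalVec n i m hin w = extremalMinor n i hin w ^ m := rfl
  rw [List.map_singleton, List.prod_singleton] at e
  rw [e, hv, map_pow, hdet, ← C_pow, coeff_C, if_neg, smul_zero]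
  intro h0
  have := DFunLike.congr_fun h0 β
  simp [wordDeg] at this

end Polarization
end GTSchubert

namespace GTSchubert

/-! ### The roots of the diagram -/

section Cells

variable {n i : ℕ} {w : Equiv.Perm (Fin (n + 1))}

/-- The roots `-w(α)` with `α = α_{k,j}`, `k ≤ i ≤ j`. -/
def liveRoots (n i : ℕ) (w : Equiv.Perm (Fin (n + 1))) : Set (PosRoot n) :=
  {β | (w.symm β.1.2).val < i ∧ i ≤ (w.symm β.1.1).val}

/-- The cell of the diagram that belongs to a root. -/
def rootCell (i : ℕ) (w : Equiv.Perm (Fin (n + 1))) (β : PosRoot n) : ℕ × ℕ :=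
  (i - 1 - (w.symm β.1.2).val, (w.symm β.1.1).val - i)

theorem liveRoots_ne {β γ : PosRoot n} (hβ : β ∈ liveRoots n i w) (hγ : γ ∈ liveRoots n i w) :
    γ.1.2 ≠ β.1.1 := by
  intro h
  have h₁ := hγ.1
  have h₂ := hβ.2
  rw [h] at h₁
  omega

theorem mem_diagram_iff {a b : Fin (n + 1)} (hb : (w.symm b).val < i) (ha : i ≤ (w.symm a).val) :
    (i - 1 - (w.symm b).val, (w.symm a).val - i) ∈ diagram n i w ↔ a < b := by
  rw [mem_diagram]
  dsimp only
  rw [show i + ((w.symm a).val - i) = (w.symm a).val by omega,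
    show i - 1 - (i - 1 - (w.symm b).val) = (w.symm b).val by omega, wv_val, wv_val,
    Equiv.apply_symm_apply, Equiv.apply_symm_apply]
  exact ⟨fun h => h.2, fun h => ⟨⟨by omega, by omega⟩, h⟩⟩

theorem rootCell_mem {β : PosRoot n} (hβ : β ∈ liveRoots n i w) : rootCell i w β ∈ diagram n i w :=
  (mem_diagram_iff hβ.1 hβ.2).2 β.2

theorem rootCell_injOn : Set.InjOn (rootCell i w) (liveRoots n i w) := by
  rintro β ⟨h₁, h₂⟩ γ ⟨h₃, h₄⟩ h
  simp only [rootCell, Prod.mk.injEq] at h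
  refine Subtype.ext (Prod.ext (w.symm.injective (Fin.ext ?_)) (w.symm.injective (Fin.ext ?_))) <;>
    omega

theorem exists_rootCell_eq {c : ℕ × ℕ} (hc : c ∈ diagram n i w) :
    ∃ β ∈ liveRoots n i w, rootCell i w β = c := by
  obtain ⟨⟨h₁, h₂⟩, h₃⟩ := mem_diagram.1 hc
  rw [wv_of_lt w h₂, wv_of_lt w (show i - 1 - c.1 < n + 1 by omega)] at h₃
  refine ⟨⟨(w ⟨i + c.2, h₂⟩, w ⟨i - 1 - c.1, by omega⟩), h₃⟩, ⟨?_, ?_⟩, ?_⟩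
  · simp only [Equiv.symm_apply_apply]; omega
  · simp only [Equiv.symm_apply_apply]; omega
  · simp only [rootCell, Equiv.symm_apply_apply]
    ext <;> dsimp only <;> omega

/-- The cell (r, s) comes from a root of height r + s + 1, so a strictly larger cell has strictly
larger height; ties need not be examined. -/
theorem rel_of_rootCell_lt {r : PosRoot n → PosRoot n → Prop} (hrw : ExtendsHeightOrder w r)
    {β γ : PosRoot n} (hβ : β ∈ liveRoots n i w) (hγ : γ ∈ liveRoots n i w)
    (h : rootCell i w β < rootCell i w γ) : r β γ := by
  have hinv : ∀ β : PosRoot n, β ∈ liveRoots n i w → ∃ (α : PosRoot n) (hα : IsInv w α),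
      negImage w α hα = β ∧ α.1.1 = w.symm β.1.2 ∧ α.1.2 = w.symm β.1.1 := by
    rintro β ⟨h₁, h₂⟩
    have hα : w.symm β.1.2 < w.symm β.1.1 := by
      rw [Fin.lt_def]
      omega
    refine ⟨⟨(w.symm β.1.2, w.symm β.1.1), hα⟩, ?_, ?_, rfl, rfl⟩
    · simpa [IsInv] using β.2
    · simp [negImage]
  obtain ⟨α, hα, e, h₁, h₂⟩ := hinv β hβ
  obtain ⟨α', hα', e', h₁', h₂'⟩ := hinv γ hγ
  rw [← e, ← e']
  refine hrw _ _ _ _ (Or.inl ?_)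
  rw [h₁, h₂, h₁', h₂']
  obtain ⟨hβ₁, hβ₂⟩ := hβ
  obtain ⟨hγ₁, hγ₂⟩ := hγ
  obtain ⟨⟨hle, hle'⟩, hne⟩ := lt_iff_le_and_ne.1 h
  simp only [rootCell, ne_eq, Prod.mk.injEq, not_and_or] at hle hle' hne
  omega

/-- The exponents supported on the live roots whose sums over chains are at most `m`. -/
def liveExps (n i m : ℕ) (w : Equiv.Perm (Fin (n + 1))) : Set (PosRoot n → ℕ) :=
  {p | (∀ β ∉ liveRoots n i w, p β = 0) ∧ ∀ Γ : Finset (PosRoot n), ↑Γ ⊆ liveRoots n i w →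
    IsChain (fun β γ => rootCell i w β ≤ rootCell i w γ) (Γ : Set (PosRoot n)) → ∑ β ∈ Γ, p β ≤ m}

theorem finite_liveExps (n i m : ℕ) (w : Equiv.Perm (Fin (n + 1))) : (liveExps n i m w).Finite := by
  refine (Set.finite_Icc 0 (fun _ : PosRoot n => m)).subset fun p hp =>
    ⟨fun _ => Nat.zero_le _, fun β => ?_⟩
  by_cases hβ : β ∈ liveRoots n i w
  · simpa using hp.2 {β} (by simpa using hβ) (by simp)
  · simp [hp.1 β hβ]

end Cells

/-! ### Rank one perturbations of a matrix -/

section RankOne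

open MvPolynomial

/-- By the Schur complement this is a bordered determinant with `u` and `y` in one extra column and
row, and each term of its expansion meets this column and this row once. -/
theorem totalDegree_det_rankOne {k σ ι : Type*} [CommRing k] [Fintype ι] [DecidableEq ι]
    (A : Matrix ι ι k) {u y : ι → MvPolynomial σ k} (hu : ∀ a, (u a).totalDegree ≤ 1)
    (hy : ∀ a, (y a).totalDegree ≤ 1) :
    (Matrix.det (Matrix.of fun a b => C (A a b) + u a * y b)).totalDegree ≤ 2 := by
  set B : Matrix (ι ⊕ Unit) (ι ⊕ Unit) (MvPolynomial σ k) :=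
    Matrix.fromBlocks (Matrix.of fun a b => C (A a b)) (Matrix.of fun a _ => -u a)
      (Matrix.of fun _ b => y b) 1 with hB
  have hdet : Matrix.det (Matrix.of fun a b => C (A a b) + u a * y b) = B.det := by
    rw [hB, Matrix.det_fromBlocks_one₂₂]
    congr 1
    ext1 a b
    simp [Matrix.mul_apply]
  have hdeg : ∀ a b, (B a b).totalDegree ≤ Sum.elim (fun _ => 0) (fun _ => 1) a +
      Sum.elim (fun _ => 0) (fun _ => 1) b := by
    rintro (a | a) (b | b)
    · simp [hB]
    · simpa [hB] using hu a
    · simpa [hB] using hy b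
    · simp only [hB, Matrix.fromBlocks_apply₂₂, Matrix.one_apply]
      simp
  rw [hdet, Matrix.det_apply']
  refine (totalDegree_finsetSum _ _).trans (Finset.sup_le fun π _ => ?_)
  refine (totalDegree_mul _ _).trans ?_
  have h₀ : (((Equiv.Perm.sign π : ℤˣ) : ℤ) : MvPolynomial σ k).totalDegree = 0 := by
    rw [← map_intCast (C : k →+* MvPolynomial σ k), totalDegree_C]
  rw [h₀, zero_add]
  refine (totalDegree_finsetProd _ _).trans ((Finset.sum_le_sum fun a _ => hdeg _ _).trans ?_)
  rw [Finset.sum_add_distrib, Equiv.sum_comp π]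
  simp

open scoped Classical in
theorem coeff_aeval_monomial {k σ τ : Type*} [CommRing k] [Fintype σ] (T : Set σ)
    [DecidablePred (· ∈ T)]
    (d : σ → τ →₀ ℕ) (f : MvPolynomial σ k) (e : τ →₀ ℕ) :
    coeff e (aeval (fun β => if β ∈ T then (monomial (d β) 1 : MvPolynomial τ k) else 0) f) =
      ∑ t ∈ f.support, if (∀ β ∉ T, t β = 0) ∧ ∑ β, t β • d β = e then coeff t f else 0 := by
  rw [aeval_def, eval₂_eq', coeff_sum]
  refine Finset.sum_congr rfl fun t _ => ?_
  rw [MvPolynomial.algebraMap_eq, coeff_C_mul]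
  by_cases h : ∀ β ∉ T, t β = 0
  · have : ∏ β, (if β ∈ T then (monomial (d β) 1 : MvPolynomial τ k) else 0) ^ t β =
        monomial (∑ β, t β • d β) 1 := by
      rw [monomial_sum_one]
      refine Finset.prod_congr rfl fun β _ => ?_
      by_cases hβ : β ∈ T
      · rw [if_pos hβ, monomial_pow, one_pow]
      · rw [if_neg hβ, h β hβ, pow_zero, zero_smul, monomial_zero', map_one]
    rw [this, coeff_monomial, mul_ite, mul_one, mul_zero]
    exact if_congr ⟨fun h' => ⟨h, h'⟩, fun h' => h'.2⟩ rfl rfl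
  · rw [if_neg fun h' => h h'.1]
    push Not at h
    obtain ⟨β, hβ, ht⟩ := h
    rw [Finset.prod_eq_zero (Finset.mem_univ β), coeff_zero, mul_zero]
    rw [if_neg hβ, zero_pow ht]

end RankOne
end GTSchubert

namespace GTSchubert

theorem wordDeg_eq_zero_iff {R : Type*} [DecidableEq R] {L : List R} {β : R} :
    wordDeg L β = 0 ↔ β ∉ L := List.count_eq_zero

theorem wordDeg_append {R : Type*} [DecidableEq R] (L L' : List R) :
    wordDeg (L ++ L') = wordDeg L' + wordDeg L := by
  funext β
  simp [wordDeg, add_comm]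

/-! ### Straightening exponents that violate a chain inequality -/

section Upper

open MvPolynomial

variable {n i m : ℕ} {w : Equiv.Perm (Fin (n + 1))}

/-- The coefficient of `c^p` in `exp(∑ c_β e_β) v`, up to the factorials `x^p v / p!`. -/
def expCoeff (n i m : ℕ) (hin : i ≤ n) (w : Equiv.Perm (Fin (n + 1))) (p : PosRoot n → ℕ) :
    MatPoly n i :=
  coeff (Finsupp.equivFunOnFinite.symm p)
    (genericExp n i (liveRoots n i w) (extremalVec n i m hin w))

/-- The marginals of an exponent: the sums over the rows and over the columns. -/
def margin (p : PosRoot n → ℕ) (e : Fin (n + 1)) : ℕ :=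
  ∑ β, p β * ((if β.1.1 = e then 1 else 0) + (if β.1.2 = e then 1 else 0))

theorem sum_margin (p : PosRoot n → ℕ) : ∑ e, margin p e = 2 * ∑ β, p β := by
  simp only [margin]
  rw [Finset.sum_comm, Finset.mul_sum]
  refine Finset.sum_congr rfl fun β _ => ?_
  rw [← Finset.mul_sum, Finset.sum_add_distrib]
  simp
  ring

theorem exists_lt_of_margin_eq {p q : PosRoot n → ℕ} {e : Fin (n + 1)} {β : PosRoot n}
    (h : margin p e = margin q e) (hβ : q β < p β) (he : β.1.1 = e ∨ β.1.2 = e) :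
    ∃ γ, (γ.1.1 = e ∨ γ.1.2 = e) ∧ p γ < q γ := by
  by_contra! hcon
  refine h.not_gt (Finset.sum_lt_sum (fun γ _ => ?_) ⟨β, Finset.mem_univ _, ?_⟩)
  · by_cases hγ : γ.1.1 = e ∨ γ.1.2 = e
    · exact Nat.mul_le_mul_right _ (hcon γ hγ)
    · rw [not_or] at hγ
      simp [hγ.1, hγ.2]
  · refine Nat.mul_lt_mul_of_pos_right hβ ?_
    rcases he with he | he <;> simp [he]

/-- An exponent supported on a chain is the largest one with its marginals. -/
theorem homLexLT_of_margin_eq {r : PosRoot n → PosRoot n → Prop}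
    (hr : IsStrictTotalOrder _ r) (hrw : ExtendsHeightOrder w r) {p q : PosRoot n → ℕ}
    (hp : ∀ β ∉ liveRoots n i w, p β = 0) (hq : ∀ β ∉ liveRoots n i w, q β = 0)
    (hchain : IsChain (fun β γ => rootCell i w β ≤ rootCell i w γ) {β | p β ≠ 0})
    (h : ∀ e, margin q e = margin p e) (hne : q ≠ p) : HomLexLT r q p := by
  have hsum : ∑ β, q β = ∑ β, p β := by
    have := sum_margin q
    rw [Finset.sum_congr rfl fun e _ => h e, sum_margin] at this
    omega
  obtain ⟨β, hβ, hlast⟩ := exists_last_ne hr hne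
  refine Or.inr ⟨hsum, β, ?_, hlast⟩
  by_contra hle
  have hlt : p β < q β := by omega
  have hβN : β ∈ liveRoots n i w := by_contra fun h' => by rw [hp β h', hq β h'] at hlt; omega
  -- At the ≺-largest discrepancy β, an excess of `q` is compensated by γ in the row and δ in the
  -- column of the cell of β, where `p` exceeds `q`. As neither is ≻ β, both lie at smaller cells;
  -- these are incomparable, although both belong to the chain supporting `p`.
  obtain ⟨γ, hγ, hγlt⟩ := exists_lt_of_margin_eq (h β.1.2) hlt (Or.inr rfl)
  obtain ⟨δ, hδ, hδlt⟩ := exists_lt_of_margin_eq (h β.1.1) hlt (Or.inl rfl)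
  have hγN : γ ∈ liveRoots n i w := by_contra fun h' => by rw [hp γ h', hq γ h'] at hγlt; omega
  have hδN : δ ∈ liveRoots n i w := by_contra fun h' => by rw [hp δ h', hq δ h'] at hδlt; omega
  have hγ : γ.1.2 = β.1.2 := hγ.resolve_left fun h' => liveRoots_ne hγN hβN h'.symm
  have hδ : δ.1.1 = β.1.1 := hδ.resolve_right fun h' => liveRoots_ne hβN hδN h'
  have h₁ : ¬ rootCell i w β < rootCell i w γ := fun h' => by
    have := hlast γ (rel_of_rootCell_lt hrw hβN hγN h')
    omega
  have h₂ : ¬ rootCell i w β < rootCell i w δ := fun h' => by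
    have := hlast δ (rel_of_rootCell_lt hrw hβN hδN h')
    omega
  have hγβ : γ ≠ β := by rintro rfl; omega
  have hδβ : δ ≠ β := by rintro rfl; omega
  have hγδ : γ ≠ δ := by
    rintro rfl
    exact hγβ (Subtype.ext (Prod.ext hδ hγ))
  have h₁' : ¬ rootCell i w γ = rootCell i w β := fun h' => hγβ (rootCell_injOn hγN hβN h')
  have h₂' : ¬ rootCell i w δ = rootCell i w β := fun h' => hδβ (rootCell_injOn hδN hβN h')
  have hc := hchain (show p γ ≠ 0 by omega) (show p δ ≠ 0 by omega) hγδ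
  simp only [rootCell, hγ, hδ, Prod.mk_lt_mk, Prod.mk_le_mk, Prod.mk.injEq,
    true_and, and_true] at h₁ h₂ h₁' h₂' hc
  obtain ⟨hβ₁, hβ₂⟩ := hβN
  obtain ⟨hγ₁, hγ₂⟩ := hγN
  obtain ⟨hδ₁, hδ₂⟩ := hδN
  rw [hγ] at hγ₁
  rw [hδ] at hδ₂
  omega

/-- The live roots whose cells are at most `top`. -/
def rootsBelow (n i : ℕ) (w : Equiv.Perm (Fin (n + 1))) (top : ℕ × ℕ) : Set (PosRoot n) :=
  {β | β ∈ liveRoots n i w ∧ rootCell i w β ≤ top}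

open scoped Classical in
/-- The substitution `c_β ↦ z_a z_b` for `β = (a, b) ∈ T`. -/
def rankOneHom (n i : ℕ) (T : Set (PosRoot n)) : MvPolynomial (PosRoot n) (MatPoly n i) →ₐ[MatPoly n i]
    MvPolynomial (Fin (n + 1)) (MatPoly n i) :=
  aeval fun β => if β ∈ T then monomial (Finsupp.single β.1.1 1 + Finsupp.single β.1.2 1) 1 else 0

theorem rankOneHom_C (T : Set (PosRoot n)) (f : MatPoly n i) : rankOneHom n i T (C f) = C f :=
  AlgHom.commutes _ f

open scoped Classical in
theorem rankOneHom_X (T : Set (PosRoot n)) (β : PosRoot n) :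
    rankOneHom n i T (X β) = if β ∈ T then X β.1.1 * X β.1.2 else 0 := by
  rw [rankOneHom, aeval_X]
  refine if_congr Iff.rfl ?_ rfl
  rw [← one_mul (1 : MatPoly n i), ← monomial_mul]
  rfl

open scoped Classical in
-- The whole rectangle of cells below `top` lies in the diagram, so no entry of the product of the
-- column and the row is cut off: the perturbation has rank one.
theorem rankOneHom_genericExp_X (hin : i ≤ n) (hw : IsMinRep n i w) {top : ℕ × ℕ}
    (htop : top ∈ diagram n i w) {b : Fin (n + 1)} (hb : (w.symm b).val < i) (q : Fin i) :
    rankOneHom n i (rootsBelow n i w top) (genericExp n i (liveRoots n i w) (X (b, q))) =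
      C (X (b, q)) + (if i - 1 - (w.symm b).val ≤ top.1 then X b else 0) *
        ∑ a, if i ≤ (w.symm a).val ∧ (w.symm a).val - i ≤ top.2 then C (X (a, q)) * X a else 0 := by
  have hterm : ∀ β : PosRoot n, rankOneHom n i (rootsBelow n i w top)
      (if β ∈ liveRoots n i w ∧ β.1.2 = b then X β * C (X (β.1.1, q)) else 0) =
      if β ∈ rootsBelow n i w top ∧ β.1.2 = b then X β.1.1 * X β.1.2 * C (X (β.1.1, q)) else 0 := by
    intro β
    by_cases h₁ : β ∈ liveRoots n i w ∧ β.1.2 = b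
    · rw [if_pos h₁, map_mul, rankOneHom_C, rankOneHom_X, ite_mul, zero_mul]
      exact if_congr ⟨fun h => ⟨h, h₁.2⟩, fun h => h.1⟩ rfl rfl
    · rw [if_neg h₁, map_zero, if_neg fun h => h₁ ⟨h.1.1, h.2⟩]
  rw [genericExp_X, map_add, rankOneHom_C, map_sum, Finset.sum_congr rfl fun β _ => hterm β]
  congr 1
  by_cases hk : i - 1 - (w.symm b).val ≤ top.1
  · have hlive : ∀ a, i ≤ (w.symm a).val ∧ (w.symm a).val - i ≤ top.2 → a < b := fun a h =>
      (mem_diagram_iff hb h.1).1 (hw.isLowerSet_diagram hin (a := top)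
        (b := (i - 1 - (w.symm b).val, (w.symm a).val - i)) ⟨hk, h.2⟩ htop)
    rw [if_pos hk, Finset.mul_sum, ← Finset.sum_filter]
    simp only [mul_ite, mul_zero]
    rw [← Finset.sum_filter]
    refine Finset.sum_bij' (fun β _ => β.1.1) (fun a ha => ⟨(a, b), hlive a (Finset.mem_filter.1 ha).2⟩)
      ?_ ?_ ?_ ?_ ?_
    · intro β hβ
      obtain ⟨-, ⟨h₁, h₂⟩, h₃⟩ := Finset.mem_filter.1 hβ
      exact Finset.mem_filter.2 ⟨Finset.mem_univ _, h₁.2, h₂.2⟩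
    · intro a ha
      obtain ⟨-, h₁, h₂⟩ := Finset.mem_filter.1 ha
      exact Finset.mem_filter.2 ⟨Finset.mem_univ _, ⟨⟨hb, h₁⟩, hk, h₂⟩, rfl⟩
    · intro β hβ
      obtain ⟨-, -, h₃⟩ := Finset.mem_filter.1 hβ
      exact Subtype.ext (Prod.ext rfl h₃.symm)
    · intro a ha
      rfl
    · intro β hβ
      obtain ⟨-, -, h₃⟩ := Finset.mem_filter.1 hβ
      rw [h₃]
      ring
  · rw [if_neg hk, zero_mul]
    refine Finset.sum_eq_zero fun β _ => if_neg ?_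
    rintro ⟨h, rfl⟩
    exact hk h.2.1

theorem totalDegree_rankOneHom_genericExp (hin : i ≤ n) (hw : IsMinRep n i w) {top : ℕ × ℕ}
    (htop : top ∈ diagram n i w) :
    (rankOneHom n i (rootsBelow n i w top)
      (genericExp n i (liveRoots n i w) (extremalVec n i m hin w))).totalDegree ≤ 2 * m := by
  classical
  let u : Fin i → MvPolynomial (Fin (n + 1)) (MatPoly n i) := fun k =>
    if i - 1 - k.val ≤ top.1 then X (w (Fin.castLE (by omega) k)) else 0
  let y : Fin i → MvPolynomial (Fin (n + 1)) (MatPoly n i) := fun q =>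
    ∑ a, if i ≤ (w.symm a).val ∧ (w.symm a).val - i ≤ top.2 then C (X (a, q)) * X a else 0
  have hu : ∀ k, (u k).totalDegree ≤ 1 := by
    intro k
    simp only [u]
    split_ifs
    · rw [totalDegree_X]
    · simp
  have hy : ∀ k, (y k).totalDegree ≤ 1 := by
    intro q
    refine (totalDegree_finsetSum _ _).trans (Finset.sup_le fun a _ => ?_)
    split_ifs
    · refine (totalDegree_mul _ _).trans ?_
      rw [totalDegree_C, totalDegree_X]
    · simp
  have h := totalDegree_det_rankOne (Matrix.of fun k q : Fin i =>
    (X (w (Fin.castLE (by omega) k), q) : MatPoly n i)) hu hy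
  rw [show extremalVec n i m hin w = extremalMinor n i hin w ^ m from rfl, map_pow, map_pow,
    genericExp_extremalMinor, AlgHom.map_det]
  refine (totalDegree_pow _ _).trans ?_
  rw [mul_comm]
  refine Nat.mul_le_mul_right m (le_of_eq_of_le ?_ h)
  congr 2
  ext1 k q
  have hk : (w.symm (w (Fin.castLE (show i ≤ n + 1 by omega) k))).val = k.val := by
    rw [Equiv.symm_apply_apply]
    rfl
  have := rankOneHom_genericExp_X hin hw htop (hk ▸ k.2) q
  rw [hk] at this
  exact this

theorem margin_eq_of_sum_eq (p : PosRoot n → ℕ) (e : Fin (n + 1)) :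
    (∑ β, p β • (Finsupp.single β.1.1 1 + Finsupp.single β.1.2 1 : Fin (n + 1) →₀ ℕ)) e =
      margin p e := by
  rw [Finsupp.finsetSum_apply]
  refine Finset.sum_congr rfl fun β _ => ?_
  simp [Finsupp.single_apply, mul_add]

/-- The vectors `x^q v` of smaller multi-exponent. -/
def smallerSpan (n i m : ℕ) (hin : i ≤ n) (w : Equiv.Perm (Fin (n + 1)))
    (r : PosRoot n → PosRoot n → Prop) (p : PosRoot n → ℕ) : Submodule ℂ (MatPoly n i) :=
  Submodule.span ℂ {y | ∃ q : PosRoot n → ℕ, (∀ β ∉ liveRoots n i w, q β = 0) ∧ HomLexLT r q p ∧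
    y = expCoeff n i m hin w q}

/-- The generic exponential is specialised to rank one on the rectangle below the top cell of the
chain. The result has degree at most 2m, whereas the monomial recording the margins of `p` has
degree 2∑p > 2m. Its vanishing coefficient is a relation between the vectors of the exponents with
these margins, among which `p` is the largest by `homLexLT_of_margin_eq`. -/
theorem expCoeff_mem_of_chain (hin : i ≤ n) (hw : IsMinRep n i w)
    {r : PosRoot n → PosRoot n → Prop} (hr : IsStrictTotalOrder _ r)
    (hrw : ExtendsHeightOrder w r) {p : PosRoot n → ℕ} (hp : ∀ β ∉ liveRoots n i w, p β = 0)
    (hchain : IsChain (fun β γ => rootCell i w β ≤ rootCell i w γ) {β | p β ≠ 0})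
    (hsum : m < ∑ β, p β) : expCoeff n i m hin w p ∈ smallerSpan n i m hin w r p := by
  classical
  have hne : (Finset.univ.filter fun β => p β ≠ 0).Nonempty := by
    rw [Finset.nonempty_iff_ne_empty]
    intro h
    rw [Finset.filter_eq_empty_iff] at h
    rw [Finset.sum_eq_zero fun β hβ => not_not.1 (h hβ)] at hsum
    omega
  obtain ⟨τ, hτ, hmax⟩ := Finset.exists_max_image (Finset.univ.filter fun β => p β ≠ 0)
    (fun β => (rootCell i w β).1 + (rootCell i w β).2) hne
  have hτ0 := (Finset.mem_filter.1 hτ).2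
  have hτN : τ ∈ liveRoots n i w := by_contra fun h => hτ0 (hp τ h)
  have hle : ∀ β, p β ≠ 0 → rootCell i w β ≤ rootCell i w τ := by
    intro β hβ
    by_cases e : β = τ
    · rw [e]
    · have h₁ := hmax β (Finset.mem_filter.2 ⟨Finset.mem_univ _, hβ⟩)
      rcases hchain hβ hτ0 e with h | h
      · exact h
      · refine le_of_eq (Prod.ext ?_ ?_) <;> have := h.1 <;> have := h.2 <;> omega
  set e : Fin (n + 1) →₀ ℕ :=
    ∑ β, p β • (Finsupp.single β.1.1 1 + Finsupp.single β.1.2 1 : Fin (n + 1) →₀ ℕ) with he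
  have hzero : coeff e (rankOneHom n i (rootsBelow n i w (rootCell i w τ))
      (genericExp n i (liveRoots n i w) (extremalVec n i m hin w))) = 0 := by
    refine coeff_eq_zero_of_totalDegree_lt
      ((totalDegree_rankOneHom_genericExp hin hw (rootCell_mem hτN)).trans_lt ?_)
    rw [Finset.sum_subset (Finset.subset_univ _) fun a _ ha => Finsupp.notMem_support_iff.1 ha,
      Finset.sum_congr rfl fun a _ => margin_eq_of_sum_eq p a, sum_margin]
    omega
  rw [rankOneHom, coeff_aeval_monomial] at hzero
  set f := genericExp n i (liveRoots n i w) (extremalVec n i m hin w) with hf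
  by_cases hps : Finsupp.equivFunOnFinite.symm p ∈ f.support
  · rw [← Finset.add_sum_erase _ _ hps, if_pos] at hzero
    · rw [expCoeff, ← hf, eq_neg_of_add_eq_zero_left hzero]
      refine Submodule.neg_mem _ (Submodule.sum_mem _ fun t ht => ?_)
      split_ifs with h
      · refine Submodule.subset_span ⟨t, fun β hβ => h.1 β fun hβ' => hβ hβ'.1, ?_, ?_⟩
        · refine homLexLT_of_margin_eq hr hrw hp (fun β hβ => h.1 β fun hβ' => hβ hβ'.1) hchain ?_ ?_
          · intro a
            rw [← margin_eq_of_sum_eq, ← margin_eq_of_sum_eq, h.2]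
          · intro h'
            refine (Finset.mem_erase.1 ht).1 (DFunLike.coe_injective ?_)
            exact h'
        · rw [expCoeff, ← hf]
          congr 1
          exact (Equiv.symm_apply_apply _ _).symm
      · exact Submodule.zero_mem _
    · refine ⟨fun β hβ => ?_, rfl⟩
      by_contra h
      exact hβ ⟨by_contra fun h' => h (hp β h'), hle β h⟩
  · rw [expCoeff, ← hf, notMem_support_iff.1 hps]
    exact Submodule.zero_mem _

theorem exists_expCoeff_eq_smul_word (hin : i ≤ n) (L : List (PosRoot n))
    (hL : ∀ β ∈ L, β ∈ liveRoots n i w) :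
    ∃ k : ℂ, k ≠ 0 ∧ (L.map fun β => polarization n i β.1.1 β.1.2).prod (extremalVec n i m hin w) =
      k • expCoeff n i m hin w (wordDeg L) :=
  exists_word_eq_smul_coeff (fun _ hβ _ hγ => liveRoots_ne hβ hγ) L hL _

theorem word_apply_expCoeff (hin : i ≤ n) (L : List (PosRoot n))
    (hL : ∀ β ∈ L, β ∈ liveRoots n i w) {q : PosRoot n → ℕ}
    (hq : ∀ β ∉ liveRoots n i w, q β = 0) :
    ∃ k : ℂ, k ≠ 0 ∧ (L.map fun β => polarization n i β.1.1 β.1.2).prod (expCoeff n i m hin w q) =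
      k • expCoeff n i m hin w (q + wordDeg L) := by
  obtain ⟨L', rfl⟩ := exists_wordDeg_eq q
  have hL' : ∀ β ∈ L', β ∈ liveRoots n i w := by
    intro β hβ
    by_contra h
    exact wordDeg_eq_zero_iff.1 (hq β h) hβ
  obtain ⟨k, hk, e⟩ := exists_expCoeff_eq_smul_word (m := m) hin L' hL'
  obtain ⟨k', hk', e'⟩ := exists_expCoeff_eq_smul_word (m := m) hin (L ++ L')
    (fun β hβ => (List.mem_append.1 hβ).elim (hL β) (hL' β))
  rw [List.map_append, List.prod_append, Module.End.mul_apply, e, map_smul, wordDeg_append] at e'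
  refine ⟨k⁻¹ * k', mul_ne_zero (inv_ne_zero hk) hk', ?_⟩
  rw [mul_smul, ← e', smul_smul, inv_mul_cancel₀ hk, one_smul]

/-- Only the part `s` of `p` on a violating chain is straightened. The remaining letters are applied
afterwards, which respects the order because it is compatible with addition. -/
theorem expCoeff_mem_smallerSpan (hin : i ≤ n) (hw : IsMinRep n i w)
    {r : PosRoot n → PosRoot n → Prop} (hr : IsStrictTotalOrder _ r)
    (hrw : ExtendsHeightOrder w r) {p : PosRoot n → ℕ} (hp : ∀ β ∉ liveRoots n i w, p β = 0)
    (hpA : p ∉ liveExps n i m w) : expCoeff n i m hin w p ∈ smallerSpan n i m hin w r p := by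
  classical
  obtain ⟨Γ, hΓN, hΓ, hsum⟩ : ∃ Γ : Finset (PosRoot n), ↑Γ ⊆ liveRoots n i w ∧
      IsChain (fun β γ => rootCell i w β ≤ rootCell i w γ) (Γ : Set (PosRoot n)) ∧
      m < ∑ β ∈ Γ, p β := by
    by_contra! h
    exact hpA ⟨hp, fun Γ h₁ h₂ => h Γ h₁ h₂⟩
  set s : PosRoot n → ℕ := fun β => if β ∈ Γ then p β else 0 with hs
  obtain ⟨L, hL⟩ := exists_wordDeg_eq fun β => if β ∈ Γ then 0 else p β
  have hpL : p = s + wordDeg L := by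
    rw [hL]
    funext β
    simp only [hs, Pi.add_apply]
    split_ifs <;> simp
  have hLN : ∀ β ∈ L, β ∈ liveRoots n i w := by
    intro β hβ
    by_contra h
    have h₁ := congrFun hL β
    simp only [hp β h, ite_self] at h₁
    exact wordDeg_eq_zero_iff.1 h₁ hβ
  have hsN : ∀ β ∉ liveRoots n i w, s β = 0 := by
    intro β hβ
    simp only [hs, hp β hβ, ite_self]
  have hmem := expCoeff_mem_of_chain (m := m) hin hw hr hrw hsN (hΓ.mono fun β hβ => by
      by_contra h
      exact hβ (if_neg h)) (by simpa [hs, Finset.sum_ite_mem] using hsum)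
  obtain ⟨k, hk, e⟩ := word_apply_expCoeff (m := m) hin L hLN hsN
  have hle : smallerSpan n i m hin w r s ≤ (smallerSpan n i m hin w r p).comap
      (L.map fun β => polarization n i β.1.1 β.1.2).prod := by
    refine Submodule.span_le.2 ?_
    rintro _ ⟨q, hqN, hq, rfl⟩
    obtain ⟨k', hk', e'⟩ := word_apply_expCoeff (m := m) hin L hLN hqN
    rw [SetLike.mem_coe, Submodule.mem_comap, e', hpL]
    refine Submodule.smul_mem _ _ (Submodule.subset_span ⟨_, ?_, hq.add _, rfl⟩)
    intro β hβ
    rw [Pi.add_apply, hqN β hβ, zero_add, wordDeg_eq_zero_iff]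
    exact fun h => hβ (hLN β h)
  have := hle hmem
  rw [Submodule.mem_comap, e, ← hpL, Submodule.smul_mem_iff _ hk] at this
  exact this

end Upper
end GTSchubert

namespace GTSchubert

open MvPolynomial

/-! ### The Cauchy–Binet formula and positivity -/

/-- In this form of Cauchy–Binet the sum runs over all maps instead of subsets. Every subset of
columns is counted once for each ordering, hence the factorial, and non-injective maps contribute
zero. -/
theorem factorial_mul_det_mul_transpose {k ι κ : Type*} [CommRing k] [Fintype ι] [DecidableEq ι]
    [Fintype κ] [DecidableEq κ] (A B : Matrix ι κ k) :
    ((Fintype.card ι).factorial : k) * (A * B.transpose).det =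
      ∑ f : ι → κ, (A.submatrix id f).det * (B.submatrix id f).det := by
  have h : (A * B.transpose).det = ∑ f : ι → κ, (A.submatrix id f).det * ∏ a, B a (f a) := by
    rw [Matrix.det_apply']
    simp only [Matrix.mul_apply, Matrix.transpose_apply, Finset.prod_univ_sum, Finset.mul_sum,
      Fintype.piFinset_univ]
    rw [Finset.sum_comm]
    refine Finset.sum_congr rfl fun f _ => ?_
    rw [Matrix.det_apply', Finset.sum_mul]
    refine Finset.sum_congr rfl fun σ _ => ?_
    rw [Finset.prod_mul_distrib, mul_assoc]
    rfl
  have h' : ∀ τ : Equiv.Perm ι, (A * B.transpose).det =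
      ∑ f : ι → κ, (A.submatrix id f).det * ((Equiv.Perm.sign τ : ℤ) * ∏ a, B (τ a) (f a)) := by
    intro τ
    rw [h, ← (Equiv.arrowCongr τ (Equiv.refl κ)).sum_comp]
    refine Finset.sum_congr rfl fun f _ => ?_
    have e : A.submatrix id (Equiv.arrowCongr τ (Equiv.refl κ) f) =
        (A.submatrix id f).submatrix id τ.symm := rfl
    have e' : ∏ a, B a (Equiv.arrowCongr τ (Equiv.refl κ) f a) = ∏ a, B (τ a) (f a) := by
      rw [← Equiv.prod_comp τ fun a => B a (Equiv.arrowCongr τ (Equiv.refl κ) f a)]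
      simp
    rw [e, Matrix.det_permute', e', Equiv.Perm.sign_symm]
    ring
  have hsum : ((Fintype.card ι).factorial : k) * (A * B.transpose).det =
      ∑ τ : Equiv.Perm ι, (A * B.transpose).det := by
    rw [Finset.sum_const, Finset.card_univ, Fintype.card_perm, nsmul_eq_mul]
  rw [hsum, Finset.sum_congr rfl fun τ _ => h' τ, Finset.sum_comm]
  refine Finset.sum_congr rfl fun f _ => ?_
  rw [← Finset.mul_sum, Matrix.det_apply' (B.submatrix id f)]
  rfl

/-- Pairing the relation with the conjugate of `c` gives a sum of squared absolute values;
integrality of `z` makes its entries invariant under conjugation. -/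
theorem eq_zero_of_gram {A I : Type*} [Fintype A] [Fintype I] (z : I → A → ℤ) (c : A → ℂ)
    (h : ∀ t, ∑ a, c a * ∑ F, (z F a : ℂ) * z F t = 0) (F : I) : ∑ a, c a * (z F a : ℂ) = 0 := by
  have key : ∑ F, (∑ a, c a * (z F a : ℂ)) * star (∑ a, c a * (z F a : ℂ)) = 0 := by
    calc ∑ F, (∑ a, c a * (z F a : ℂ)) * star (∑ a, c a * (z F a : ℂ))
        = ∑ t, star (c t) * ∑ a, c a * ∑ F, (z F a : ℂ) * z F t := by
          simp only [star_sum, star_mul', star_intCast, Finset.sum_mul, Finset.mul_sum]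
          rw [Finset.sum_comm]
          refine (Finset.sum_congr rfl fun a _ => Finset.sum_comm).trans ?_
          refine Finset.sum_congr rfl fun t _ => Finset.sum_congr rfl fun a _ =>
            Finset.sum_congr rfl fun F _ => ?_
          ring
      _ = 0 := by simp [h]
  have hnn : ∀ F ∈ Finset.univ, 0 ≤ Complex.normSq (∑ a, c a * (z F a : ℂ)) :=
    fun F _ => Complex.normSq_nonneg _
  have key' : ∑ F, Complex.normSq (∑ a, c a * (z F a : ℂ)) = 0 := by
    rw [← Complex.ofReal_inj, Complex.ofReal_sum, Complex.ofReal_zero, ← key]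
    exact Finset.sum_congr rfl fun F _ => (Complex.mul_conj _).symm
  exact Complex.normSq_eq_zero.1 ((Finset.sum_eq_zero_iff_of_nonneg hnn).1 key' F (Finset.mem_univ F))

/-! ### Lowest monomials -/

/-- The monomial `X^p` occurs in `g` with coefficient one and is the smallest one. -/
def HasLowest {R k : Type*} [Fintype R] [CommRing k] (r : R → R → Prop) (g : MvPolynomial R k)
    (p : R →₀ ℕ) : Prop :=
  coeff p g = 1 ∧ ∀ t, coeff t g ≠ 0 → t = p ∨ HomLexLT r p t

theorem HasLowest.mul {R k : Type*} [Fintype R] [CommRing k] {r : R → R → Prop}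
    (hr : IsStrictTotalOrder R r) {g g' : MvPolynomial R k} {p p' : R →₀ ℕ}
    (h : HasLowest r g p) (h' : HasLowest r g' p') : HasLowest r (g * g') (p + p') := by
  classical
  have key : ∀ a b, coeff a g ≠ 0 → coeff b g' ≠ 0 →
      (a = p ∧ b = p') ∨ HomLexLT r (p + p' : R →₀ ℕ) (a + b : R →₀ ℕ) := by
    intro a b ha hb
    rcases h.2 a ha with rfl | hp <;> rcases h'.2 b hb with rfl | hp'
    · exact Or.inl ⟨rfl, rfl⟩
    · right
      have := hp'.add a
      rwa [add_comm, add_comm (b : R → ℕ)] at this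
    · exact Or.inr (hp.add b)
    · right
      have h₁ := hp.add p'
      have h₂ := hp'.add a
      rw [add_comm (p' : R → ℕ), add_comm (b : R → ℕ)] at h₂
      exact h₁.trans hr h₂
  constructor
  · rw [coeff_mul, Finset.sum_eq_single (p, p'), h.1, h'.1, one_mul]
    · rintro ⟨a, b⟩ hab hne
      rw [Finset.HasAntidiagonal.mem_antidiagonal] at hab
      by_contra hcon
      rcases key a b (left_ne_zero_of_mul hcon) (right_ne_zero_of_mul hcon) with ⟨rfl, rfl⟩ | hlt
      · exact hne rfl
      · dsimp only at hab
        rw [hab] at hlt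
        exact hlt.irrefl _
    · intro hp
      exact (hp (by rw [Finset.HasAntidiagonal.mem_antidiagonal])).elim
  · intro t ht
    rw [coeff_mul] at ht
    obtain ⟨⟨a, b⟩, hab, hne⟩ := Finset.exists_ne_zero_of_sum_ne_zero ht
    rw [Finset.HasAntidiagonal.mem_antidiagonal] at hab
    dsimp only at hab
    subst hab
    rcases key a b (left_ne_zero_of_mul hne) (right_ne_zero_of_mul hne) with ⟨rfl, rfl⟩ | hlt
    · exact Or.inl rfl
    · exact Or.inr hlt

theorem HasLowest.prod {R k J : Type*} [Fintype R] [CommRing k] {r : R → R → Prop}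
    (hr : IsStrictTotalOrder R r) {g : J → MvPolynomial R k} {p : J → R →₀ ℕ} (s : Finset J)
    (h : ∀ j, HasLowest r (g j) (p j)) : HasLowest r (∏ j ∈ s, g j) (∑ j ∈ s, p j) := by
  classical
  induction s using Finset.induction_on with
  | empty =>
    refine ⟨by simp, fun t ht => Or.inl ?_⟩
    by_contra hne
    rw [Finset.prod_empty, coeff_one, if_neg fun h => hne h.symm] at ht
    exact ht rfl
  | insert j s hj ih =>
    rw [Finset.prod_insert hj, Finset.sum_insert hj]
    exact (h j).mul hr ih

/-! ### The generic matrix of the open cell -/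

section GenMat

variable {n i : ℕ} (k : Type*) [CommRing k]

/-- The generic matrix with the identity in the columns `w(1), …, w(i)` and with indeterminates
at the live roots. -/
def genMat (n i : ℕ) (hin : i ≤ n) (w : Equiv.Perm (Fin (n + 1))) :
    Matrix (Fin i) (Fin (n + 1)) (MvPolynomial (PosRoot n) k) :=
  Matrix.of fun a b => if b = w (Fin.castLE (by omega) a) then 1 else
    if h : b < w (Fin.castLE (by omega) a) ∧ i ≤ (w.symm b).val then X ⟨(b, _), h.1⟩ else 0

variable {k} {w : Equiv.Perm (Fin (n + 1))}

theorem symm_apply_castLE (h : i ≤ n + 1) (a : Fin i) : (w.symm (w (Fin.castLE h a))).val = a.val := by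
  rw [Equiv.symm_apply_apply]
  rfl

theorem map_genMat {k' : Type*} [CommRing k'] (hin : i ≤ n) (φ : k →+* k') :
    (genMat k n i hin w).map (MvPolynomial.map φ) = genMat k' n i hin w := by
  ext1 a b
  simp only [Matrix.map_apply, genMat, Matrix.of_apply]
  split_ifs <;> simp

/-- This writes the exponential of the minor as the determinant of a product of matrices, the shape
needed for Cauchy–Binet. -/
theorem genericExp_X_eq_sum (hin : i ≤ n) (a q : Fin i) :
    genericExp n i (liveRoots n i w) (X (w (Fin.castLE (by omega) a), q)) =
      ∑ b, genMat (MatPoly n i) n i hin w a b * C (X (b, q)) := by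
  classical
  have hlt : ∀ b : Fin (n + 1), i ≤ (w.symm b).val → b ≠ w (Fin.castLE (by omega) a) := by
    rintro b hb rfl
    rw [symm_apply_castLE] at hb
    omega
  rw [genericExp_X, ← Finset.add_sum_erase _ _ (Finset.mem_univ (w (Fin.castLE (by omega) a)))]
  congr 1
  · simp [genMat]
  · rw [← Finset.sum_filter]
    have : ∀ b ∈ Finset.univ.erase (w (Fin.castLE (by omega) a)),
        genMat (MatPoly n i) n i hin w a b * C (X (b, q)) =
        if h : b < w (Fin.castLE (by omega) a) ∧ i ≤ (w.symm b).val then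
          X ⟨(b, w (Fin.castLE (by omega) a)), h.1⟩ * C (X (b, q)) else 0 := by
      intro b hb
      simp only [genMat, Matrix.of_apply, if_neg (Finset.mem_erase.1 hb).1, dite_mul, zero_mul]
    rw [Finset.sum_congr rfl this, Finset.sum_dite, Finset.sum_const_zero, add_zero]
    refine Finset.sum_bij' (fun β hβ => ⟨β.1.1, ?_⟩) (fun b _ => ⟨(b.1, w (Fin.castLE (by omega) a)),
      (Finset.mem_filter.1 b.2).2.1⟩) ?_ ?_ ?_ ?_ ?_
    · obtain ⟨-, h, h'⟩ := Finset.mem_filter.1 hβ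
      exact Finset.mem_filter.2 ⟨Finset.mem_erase.2 ⟨hlt _ h.2, Finset.mem_univ _⟩, lt_of_lt_of_eq β.2 h', h.2⟩
    · intro β hβ
      exact Finset.mem_attach _ _
    · intro b hb
      have h := (Finset.mem_filter.1 b.2).2
      refine Finset.mem_filter.2 ⟨Finset.mem_univ _, ⟨?_, h.2⟩, rfl⟩
      dsimp only
      rw [symm_apply_castLE]
      exact a.2
    · intro β hβ
      obtain ⟨-, h, h'⟩ := Finset.mem_filter.1 hβ
      exact Subtype.ext (Prod.ext rfl h'.symm)
    · intro b hb
      rfl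
    · intro β hβ
      obtain ⟨-, h, h'⟩ := Finset.mem_filter.1 hβ
      congr 2
      exact Subtype.ext (Prod.ext rfl h')

variable (k) in
/-- The minor of the generic matrix on a family of columns. -/
def genMinor (n i : ℕ) (hin : i ≤ n) (w : Equiv.Perm (Fin (n + 1))) (f : Fin i → Fin (n + 1)) :
    MvPolynomial (PosRoot n) k := ((genMat k n i hin w).submatrix id f).det

theorem map_genMinor {k' : Type*} [CommRing k'] (hin : i ≤ n) (φ : k →+* k')
    (f : Fin i → Fin (n + 1)) :
    MvPolynomial.map φ (genMinor k n i hin w f) = genMinor k' n i hin w f := by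
  rw [genMinor, genMinor, RingHom.map_det, ← map_genMat hin φ]
  rfl

/-- The matrix variables are specialised to a second copy of `genMat`. By Cauchy–Binet the
exponential becomes ∑ P_F ⊗ P_F over products P_F of minors, so the coefficients of the specialised
vectors form a Gram matrix. -/
theorem gram_expCoeff (m : ℕ) (hin : i ≤ n) (p : PosRoot n → ℕ) :
    ((i.factorial : ℂ) ^ m) • aeval (fun e : Fin (n + 1) × Fin i => genMat ℂ n i hin w e.2 e.1)
      (expCoeff n i m hin w p) = ∑ F : Fin m → Fin i → Fin (n + 1),
      coeff (Finsupp.equivFunOnFinite.symm p) (∏ j, genMinor ℂ n i hin w (F j)) •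
        ∏ j, genMinor ℂ n i hin w (F j) := by
  set π : MatPoly n i →ₐ[ℂ] MvPolynomial (PosRoot n) ℂ :=
    aeval (fun e : Fin (n + 1) × Fin i => genMat ℂ n i hin w e.2 e.1) with hπ
  let G : Matrix (Fin i) (Fin (n + 1)) (MvPolynomial (PosRoot n) (MvPolynomial (PosRoot n) ℂ)) :=
    genMat (MvPolynomial (PosRoot n) ℂ) n i hin w
  let B : Matrix (Fin i) (Fin (n + 1)) (MvPolynomial (PosRoot n) (MvPolynomial (PosRoot n) ℂ)) :=
    (genMat ℂ n i hin w).map C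
  have hdet : MvPolynomial.map π.toRingHom (genericExp n i (liveRoots n i w) (extremalMinor n i hin w)) =
      (G * B.transpose).det := by
    rw [genericExp_extremalMinor, RingHom.map_det]
    congr 1
    ext1 a q
    simp only [RingHom.mapMatrix_apply, Matrix.map_apply, Matrix.of_apply, genericExp_X_eq_sum hin,
      map_sum, map_mul, Matrix.mul_apply, Matrix.transpose_apply]
    refine Finset.sum_congr rfl fun b _ => ?_
    have h₁ := congrFun (congrFun (map_genMat (w := w) hin π.toRingHom) a) b
    have h₂ : MvPolynomial.map π.toRingHom (C (X (b, q)) : MvPolynomial (PosRoot n) (MatPoly n i)) =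
        C (genMat ℂ n i hin w q b) := by
      rw [map_C]
      congr 1
      exact aeval_X _ _
    exact congrArg₂ (· * ·) h₁ h₂
  have hmain : (C ((i.factorial : MvPolynomial (PosRoot n) ℂ) ^ m) :
      MvPolynomial (PosRoot n) (MvPolynomial (PosRoot n) ℂ)) *
      MvPolynomial.map π.toRingHom (genericExp n i (liveRoots n i w) (extremalVec n i m hin w)) =
      ∑ F : Fin m → Fin i → Fin (n + 1), MvPolynomial.map C (∏ j, genMinor ℂ n i hin w (F j)) *
        C (∏ j, genMinor ℂ n i hin w (F j)) := by
    rw [show extremalVec n i m hin w = extremalMinor n i hin w ^ m from rfl, C_pow, map_pow, map_pow, hdet,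
      ← mul_pow, map_natCast]
    have := factorial_mul_det_mul_transpose G B
    rw [Fintype.card_fin] at this
    rw [this, Fintype.sum_pow]
    refine Finset.sum_congr rfl fun F _ => ?_
    rw [Finset.prod_mul_distrib, map_prod, map_prod]
    congr 1
    · refine Finset.prod_congr rfl fun j _ => ?_
      rw [map_genMinor]
      rfl
    · refine Finset.prod_congr rfl fun j _ => ?_
      rw [genMinor, RingHom.map_det]
      rfl
  have := congrArg (coeff (Finsupp.equivFunOnFinite.symm p)) hmain
  rw [coeff_C_mul, coeff_map, coeff_sum] at this
  rw [smul_eq_C_mul, map_pow, map_natCast]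
  refine this.trans (Finset.sum_congr rfl fun F _ => ?_)
  rw [mul_comm, coeff_C_mul, coeff_map, smul_eq_C_mul, mul_comm]

/-- The vectors `x^p v`, `p ∈ liveExps`, are linearly independent if their exponents are the lowest
ones of suitable products of minors. -/
theorem linearIndependent_expCoeff (m : ℕ) (hin : i ≤ n) {r : PosRoot n → PosRoot n → Prop}
    (hr : IsStrictTotalOrder _ r) {A : Type*} [Fintype A] (p : A → PosRoot n → ℕ)
    (hp : Function.Injective p)
    (hlow : ∀ a, ∃ F : Fin m → Fin i → Fin (n + 1), HasLowest r (∏ j, genMinor ℂ n i hin w (F j))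
      (Finsupp.equivFunOnFinite.symm (p a))) :
    LinearIndependent ℂ fun a => expCoeff n i m hin w (p a) := by
  rw [Fintype.linearIndependent_iff]
  intro c hc
  have hz : ∀ (F : Fin m → Fin i → Fin (n + 1)) (t : PosRoot n →₀ ℕ),
      coeff t (∏ j, genMinor ℂ n i hin w (F j)) =
        ((coeff t (∏ j, genMinor ℤ n i hin w (F j)) : ℤ) : ℂ) := by
    intro F t
    rw [← Finset.prod_congr rfl fun j _ => map_genMinor (w := w) hin (Int.castRingHom ℂ) (F j),
      ← map_prod, coeff_map]
    rfl
  have hgram := eq_zero_of_gram (fun (F : Fin m → Fin i → Fin (n + 1)) (a : A) =>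
    coeff (Finsupp.equivFunOnFinite.symm (p a)) (∏ j, genMinor ℤ n i hin w (F j))) c (fun t => ?_)
  · simp only [← hz] at hgram
    -- Triangular elimination, starting from the largest exponent: in the relation for `F` only
    -- exponents not below `p a` survive.
    have wf : WellFounded fun a b : A => HomLexLT r (p b) (p a) :=
      @Finite.wellFounded_of_trans_of_irrefl A _ _ ⟨fun a b d h h' => h'.trans hr h⟩
        ⟨fun a => HomLexLT.irrefl _⟩
    intro a
    induction a using wf.induction with
    | _ a ih =>
      obtain ⟨F, hF₁, hF₂⟩ := hlow a
      have := hgram F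
      rw [Finset.sum_eq_single a, hF₁, mul_one] at this
      · exact this
      · intro b _ hb
        by_cases h : coeff (Finsupp.equivFunOnFinite.symm (p b)) (∏ j, genMinor ℂ n i hin w (F j)) = 0
        · rw [h, mul_zero]
        · rcases hF₂ _ h with h' | h'
          · exact absurd (hp (Finsupp.equivFunOnFinite.symm.injective h')) hb
          · rw [ih b h', zero_mul]
      · simp
  · have h₁ := congrArg (fun y => coeff (Finsupp.equivFunOnFinite.symm (p t))
      (((i.factorial : ℂ) ^ m) • aeval (fun e : Fin (n + 1) × Fin i => genMat ℂ n i hin w e.2 e.1) y)) hc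
    simp only [map_sum, map_smul, map_zero, smul_zero, coeff_zero, Finset.smul_sum, coeff_sum] at h₁
    rw [← h₁]
    refine Finset.sum_congr rfl fun a _ => ?_
    rw [smul_comm, gram_expCoeff, coeff_smul, coeff_sum, smul_eq_mul]
    congr 1
    refine Finset.sum_congr rfl fun F _ => ?_
    rw [coeff_smul, smul_eq_mul, ← hz, ← hz]

end GenMat
end GTSchubert

namespace GTSchubert

open MvPolynomial

/-! ### Minors with a prescribed lowest monomial -/

section AntichainMinor

variable {n i : ℕ} {w : Equiv.Perm (Fin (n + 1))}

/-- The exponent of a nonzero entry of the generic matrix. -/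
def genExponent (n i : ℕ) (hin : i ≤ n) (w : Equiv.Perm (Fin (n + 1))) (a : Fin i)
    (b : Fin (n + 1)) : PosRoot n →₀ ℕ :=
  if h : b < w (Fin.castLE (by omega) a) ∧ i ≤ (w.symm b).val then Finsupp.single ⟨(b, _), h.1⟩ 1 else 0

theorem genMat_eq_monomial (hin : i ≤ n) {a : Fin i} {b : Fin (n + 1)}
    (h : genMat ℂ n i hin w a b ≠ 0) : genMat ℂ n i hin w a b = monomial (genExponent n i hin w a b) 1 := by
  simp only [genMat, Matrix.of_apply, genExponent] at h ⊢
  by_cases h₁ : b = w (Fin.castLE (by omega) a)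
  · rw [if_pos h₁, dif_neg, monomial_zero', map_one]
    rw [h₁]
    exact fun h => lt_irrefl _ h.1
  · rw [if_neg h₁] at h ⊢
    by_cases h₂ : b < w (Fin.castLE (by omega) a) ∧ i ≤ (w.symm b).val
    · rw [dif_pos h₂, dif_pos h₂]
      rfl
    · rw [dif_neg h₂] at h
      exact absurd rfl h

theorem genMat_apply_col (hin : i ≤ n) {a a' : Fin i} :
    genMat ℂ n i hin w a (w (Fin.castLE (by omega) a')) = if a' = a then 1 else 0 := by
  simp only [genMat, Matrix.of_apply]
  rw [dif_neg]
  · refine if_congr ?_ rfl rfl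
    rw [w.injective.eq_iff, Fin.castLE_inj]
  · rw [symm_apply_castLE]
    omega

theorem genMat_apply_live (hin : i ≤ n) {a : Fin i} {b : Fin (n + 1)} (hb : i ≤ (w.symm b).val) :
    genMat ℂ n i hin w a b = if h : b < w (Fin.castLE (by omega) a) then X ⟨(b, _), h⟩ else 0 := by
  simp only [genMat, Matrix.of_apply]
  rw [if_neg]
  · by_cases h : b < w (Fin.castLE (by omega) a)
    · rw [dif_pos ⟨h, hb⟩, dif_pos h]
    · rw [dif_neg fun h' => h h'.1, dif_neg h]
  · rintro rfl
    rw [symm_apply_castLE] at hb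
    omega

/-- The minor that belongs to an antichain of live roots has the product of the roots of the
antichain as its lowest monomial. -/
theorem hasLowest_genMinor (hin : i ≤ n) {r : PosRoot n → PosRoot n → Prop}
    (hr : IsStrictTotalOrder _ r) (hrw : ExtendsHeightOrder w r) (S : Finset (PosRoot n))
    (hS : ∀ β ∈ S, β ∈ liveRoots n i w)
    (hanti : ∀ β ∈ S, ∀ γ ∈ S, rootCell i w β ≤ rootCell i w γ → β = γ) :
    ∃ f, HasLowest r (genMinor ℂ n i hin w f) (∑ β ∈ S, Finsupp.single β 1) := by
  classical
  let W : Fin i → Fin (n + 1) := fun a => w (Fin.castLE (by omega) a)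
  have hW : ∀ a, (w.symm (W a)).val = a.val := fun a => symm_apply_castLE _ a
  let K : Fin i → Prop := fun a => ∃ β ∈ S, β.1.2 = W a
  -- For each root (a, b) in `S`, column `b` of the identity block is exchanged for column `a`. An
  -- antichain has at most one root for each `b`, so the choice is forced.
  let f : Fin i → Fin (n + 1) := fun a => if h : K a then h.choose.1.1 else W a
  have hfK : ∀ β ∈ S, ∀ a, β.1.2 = W a → f a = β.1.1 := by
    intro β hβ a ha
    have hKa : K a := ⟨β, hβ, ha⟩
    have h₁ := hKa.choose_spec
    simp only [f, dif_pos hKa]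
    congr 2
    have h₂ : (w.symm hKa.choose.1.2) = w.symm β.1.2 := by rw [h₁.2, ha]
    rcases le_total (w.symm hKa.choose.1.1).val (w.symm β.1.1).val with h | h
    · exact hanti _ h₁.1 _ hβ ⟨by simp only [rootCell, h₂]; exact le_rfl, Nat.sub_le_sub_right h i⟩
    · exact (hanti _ hβ _ h₁.1
        ⟨by simp only [rootCell, h₂]; exact le_rfl, Nat.sub_le_sub_right h i⟩).symm
  have hfK' : ∀ a, ¬ K a → f a = W a := fun a ha => dif_neg ha
  let row : ∀ β ∈ S, Fin i := fun β hβ => ⟨(w.symm β.1.2).val, (hS β hβ).1⟩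
  have hrow : ∀ β (hβ : β ∈ S), β.1.2 = W (row β hβ) := by
    intro β hβ
    exact (w.apply_symm_apply _).symm.trans (congrArg w (Fin.ext rfl))
  let P : Equiv.Perm (Fin i) → MvPolynomial (PosRoot n) ℂ := fun σ =>
    ∏ a, genMat ℂ n i hin w (σ a) (f a)
  let t : Equiv.Perm (Fin i) → PosRoot n →₀ ℕ := fun σ => ∑ a, genExponent n i hin w (σ a) (f a)
  have hP : ∀ σ, P σ ≠ 0 → P σ = monomial (t σ) 1 := by
    intro σ hσ
    simp only [P, t, monomial_sum_one]
    exact Finset.prod_congr rfl fun a _ =>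
      genMat_eq_monomial hin (Finset.prod_ne_zero_iff.1 hσ a (Finset.mem_univ a))
  have hfix : ∀ σ, P σ ≠ 0 → ∀ a, ¬ K a → σ a = a := by
    intro σ hσ a ha
    have h := Finset.prod_ne_zero_iff.1 hσ a (Finset.mem_univ a)
    rw [hfK' a ha, genMat_apply_col] at h
    by_contra hne
    exact h (if_neg fun h => hne h.symm)
  have hlive : ∀ σ, P σ ≠ 0 → ∀ β (hβ : β ∈ S), ∃ γ : PosRoot n, γ.1.1 = β.1.1 ∧
      γ.1.2 = W (σ (row β hβ)) ∧
      genExponent n i hin w (σ (row β hβ)) (f (row β hβ)) = Finsupp.single γ 1 := by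
    intro σ hσ β hβ
    have h := Finset.prod_ne_zero_iff.1 hσ (row β hβ) (Finset.mem_univ _)
    rw [hfK β hβ _ (hrow β hβ)] at h ⊢
    rw [genMat_apply_live hin (hS β hβ).2] at h
    have h₁ : β.1.1 < w (Fin.castLE (by omega) (σ (row β hβ))) := by
      by_contra h'
      exact h (dif_neg h')
    refine ⟨⟨(β.1.1, w (Fin.castLE (by omega) (σ (row β hβ)))), h₁⟩, rfl, rfl, ?_⟩
    rw [genExponent, dif_pos ⟨h₁, (hS β hβ).2⟩]
  have hP1 : P 1 ≠ 0 := by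
    refine Finset.prod_ne_zero_iff.2 fun a _ => ?_
    rw [Equiv.Perm.one_apply]
    by_cases ha : K a
    · obtain ⟨β, hβ, hβa⟩ := ha
      rw [hfK β hβ a hβa, genMat_apply_live hin (hS β hβ).2, dif_pos]
      · exact X_ne_zero _
      · exact lt_of_lt_of_eq β.2 hβa
    · rw [hfK' a ha, genMat_apply_col, if_pos rfl]
      exact one_ne_zero
  have hexp0 : ∀ σ, P σ ≠ 0 → ∀ a, ¬ K a → genExponent n i hin w (σ a) (f a) = 0 := by
    intro σ hσ a ha
    rw [hfix σ hσ a ha, hfK' a ha, genExponent, dif_neg]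
    exact fun h => lt_irrefl _ h.1
  have hsum : ∀ (σ : Equiv.Perm (Fin i)), P σ ≠ 0 → t σ =
      ∑ β ∈ S.attach, genExponent n i hin w (σ (row β.1 β.2)) (f (row β.1 β.2)) := by
    intro σ hσ
    have hinj : ∀ β ∈ S.attach, ∀ γ ∈ S.attach, row β.1 β.2 = row γ.1 γ.2 → β = γ := by
      intro β _ γ _ h
      have h₁ := hfK β.1 β.2 _ (hrow β.1 β.2)
      rw [h, hfK γ.1 γ.2 _ (hrow γ.1 γ.2)] at h₁
      have h₂ := hrow β.1 β.2
      rw [h, ← hrow γ.1 γ.2] at h₂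
      exact Subtype.ext (Subtype.ext (Prod.ext h₁.symm h₂))
    rw [← Finset.sum_image (f := fun a => genExponent n i hin w (σ a) (f a)) hinj]
    refine (Finset.sum_subset (Finset.subset_univ _) fun a _ ha => hexp0 σ hσ a ?_).symm
    rintro ⟨β, hβ, hβa⟩
    refine ha (Finset.mem_image.2 ⟨⟨β, hβ⟩, Finset.mem_attach _ _, Fin.ext ?_⟩)
    simp only [row]
    rw [hβa, hW]
  have ht1 : t 1 = ∑ β ∈ S, Finsupp.single β 1 := by
    rw [hsum 1 hP1, ← Finset.sum_attach S]
    refine Finset.sum_congr rfl fun β _ => ?_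
    obtain ⟨γ, h₁, h₂, h₃⟩ := hlive 1 hP1 β.1 β.2
    rw [h₃]
    congr 1
    refine Subtype.ext (Prod.ext h₁ (h₂.trans ?_))
    exact (hrow β.1 β.2).symm
  have hdeg : ∀ σ, P σ ≠ 0 → ∑ β, t σ β = S.card := by
    intro σ hσ
    rw [hsum σ hσ]
    simp only [Finsupp.finsetSum_apply]
    rw [Finset.sum_comm, ← Finset.card_attach, Finset.card_eq_sum_ones]
    refine Finset.sum_congr rfl fun β _ => ?_
    obtain ⟨γ, -, -, h₃⟩ := hlive σ hσ β.1 β.2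
    rw [h₃]
    simp [Finsupp.single_apply]
  have hS1 : ∀ β, (∑ γ ∈ S, Finsupp.single γ 1 : PosRoot n →₀ ℕ) β = if β ∈ S then 1 else 0 := by
    intro β
    rw [Finsupp.finsetSum_apply]
    simp [Finsupp.single_apply]
  -- Pigeonhole: σ cannot map the places from the row of β on into the places strictly after it, so
  -- some `j'` at or after it goes to a place at or before it. The column exchanged at `j'` then
  -- yields a root γ at a cell strictly above that of β: its row index has not decreased, and
  -- neither has its column index, by the antichain property.
  have hmove : ∀ σ, P σ ≠ 0 → ∀ β (hβ : β ∈ S), σ (row β hβ) ≠ row β hβ →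
      ∃ γ, γ ∉ S ∧ t σ γ ≠ 0 ∧ r β γ := by
    intro σ hσ β hβ hne
    obtain ⟨j', hj', hσj'⟩ : ∃ j', row β hβ ≤ j' ∧ σ j' ≤ row β hβ := by
      by_contra! h
      have : (Finset.Ici (row β hβ)).card ≤ (Finset.Ioi (row β hβ)).card :=
        Finset.card_le_card_of_injOn σ
          (fun a ha => Finset.mem_coe.2 (Finset.mem_Ioi.2 (h a (Finset.mem_Ici.1 ha))))
          σ.injective.injOn
      rw [Fin.card_Ici, Fin.card_Ioi] at this
      omega
    have hK : K j' := by
      by_contra h'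
      have h₁ := hfix σ hσ j' h'
      rw [h₁] at hσj'
      rw [le_antisymm hσj' hj'] at h'
      exact h' ⟨β, hβ, hrow β hβ⟩
    obtain ⟨δ, hδ, hδj'⟩ := hK
    obtain rfl : j' = row δ hδ := Fin.ext (by simp only [row]; rw [hδj', hW])
    obtain ⟨γ, h₁, h₂, h₃⟩ := hlive σ hσ δ hδ
    have hγlive : γ ∈ liveRoots n i w := by
      refine ⟨?_, ?_⟩
      · rw [h₂, hW]
        exact (σ _).2
      · rw [h₁]
        exact (hS δ hδ).2
    have hlt : rootCell i w β < rootCell i w γ := by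
      have hβ₁ := (hS β hβ)
      have hδ₁ := (hS δ hδ)
      have e : (w.symm γ.1.2).val = (σ (row δ hδ)).val := by rw [h₂, hW]
      have hle₁ : (w.symm β.1.2).val ≤ (w.symm δ.1.2).val := hj'
      have hle₂ : (σ (row δ hδ)).val ≤ (w.symm β.1.2).val := hσj'
      obtain ⟨hβ₁, hβ₂⟩ := hβ₁
      obtain ⟨hδ₁, hδ₂⟩ := hδ₁
      by_cases hβδ : δ = β
      · subst hβδ
        have hne' : (σ (row δ hδ)).val ≠ (w.symm δ.1.2).val := fun h => hne (Fin.ext h)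
        rw [Prod.lt_iff]
        left
        simp only [rootCell, e, h₁]
        constructor
        · omega
        · exact le_rfl
      · have hnle : ¬ rootCell i w δ ≤ rootCell i w β := fun h => hβδ (hanti δ hδ β hβ h)
        rw [Prod.lt_iff]
        right
        simp only [rootCell, e, h₁, Prod.mk_le_mk] at hnle ⊢
        constructor <;> omega
    refine ⟨γ, fun hγ => ?_, ?_, rel_of_rootCell_lt hrw (hS β hβ) hγlive hlt⟩
    · rw [hanti β hβ γ hγ hlt.le] at hlt
      exact lt_irrefl _ hlt
    · intro h0
      simp only [t, Finsupp.finsetSum_apply, Finset.sum_eq_zero_iff] at h0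
      have := h0 (row δ hδ) (Finset.mem_univ _)
      rw [h₃, Finsupp.single_eq_same] at this
      exact one_ne_zero this
  have hlow : ∀ σ, P σ ≠ 0 → σ ≠ 1 →
      HomLexLT r (∑ β ∈ S, Finsupp.single β 1 : PosRoot n →₀ ℕ) (t σ) := by
    intro σ hσ hσ1
    have hne : ((∑ β ∈ S, Finsupp.single β 1 : PosRoot n →₀ ℕ) : PosRoot n → ℕ) ≠ t σ := by
      obtain ⟨a, ha⟩ : ∃ a, σ a ≠ a := by
        by_contra! h
        exact hσ1 (Equiv.ext h)
      obtain ⟨β, hβ, hβa⟩ : K a := by_contra fun h => ha (hfix σ hσ a h)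
      obtain rfl : a = row β hβ := Fin.ext (by simp only [row]; rw [hβa, hW])
      obtain ⟨γ, hγ, hγt, -⟩ := hmove σ hσ β hβ ha
      intro h
      rw [← congrFun h γ, hS1, if_neg hγ] at hγt
      exact hγt rfl
    refine Or.inr ⟨?_, ?_⟩
    · rw [hdeg σ hσ, ← ht1, hdeg 1 hP1]
    -- If the last difference were a root of `S` missing from `t σ`, its place would be moved and
    -- `hmove` would provide a still larger difference.
    · obtain ⟨β, hβ, hlast⟩ := exists_last_ne hr hne
      refine ⟨β, ?_, hlast⟩
      by_contra hle
      rw [hS1] at hβ hle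
      have hβS : β ∈ S := by
        by_contra h
        rw [if_neg h] at hβ hle
        omega
      rw [if_pos hβS] at hle hβ
      have ht0 : t σ β = 0 := by omega
      have hmv : σ (row β hβS) ≠ row β hβS := by
        intro h
        obtain ⟨γ, h₁, h₂, h₃⟩ := hlive σ hσ β hβS
        rw [h, ← hrow β hβS] at h₂
        obtain rfl : γ = β := Subtype.ext (Prod.ext h₁ h₂)
        simp only [t, Finsupp.finsetSum_apply, Finset.sum_eq_zero_iff] at ht0
        have := ht0 (row γ hβS) (Finset.mem_univ _)
        rw [h₃, Finsupp.single_eq_same] at this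
        exact one_ne_zero this
      obtain ⟨γ, hγ, hγt, hβγ⟩ := hmove σ hσ β hβS hmv
      have := hlast γ hβγ
      rw [hS1, if_neg hγ] at this
      exact hγt this.symm
  have hdet : genMinor ℂ n i hin w f = ∑ σ : Equiv.Perm (Fin i), ((Equiv.Perm.sign σ : ℤ) : MvPolynomial (PosRoot n) ℂ) * P σ := by
    rw [genMinor, Matrix.det_apply']
    rfl
  have hcoeff : ∀ (s : PosRoot n →₀ ℕ) (σ : Equiv.Perm (Fin i)),
      coeff s (((Equiv.Perm.sign σ : ℤ) : MvPolynomial (PosRoot n) ℂ) * P σ) ≠ 0 →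
        P σ ≠ 0 ∧ s = t σ := by
    intro s σ h
    have h0 : P σ ≠ 0 := by
      intro h'
      rw [h', mul_zero, coeff_zero] at h
      exact h rfl
    refine ⟨h0, ?_⟩
    rw [hP σ h0, ← map_intCast (C : ℂ →+* MvPolynomial (PosRoot n) ℂ), coeff_C_mul,
      coeff_monomial] at h
    by_contra hne
    rw [if_neg fun h => hne h.symm, mul_zero] at h
    exact h rfl
  refine ⟨f, ?_, ?_⟩
  · rw [hdet, coeff_sum, Finset.sum_eq_single 1]
    · rw [hP 1 hP1, ht1]
      simp
    · intro σ _ hσ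
      by_contra h
      obtain ⟨h₁, h₂⟩ := hcoeff _ σ h
      have := hlow σ h₁ hσ
      rw [h₂] at this
      exact this.irrefl _
    · simp
  · intro s hs
    rw [hdet, coeff_sum] at hs
    obtain ⟨σ, -, hσ⟩ := Finset.exists_ne_zero_of_sum_ne_zero hs
    obtain ⟨h₁, rfl⟩ := hcoeff s σ hσ
    by_cases h : σ = 1
    · left
      rw [h, ht1]
    · exact Or.inr (hlow σ h₁ h)

end AntichainMinor
end GTSchubert

namespace GTSchubert

/-! ### The toric degeneration is the toric variety of the chain polytope -/

section Reindex

variable {V G A A' I I' : Type*} [AddCommGroup V] [Module ℂ V] [Group G]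
  [Fintype I] [Fintype I']
  {X : Set (Projectivization ℂ V)} {ρ : G →* LinearMap.GeneralLinearGroup ℂ V}
  {ex : A → I → ℕ} {ex' : A' → I' → ℕ} {Ψ : V ≃ₗ[ℂ] (A → ℂ)}

theorem IsToricModel.reindex (hX : IsToricModel X ρ ex Ψ) (e : A' ≃ A)
    (h₁ : ∀ h : I → ℂˣ, ∃ h' : I' → ℂˣ, ∀ a, mon h (ex (e a)) = mon h' (ex' a))
    (h₂ : ∀ h' : I' → ℂˣ, ∃ h : I → ℂˣ, ∀ a, mon h' (ex' a) = mon h (ex (e a))) :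
    IsToricModel X ρ ex' (Ψ ≪≫ₗ LinearEquiv.funCongrLeft ℂ ℂ e) := by
  have hT : ∀ y a, (Ψ ≪≫ₗ LinearEquiv.funCongrLeft ℂ ℂ e) y a = Ψ y (e a) := fun _ _ => rfl
  refine ⟨fun z => ?_, fun g => ?_, fun h' => ?_⟩
  · rw [hX.mem_iff]
    constructor
    · intro hz d f hf hv
      refine hz d (fun y => f (LinearEquiv.funCongrLeft ℂ ℂ e y))
        (hf.comp_linear (LinearEquiv.funCongrLeft ℂ ℂ e).toLinearMap) fun h => ?_
      obtain ⟨h', hh'⟩ := h₁ h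
      rw [← hv h']
      congr 1
      funext a
      rw [← hh' a]
      rfl
    · intro hz d f hf hv
      have := hz d (fun y => f ((LinearEquiv.funCongrLeft ℂ ℂ e).symm y))
        (hf.comp_linear (LinearEquiv.funCongrLeft ℂ ℂ e).symm.toLinearMap) fun h' => ?_
      · change f ((LinearEquiv.funCongrLeft ℂ ℂ e).symm
          (LinearEquiv.funCongrLeft ℂ ℂ e (Ψ z.rep))) = 0 at this
        rwa [LinearEquiv.symm_apply_apply] at this
      · obtain ⟨h, hh⟩ := h₂ h'
        rw [← hv h]
        congr 1
        rw [LinearEquiv.symm_apply_eq]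
        funext a
        rw [hh a]
        rfl
  · obtain ⟨h, c, hc⟩ := hX.torus_to g
    obtain ⟨h', hh'⟩ := h₁ h
    exact ⟨h', c, fun y a => by rw [hT, hT, hc, hh']⟩
  · obtain ⟨h, hh⟩ := h₂ h'
    obtain ⟨g, c, hc⟩ := hX.torus_from h
    exact ⟨g, c, fun y a => by rw [hT, hT, hc, hh]⟩

end Reindex

section Model

variable {n i m : ℕ} {w : Equiv.Perm (Fin (n + 1))}

/-- The root of a cell of the diagram. -/
def cellRoot (c : diagram n i w) : PosRoot n := (exists_rootCell_eq c.2).choose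

theorem cellRoot_mem (c : diagram n i w) : cellRoot c ∈ liveRoots n i w :=
  (exists_rootCell_eq c.2).choose_spec.1

theorem rootCell_cellRoot (c : diagram n i w) : rootCell i w (cellRoot c) = c :=
  (exists_rootCell_eq c.2).choose_spec.2

theorem cellRoot_injective : Function.Injective (cellRoot : diagram n i w → PosRoot n) :=
  fun c d h => Subtype.ext (by rw [← rootCell_cellRoot c, h, rootCell_cellRoot])

theorem cellRoot_rootCell {β : PosRoot n} (hβ : β ∈ liveRoots n i w) :
    cellRoot (⟨rootCell i w β, rootCell_mem hβ⟩ : diagram n i w) = β :=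
  rootCell_injOn (cellRoot_mem _) hβ (rootCell_cellRoot _)

theorem mem_liveExps_iff {p : PosRoot n → ℕ} : p ∈ liveExps n i m w ↔
    (∀ β ∉ liveRoots n i w, p β = 0) ∧ ChainBound (diagram n i w) m fun c => p (cellRoot c) := by
  classical
  refine and_congr_right fun hp => ⟨fun h Γ hΓ => ?_, fun h Γ hΓ hchain => ?_⟩
  · rw [← Finset.sum_image (f := p) fun c _ d _ h => cellRoot_injective h]
    refine h _ ?_ ?_
    · intro β hβ
      obtain ⟨c, -, rfl⟩ := Finset.mem_image.1 (Finset.mem_coe.1 hβ)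
      exact cellRoot_mem c
    · intro β hβ γ hγ hne
      obtain ⟨c, hc, rfl⟩ := Finset.mem_image.1 (Finset.mem_coe.1 hβ)
      obtain ⟨d, hd, rfl⟩ := Finset.mem_image.1 (Finset.mem_coe.1 hγ)
      simp only [rootCell_cellRoot]
      exact hΓ hc hd fun h => hne (by rw [h])
  · have := h (Finset.univ.filter fun c => cellRoot c ∈ Γ) (fun c hc d hd hne => by
      have := hchain (Finset.mem_filter.1 hc).2 (Finset.mem_filter.1 hd).2
        fun h => hne (cellRoot_injective h)
      simp only [rootCell_cellRoot] at this
      exact this)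
    rw [← Finset.sum_image (f := p) fun c _ d _ h => cellRoot_injective h] at this
    convert this using 2
    ext β
    simp only [Finset.mem_image, Finset.mem_filter, Finset.mem_univ, true_and]
    constructor
    · intro hβ
      have e := cellRoot_rootCell (hΓ hβ)
      exact ⟨_, by rwa [e], e⟩
    · rintro ⟨c, hc, rfl⟩
      exact hc

/-- The exponent is a sum of `m` antichains, each with its own minor, and lowest monomials multiply.
-/
theorem exists_hasLowest (hin : i ≤ n) {r : PosRoot n → PosRoot n → Prop}
    (hr : IsStrictTotalOrder _ r) (hrw : ExtendsHeightOrder w r) {p : PosRoot n → ℕ}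
    (hp : p ∈ liveExps n i m w) : ∃ F : Fin m → Fin i → Fin (n + 1),
      HasLowest r (∏ j, genMinor ℂ n i hin w (F j)) (Finsupp.equivFunOnFinite.symm p) := by
  classical
  obtain ⟨hp₀, hp₁⟩ := mem_liveExps_iff.1 hp
  obtain ⟨g, hg, hgp⟩ := hp₁.exists_antichains
  have key : ∀ j, ∃ f, HasLowest r (genMinor ℂ n i hin w f)
      (∑ β ∈ (g j).image cellRoot, Finsupp.single β 1) := by
    intro j
    refine hasLowest_genMinor hin hr hrw _ ?_ ?_
    · intro β hβ
      obtain ⟨c, -, rfl⟩ := Finset.mem_image.1 hβ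
      exact cellRoot_mem c
    · intro β hβ γ hγ hle
      obtain ⟨c, hc, rfl⟩ := Finset.mem_image.1 hβ
      obtain ⟨d, hd, rfl⟩ := Finset.mem_image.1 hγ
      rw [rootCell_cellRoot, rootCell_cellRoot] at hle
      rw [(hg j).eq hc hd hle]
  choose F hF using key
  refine ⟨F, ?_⟩
  convert HasLowest.prod hr Finset.univ hF
  ext β
  simp only [Finsupp.finsetSum_apply, Finsupp.equivFunOnFinite_symm_apply_apply, Finsupp.single_apply,
    Finset.sum_ite_eq', Finset.mem_image]
  by_cases hβ : β ∈ liveRoots n i w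
  · have e := cellRoot_rootCell hβ
    rw [← e]
    refine (hgp _).trans (Finset.sum_congr rfl fun j _ => ?_)
    congr 1
    refine propext ⟨fun h => ⟨_, h, rfl⟩, fun ⟨c, hc, h⟩ => cellRoot_injective h ▸ hc⟩
  · rw [hp₀ β hβ]
    refine (Finset.sum_eq_zero fun j _ => if_neg ?_).symm
    rintro ⟨c, -, rfl⟩
    exact hβ (cellRoot_mem c)

/-- The exponents of the chain polytope of the diagram are those of the nonzero components of the
graded Demazure module. -/
def chainPtEquiv (n i m : ℕ) (w : Equiv.Perm (Fin (n + 1))) :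
    ChainPt (diagram n i w) m ≃ (finite_liveExps n i m w).toFinset where
  toFun q := ⟨Function.extend cellRoot q.1 0, by
    rw [Set.Finite.mem_toFinset, mem_liveExps_iff]
    refine ⟨fun β hβ => Function.extend_apply' _ _ _ ?_, ?_⟩
    · rintro ⟨c, rfl⟩
      exact hβ (cellRoot_mem c)
    · simpa only [cellRoot_injective.extend_apply] using q.2⟩
  invFun p := ⟨fun c => p.1 (cellRoot c), (mem_liveExps_iff.1 ((Set.Finite.mem_toFinset _).1 p.2)).2⟩
  left_inv q := Subtype.ext (funext fun c => cellRoot_injective.extend_apply _ _ _)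
  right_inv p := by
    refine Subtype.ext (funext fun β => ?_)
    by_cases hβ : β ∈ liveRoots n i w
    · have e := cellRoot_rootCell hβ
      rw [← e]
      exact cellRoot_injective.extend_apply _ _ _
    · rw [(mem_liveExps_iff.1 ((Set.Finite.mem_toFinset _).1 p.2)).1 β hβ]
      refine Function.extend_apply' _ _ _ ?_
      rintro ⟨c, rfl⟩
      exact hβ (cellRoot_mem c)

theorem mon_chainPtEquiv (h : PosRoot n → ℂˣ) (q : ChainPt (diagram n i w) m) :
    mon h (chainPtEquiv n i m w q).1 = mon (fun c => h (cellRoot c)) q.1 := by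
  classical
  have e : ∀ c, (chainPtEquiv n i m w q).1 (cellRoot c) = q.1 c := fun c =>
    cellRoot_injective.extend_apply _ _ _
  have h₁ : ∀ β ∉ Finset.univ.image (cellRoot : diagram n i w → PosRoot n),
      (chainPtEquiv n i m w q).1 β = 0 := by
    intro β hβ
    refine Function.extend_apply' _ _ _ ?_
    rintro ⟨c, rfl⟩
    exact hβ (Finset.mem_image_of_mem _ (Finset.mem_univ c))
  rw [mon, mon, ← Finset.prod_subset (Finset.subset_univ _)
    fun β _ hβ => by rw [h₁ β hβ, pow_zero], Finset.prod_image fun c _ d _ h => cellRoot_injective h]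
  exact Finset.prod_congr rfl fun c _ => by rw [e]

theorem demazureOp_word_coe (hin : i ≤ n) (L : List (PosRoot n)) :
    (((L.map (demazureOp n i m hin w)).prod (demazureVec n i m hin w) :
      demazureModule n i m hin w) : MatPoly n i) =
      (L.map fun β => polarization n i β.1.1 β.1.2).prod (extremalVec n i m hin w) := by
  induction L with
  | nil => rfl
  | cons β L ih =>
    simp only [List.map_cons, List.prod_cons, Module.End.mul_apply, ← ih]
    rfl

theorem demazureOp_commutator (hin : i ≤ n) (β γ : PosRoot n) :
    demazureOp n i m hin w β * demazureOp n i m hin w γ -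
      demazureOp n i m hin w γ * demazureOp n i m hin w β ∈
      Submodule.span ℂ (Set.range (demazureOp n i m hin w)) := by
  have h : ∀ y : demazureModule n i m hin w,
      (((demazureOp n i m hin w β * demazureOp n i m hin w γ -
        demazureOp n i m hin w γ * demazureOp n i m hin w β) y : demazureModule n i m hin w) :
          MatPoly n i) =
      ((if γ.1.1 = β.1.2 then polarization n i β.1.1 γ.1.2 else 0) -
        if β.1.1 = γ.1.2 then polarization n i γ.1.1 β.1.2 else 0) y := by
    intro y
    rw [← polarization_commutator]
    rfl
  by_cases h₁ : γ.1.1 = β.1.2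
  · have h₂ : β.1.1 ≠ γ.1.2 := fun h₂ => by
      have h₃ := β.2
      have h₄ := γ.2
      rw [h₁] at h₄
      rw [h₂] at h₃
      exact lt_asymm h₃ h₄
    refine Submodule.subset_span ⟨⟨(β.1.1, γ.1.2), β.2.trans (h₁ ▸ γ.2)⟩, ?_⟩
    refine LinearMap.ext fun y => Subtype.ext ?_
    rw [h, if_pos h₁, if_neg h₂, sub_zero]
    rfl
  · by_cases h₂ : β.1.1 = γ.1.2
    · have h₃ : γ.1.1 < β.1.2 := γ.2.trans (h₂ ▸ β.2)
      have : demazureOp n i m hin w β * demazureOp n i m hin w γ -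
          demazureOp n i m hin w γ * demazureOp n i m hin w β =
            (-1 : ℂ) • demazureOp n i m hin w ⟨(γ.1.1, β.1.2), h₃⟩ := by
        refine LinearMap.ext fun y => Subtype.ext ?_
        rw [h, if_neg h₁, if_pos h₂, zero_sub, LinearMap.neg_apply, ← neg_one_smul ℂ]
        rfl
      rw [this]
      exact Submodule.smul_mem _ _ (Submodule.subset_span ⟨_, rfl⟩)
    · have : demazureOp n i m hin w β * demazureOp n i m hin w γ -
          demazureOp n i m hin w γ * demazureOp n i m hin w β = 0 := by
        refine LinearMap.ext fun y => Subtype.ext ?_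
        rw [h, if_neg h₁, if_neg h₂, sub_zero]
        rfl
      rw [this]
      exact Submodule.zero_mem _

/-- The vector `x^p v` of the Demazure module. -/
def demazureWord (n i m : ℕ) (hin : i ≤ n) (w : Equiv.Perm (Fin (n + 1))) (p : PosRoot n → ℕ) :
    demazureModule n i m hin w :=
  ((exists_wordDeg_eq p).choose.map (demazureOp n i m hin w)).prod (demazureVec n i m hin w)

theorem mem_of_wordDeg {R : Type*} [DecidableEq R] {N : Set R} {L : List R}
    (h : ∀ β ∉ N, wordDeg L β = 0) {β : R} (hβ : β ∈ L) : β ∈ N :=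
  by_contra fun h' => wordDeg_eq_zero_iff.1 (h β h') hβ

theorem exists_demazureWord_eq_smul (hin : i ≤ n) {p : PosRoot n → ℕ}
    (hp : ∀ β ∉ liveRoots n i w, p β = 0) :
    ∃ k : ℂ, k ≠ 0 ∧ (demazureWord n i m hin w p : MatPoly n i) = k • expCoeff n i m hin w p := by
  have h := (exists_wordDeg_eq p).choose_spec
  obtain ⟨k, hk, e⟩ := exists_expCoeff_eq_smul_word (m := m) (w := w) hin (exists_wordDeg_eq p).choose
    (fun β hβ => mem_of_wordDeg (by rw [h]; exact hp) hβ)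
  refine ⟨k, hk, ?_⟩
  rw [demazureWord, demazureOp_word_coe, e, h]

/-- The nonzero components of the graded Demazure module are those of the chain polytope. -/
theorem demazure_grClass_ne_zero_iff (hin : i ≤ n) (hw : IsMinRep n i w)
    {r : PosRoot n → PosRoot n → Prop} (hr : IsStrictTotalOrder _ r)
    (hrw : ExtendsHeightOrder w r) (p : PosRoot n → ℕ) :
    grClass r (demazureOp n i m hin w) (demazureVec n i m hin w) p ≠ 0 ↔
      p ∈ (finite_liveExps n i m w).toFinset := by
  have hA : ∀ p ∈ (finite_liveExps n i m w).toFinset, ∀ β ∉ liveRoots n i w, p β = 0 :=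
    fun p hp => (mem_liveExps_iff.1 ((Set.Finite.mem_toFinset _).1 hp)).1
  refine grClass_ne_zero_iff hr (demazureOp_commutator hin) (N := liveRoots n i w) ?_
    (demazureWord n i m hin w) ?_ hA ?_ ?_ p
  · intro β hβ
    exact Subtype.ext (polarization_extremalVec_eq_zero m hin w β hβ)
  · intro L hL
    obtain ⟨k, hk, e⟩ := exists_expCoeff_eq_smul_word (m := m) (w := w) hin L hL
    obtain ⟨k', hk', e'⟩ := exists_demazureWord_eq_smul (m := m) (w := w) hin (p := wordDeg L)
      fun β hβ => wordDeg_eq_zero_iff.2 fun h => hβ (hL β h)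
    refine ⟨k * k'⁻¹, mul_ne_zero hk (inv_ne_zero hk'), Subtype.ext ?_⟩
    rw [demazureOp_word_coe, e, Submodule.coe_smul, e', smul_smul, mul_assoc, inv_mul_cancel₀ hk',
      mul_one]
  · intro p hp hpA
    have h := expCoeff_mem_smallerSpan (m := m) hin hw hr hrw hp
      fun h => hpA ((Set.Finite.mem_toFinset _).2 h)
    have hle : smallerSpan n i m hin w r p ≤ (Submodule.span ℂ
        {y | ∃ q : PosRoot n → ℕ, (∀ β ∉ liveRoots n i w, q β = 0) ∧ HomLexLT r q p ∧
          y = demazureWord n i m hin w q}).map (demazureModule n i m hin w).subtype := by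
      refine Submodule.span_le.2 ?_
      rintro _ ⟨q, hqN, hq, rfl⟩
      obtain ⟨k, hk, e⟩ := exists_demazureWord_eq_smul (m := m) (w := w) hin hqN
      refine ⟨k⁻¹ • demazureWord n i m hin w q,
        Submodule.smul_mem _ _ (Submodule.subset_span ⟨q, hqN, hq, rfl⟩), ?_⟩
      rw [map_smul, Submodule.subtype_apply, e, smul_smul, inv_mul_cancel₀ hk, one_smul]
    obtain ⟨k, hk, e⟩ := exists_demazureWord_eq_smul (m := m) (w := w) hin hp
    obtain ⟨y, hy, hy'⟩ := hle h
    have : demazureWord n i m hin w p = k • y := Subtype.ext (by rw [e, ← hy']; rfl)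
    rw [this]
    exact Submodule.smul_mem _ _ hy
  · have hli := linearIndependent_expCoeff (w := w) m hin hr
      (fun a : (finite_liveExps n i m w).toFinset => a.1) Subtype.val_injective
      fun a => exists_hasLowest hin hr hrw ((Set.Finite.mem_toFinset _).1 a.2)
    choose k hk e using fun a : (finite_liveExps n i m w).toFinset =>
      exists_demazureWord_eq_smul (m := m) (w := w) hin (hA a.1 a.2)
    refine LinearIndependent.of_comp (demazureModule n i m hin w).subtype ?_
    convert hli.units_smul (fun a => Units.mk0 (k a) (hk a)) using 1
    funext a
    exact e a

theorem exists_isToricModel_toricSchubert (hin : i ≤ n) (hw : IsMinRep n i w)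
    {r : PosRoot n → PosRoot n → Prop} (hr : IsStrictTotalOrder _ r)
    (hrw : ExtendsHeightOrder w r) :
    ∃ Ψ, IsToricModel (toricSchubert n i m hin w r) (toricSchubertTorus n i m hin w r)
      (fun q : ChainPt (diagram n i w) m => q.1) Ψ := by
  have h0 : (finite_liveExps n i m w).toFinset.Nonempty :=
    ⟨0, (Set.Finite.mem_toFinset _).2 ⟨fun _ _ => rfl, fun _ _ _ => by simp⟩⟩
  have hX := isToricModel_grVariety (demazureOp_commutator hin)
    (demazure_grClass_ne_zero_iff (m := m) hin hw hr hrw) h0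
  refine ⟨_, hX.reindex (chainPtEquiv n i m w) (fun h => ⟨_, mon_chainPtEquiv h⟩) fun h' => ?_⟩
  classical
  refine ⟨Function.extend cellRoot h' 1, fun q => ?_⟩
  rw [mon_chainPtEquiv]
  simp only [cellRoot_injective.extend_apply]

end Model
end GTSchubert

namespace GTSchubert

/-! ### Kogan faces of type `w w₀⁻¹` -/

section Kogan

variable {n i m : ℕ} {w : Equiv.Perm (Fin (n + 1))}

/-- The entry `x_{k,j}` of a pattern, as a function on pairs of natural numbers. -/
def entry (s : GTIndex n → ℝ) (k j : ℕ) : ℝ :=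
  if h : 1 ≤ j ∧ k + j ≤ n + 1 then s ⟨(⟨k, by omega⟩, ⟨j, by omega⟩), h⟩ else 0

theorem entry_eq (s : GTIndex n → ℝ) (p : GTIndex n) : entry s p.row p.col = s p :=
  dif_pos p.2

theorem entry_of_le (s : GTIndex n → ℝ) {k j : ℕ} (h : 1 ≤ j ∧ k + j ≤ n + 1) :
    entry s k j = s ⟨(⟨k, by omega⟩, ⟨j, by omega⟩), h⟩ := dif_pos h

variable {s : GTIndex n → ℝ}

theorem entry_top (hi : 1 ≤ i) (hin : i ≤ n)
    (hs : s ∈ gtPolytope n fun l => if l = n + 1 - i then m else 0) {j : ℕ}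
    (hj : 1 ≤ j) (hj' : j ≤ n + 1) : entry s 0 j = if j ≤ n + 1 - i then (m : ℝ) else 0 := by
  rw [entry_of_le s ⟨hj, by omega⟩, hs.1 _ rfl]
  simp only [GTIndex.col, Nat.cast_ite, Nat.cast_zero, Finset.sum_ite_eq', Finset.mem_Icc]
  exact if_congr ⟨fun h => h.1, fun h => ⟨h, by omega⟩⟩ rfl rfl

theorem entry_succ_le {lam : ℕ → ℕ} (hs : s ∈ gtPolytope n lam) {k j : ℕ} (hj : 1 ≤ j)
    (h : k + 1 + j ≤ n + 1) : entry s (k + 1) j ≤ entry s k j := by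
  rw [entry_of_le s ⟨hj, h⟩, entry_of_le s ⟨hj, by omega⟩]
  exact hs.2.1 _ _ rfl rfl

theorem entry_succ_right_le {lam : ℕ → ℕ} (hs : s ∈ gtPolytope n lam) {k j : ℕ} (hj : 1 ≤ j)
    (h : k + 1 + j ≤ n + 1) : entry s k (j + 1) ≤ entry s (k + 1) j := by
  rw [entry_of_le s ⟨hj, h⟩, entry_of_le s ⟨by omega, by omega⟩]
  exact hs.2.2 _ _ rfl rfl

theorem entry_antitone {lam : ℕ → ℕ} (hs : s ∈ gtPolytope n lam) {k j j' : ℕ} (hj : 1 ≤ j)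
    (hjj' : j ≤ j') (h : k + j' ≤ n + 1) : entry s k j' ≤ entry s k j := by
  induction j', hjj' using Nat.le_induction with
  | base => exact le_rfl
  | succ j' hj' ih =>
    exact (entry_succ_right_le hs (by omega) (by omega)).trans
      ((entry_succ_le hs (by omega) (by omega)).trans (ih (by omega)))

theorem entry_le (hi : 1 ≤ i) (hin : i ≤ n)
    (hs : s ∈ gtPolytope n fun l => if l = n + 1 - i then m else 0) {k j : ℕ} (hj : 1 ≤ j)
    (h : k + j ≤ n + 1) : entry s k j ≤ m := by
  induction k with
  | zero =>
    rw [entry_top hi hin hs hj (by omega)]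
    split_ifs <;> simp
  | succ k ih => exact (entry_succ_le hs hj h).trans (ih (by omega))

theorem entry_nonneg (hi : 1 ≤ i) (hin : i ≤ n)
    (hs : s ∈ gtPolytope n fun l => if l = n + 1 - i then m else 0) {k j : ℕ} (hj : 1 ≤ j)
    (h : k + j ≤ n + 1) : 0 ≤ entry s k j := by
  induction k generalizing j with
  | zero =>
    rw [entry_top hi hin hs hj (by omega)]
    split_ifs <;> simp
  | succ k ih => exact (ih (by omega) (by omega)).trans (entry_succ_right_le hs hj h)

theorem entry_eq_zero (hi : 1 ≤ i) (hin : i ≤ n)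
    (hs : s ∈ gtPolytope n fun l => if l = n + 1 - i then m else 0) {k j : ℕ} (hj : n + 1 - i < j)
    (h : k + j ≤ n + 1) : entry s k j = 0 := by
  refine le_antisymm ?_ (entry_nonneg hi hin hs (by omega) h)
  induction k with
  | zero => rw [entry_top hi hin hs (by omega) (by omega), if_neg (by omega)]
  | succ k ih => exact (entry_succ_le hs (by omega) h).trans (ih (by omega))

theorem entry_eq_of_mem {lam : ℕ → ℕ} {D : Finset (ℕ × ℕ)} (hs : s ∈ koganFace n lam D) {k j : ℕ}
    (hj : 1 ≤ j) (h : k + 1 + j ≤ n + 1) (hD : (k, j) ∈ D) : entry s k j = entry s (k + 1) j := by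
  rw [entry_of_le s ⟨hj, h⟩, entry_of_le s ⟨hj, by omega⟩]
  exact hs.2 _ _ rfl rfl hD

theorem wv_simpleRefl_mul (p : Equiv.Perm (Fin (n + 1))) {y : ℕ} (hy : 1 ≤ y ∧ y ≤ n) {x : ℕ}
    (hx : x < n + 1) : wv (simpleRefl n y * p) x =
      if wv p x = y - 1 then y else if wv p x = y then y - 1 else wv p x := by
  rw [wv_of_lt _ hx, wv_of_lt _ hx, Equiv.Perm.mul_apply, simpleRefl, dif_pos hy,
    Equiv.swap_apply_def]
  simp only [Fin.ext_iff]
  split_ifs <;> rfl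

/-- The number of the first `d` entries of a permutation that are at least `z`. -/
def upperCount (d : ℕ) (p : Equiv.Perm (Fin (n + 1))) (z : ℕ) : ℕ :=
  ((Finset.range d).filter fun y => z ≤ wv p y).card

theorem upperCount_le {d : ℕ} (hd : d ≤ n + 1) (p : Equiv.Perm (Fin (n + 1))) (z : ℕ) :
    upperCount d p z ≤ n + 1 - z := by
  rw [upperCount, ← Nat.card_Ico]
  refine Finset.card_le_card_of_injOn (wv p) (fun y hy => ?_) fun y hy y' hy' h => ?_
  · exact Finset.mem_coe.2 (Finset.mem_Ico.2 ⟨(Finset.mem_filter.1 hy).2, wv_lt p y⟩)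
  · have h₁ := Finset.mem_range.1 (Finset.mem_filter.1 hy).1
    have h₂ := Finset.mem_range.1 (Finset.mem_filter.1 hy').1
    exact wv_inj p (by omega) (by omega) h

theorem upperCount_eq_add {d : ℕ} (hd : d ≤ n + 1) (p : Equiv.Perm (Fin (n + 1))) (z : ℕ) :
    upperCount d p z = upperCount d p (z + 1) + ((Finset.range d).filter fun y => wv p y = z).card ∧
      ((Finset.range d).filter fun y => wv p y = z).card ≤ 1 := by
  constructor
  · rw [upperCount, upperCount, ← Finset.card_union_of_disjoint]
    · congr 1
      ext y
      simp only [Finset.mem_filter, Finset.mem_union, Finset.mem_range]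
      omega
    · refine Finset.disjoint_filter.2 fun y _ h => ?_
      omega
  · refine Finset.card_le_one.2 fun y hy y' hy' => ?_
    have h₁ := Finset.mem_filter.1 hy
    have h₂ := Finset.mem_filter.1 hy'
    rw [Finset.mem_range] at h₁ h₂
    exact wv_inj p (by omega) (by omega) (h₁.2.trans h₂.2.symm)

/-- Left multiplication exchanges the values `y - 1` and `y`, which only the threshold `y` tells
apart. The numbers `a` and `b` record whether these values occur among the first `d` entries. -/
theorem upperCount_simpleRefl_mul {d : ℕ} (hd : d ≤ n + 1) (p : Equiv.Perm (Fin (n + 1))) {y : ℕ}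
    (hy : 1 ≤ y ∧ y ≤ n) : (∀ z, z ≠ y → upperCount d (simpleRefl n y * p) z = upperCount d p z) ∧
      ∃ a b : ℕ, a ≤ 1 ∧ b ≤ 1 ∧ upperCount d (simpleRefl n y * p) y = upperCount d p (y + 1) + a ∧
        upperCount d p y = upperCount d p (y + 1) + b ∧
        upperCount d p (y - 1) = upperCount d p y + a := by
  have key : ∀ z, z ≠ y → upperCount d (simpleRefl n y * p) z = upperCount d p z := by
    intro z hz
    refine congrArg Finset.card (Finset.filter_congr fun x hx => ?_)
    rw [wv_simpleRefl_mul p hy (by rw [Finset.mem_range] at hx; omega)]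
    split_ifs <;> omega
  refine ⟨key, _, _, (upperCount_eq_add hd p (y - 1)).2, (upperCount_eq_add hd p y).2, ?_,
    (upperCount_eq_add hd p y).1, ?_⟩
  · rw [(upperCount_eq_add hd _ y).1, key (y + 1) (by omega)]
    congr 2
    refine Finset.filter_congr fun x hx => ?_
    rw [wv_simpleRefl_mul p hy (by rw [Finset.mem_range] at hx; omega)]
    split_ifs <;> omega
  · have := (upperCount_eq_add hd p (y - 1)).1
    rwa [Nat.sub_add_cancel hy.1] at this

/-- The rows above `y` have been treated down to row `k + 1`, the others down to row `k`. -/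
def Forced (m d : ℕ) (s : GTIndex n → ℝ) (k y : ℕ) (p : Equiv.Perm (Fin (n + 1))) : Prop :=
  ∀ z ≤ n, 1 ≤ upperCount d p z →
    (y ≤ z → entry s (min (k + 1) z) (upperCount d p z + (z - (k + 1))) = m) ∧
    (z < y → entry s (min k z) (upperCount d p z + (z - k)) = m)

/-- Interlacing alone carries the forced value `m` from row `k` to row `k + 1` as long as the count
at `y` does not grow. If the reflection raises it, the required entry is already forced by the
threshold `y + 1`; or, if the count there is 0, by the threshold `y - 1` together with the equation
x_{k,y-k} = x_{k+1,y-k}. -/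
theorem Forced.step (hi : 1 ≤ i) (hin : i ≤ n) {D : Finset (ℕ × ℕ)}
    (hs : s ∈ koganFace n (fun l => if l = n + 1 - i then m else 0) D) {k y : ℕ} (hky : k + 1 ≤ y)
    (hyn : y ≤ n) {p : Equiv.Perm (Fin (n + 1))} (h : Forced m (n + 1 - i) s k (y + 1) p) :
    Forced m (n + 1 - i) s k y ((if (k, y - k) ∈ D then simpleRefl n y else 1) * p) := by
  set d := n + 1 - i with hd
  have hdn : d ≤ n + 1 := by omega
  have htop : ∀ {k j j'}, 1 ≤ j → j ≤ j' → k + j' ≤ n + 1 → entry s k j' = m → entry s k j = m :=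
    fun h₁ h₂ h₃ h₄ => le_antisymm (entry_le hi hin hs.1 h₁ (by omega))
      (h₄ ▸ entry_antitone hs.1 h₁ h₂ h₃)
  have hdown : ∀ {k j}, 1 ≤ j → k + 1 + j ≤ n + 1 → entry s k (j + 1) = m →
      entry s (k + 1) j = m :=
    fun h₁ h₂ h₃ => le_antisymm (entry_le hi hin hs.1 h₁ h₂) (h₃ ▸ entry_succ_right_le hs.1 h₁ h₂)
  have hold : ∀ c, 1 ≤ c → c ≤ upperCount d p y → entry s (k + 1) (c + (y - (k + 1))) = m := by
    intro c hc hc'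
    have h₁ := (h y hyn (by omega)).2 (by omega)
    have h₂ := upperCount_le hdn p y
    rw [min_eq_left (by omega)] at h₁
    refine hdown (by omega) (by omega) (htop (by omega) ?_ ?_ h₁) <;> omega
  by_cases hD : (k, y - k) ∈ D
  · rw [if_pos hD]
    obtain ⟨hne, a, b, ha, hb, e₁, e₂, e₃⟩ := upperCount_simpleRefl_mul hdn p (y := y) ⟨by omega, hyn⟩
    intro z hz hcz
    by_cases hzy : z = y
    · subst hzy
      refine ⟨fun _ => ?_, fun h => absurd h (lt_irrefl _)⟩
      rw [min_eq_left hky]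
      by_cases hle : upperCount d (simpleRefl n z * p) z ≤ upperCount d p z
      · exact hold _ hcz hle
      · have hc : upperCount d (simpleRefl n z * p) z = upperCount d p (z + 1) + 1 := by omega
        rw [hc]
        by_cases hc0 : upperCount d p (z + 1) = 0
        · have h₁ := (h (z - 1) (by omega) (by omega)).2 (by omega)
          have h₂ : upperCount d p (z - 1) = 1 := by omega
          rw [min_eq_left (by omega), h₂, show 1 + (z - 1 - k) = z - k by omega] at h₁
          rw [hc0, show 0 + 1 + (z - (k + 1)) = z - k by omega,
            ← entry_eq_of_mem hs (by omega) (by omega) hD, h₁]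
        · have hzn : z + 1 ≤ n := by
            have := upperCount_le hdn p (z + 1)
            omega
          have h₁ := (h (z + 1) hzn (by omega)).1 le_rfl
          rw [min_eq_left (by omega)] at h₁
          rw [← h₁]
          congr 1
          omega
    · rw [hne z hzy] at hcz ⊢
      exact ⟨fun h' => (h z hz hcz).1 (by omega), fun h' => (h z hz hcz).2 (by omega)⟩
  · rw [if_neg hD, one_mul]
    intro z hz hcz
    by_cases hzy : z = y
    · subst hzy
      refine ⟨fun _ => ?_, fun h => absurd h (lt_irrefl _)⟩
      rw [min_eq_left hky]
      exact hold _ hcz le_rfl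
    · exact ⟨fun h' => (h z hz hcz).1 (by omega), fun h' => (h z hz hcz).2 (by omega)⟩

/-- The product of the simple reflections in row `k` of `D`, restricted to the first `N` places. -/
def rowProd (n : ℕ) (D : Finset (ℕ × ℕ)) (k N : ℕ) : Equiv.Perm (Fin (n + 1)) :=
  ((List.range N).map fun j => if (k, j + 1) ∈ D then simpleRefl n (k + (j + 1)) else 1).prod

theorem rowProd_succ (D : Finset (ℕ × ℕ)) (k N : ℕ) : rowProd n D k (N + 1) =
    rowProd n D k N * if (k, N + 1) ∈ D then simpleRefl n (k + (N + 1)) else 1 := by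
  simp [rowProd, List.range_succ]

/-- The product of the first `k` rows. -/
def rowsProd (n : ℕ) (D : Finset (ℕ × ℕ)) (k : ℕ) : Equiv.Perm (Fin (n + 1)) :=
  ((List.range k).reverse.map fun k => rowProd n D k (n - k)).prod

theorem rowsProd_succ (D : Finset (ℕ × ℕ)) (k : ℕ) :
    rowsProd n D (k + 1) = rowProd n D k (n - k) * rowsProd n D k := by
  simp [rowsProd, List.range_succ]

theorem koganType_eq (D : Finset (ℕ × ℕ)) : koganType n D = rowsProd n D n := rfl

theorem Forced.rowProd (hi : 1 ≤ i) (hin : i ≤ n) {D : Finset (ℕ × ℕ)}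
    (hs : s ∈ koganFace n (fun l => if l = n + 1 - i then m else 0) D) {k N : ℕ}
    (hN : k + N ≤ n) {p : Equiv.Perm (Fin (n + 1))}
    (h : Forced m (n + 1 - i) s k (k + N + 1) p) :
    Forced m (n + 1 - i) s k (k + 1) (rowProd n D k N * p) := by
  induction N generalizing p with
  | zero => simpa [GTSchubert.rowProd] using h
  | succ N ih =>
    rw [rowProd_succ, mul_assoc]
    refine ih (by omega) ?_
    have := Forced.step hi hin hs (y := k + N + 1) (by omega) (by omega) h
    rwa [show k + N + 1 - k = N + 1 by omega] at this

/-- For the identity the count at `z` is `n + 1 - i - z`, and all thresholds point to the last entry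
`m` of the top row. -/
theorem forced_rowsProd (hi : 1 ≤ i) (hin : i ≤ n) {D : Finset (ℕ × ℕ)}
    (hs : s ∈ koganFace n (fun l => if l = n + 1 - i then m else 0) D) {k : ℕ} (hk : k ≤ n) :
    Forced m (n + 1 - i) s k (n + 1) (rowsProd n D k) := by
  induction k with
  | zero =>
    have hc : ∀ z, upperCount (n + 1 - i) (1 : Equiv.Perm (Fin (n + 1))) z = n + 1 - i - z := by
      intro z
      refine Eq.trans (congrArg Finset.card ?_) (Nat.card_Ico z (n + 1 - i))
      ext y
      simp only [Finset.mem_filter, Finset.mem_range, Finset.mem_Ico]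
      constructor
      · rintro ⟨h₁, h₂⟩
        rw [wv_of_lt _ (by omega)] at h₂
        exact ⟨h₂, h₁⟩
      · rintro ⟨h₁, h₂⟩
        refine ⟨h₂, ?_⟩
        rw [wv_of_lt _ (by omega)]
        exact h₁
    intro z hz hcz
    change 1 ≤ upperCount (n + 1 - i) 1 z at hcz
    change _ ∧ (_ → entry s (min 0 z) (upperCount (n + 1 - i) 1 z + (z - 0)) = m)
    rw [hc] at hcz ⊢
    refine ⟨fun h => by omega, fun _ => ?_⟩
    rw [Nat.zero_min, entry_top hi hin hs.1 (by omega) (by omega), if_pos (by omega)]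
  | succ k ih =>
    have h := Forced.rowProd hi hin hs (k := k) (N := n - k) (by omega)
      (by rw [show k + (n - k) + 1 = n + 1 by omega]; exact ih (by omega))
    rw [rowsProd_succ]
    intro z hz hcz
    refine ⟨fun h => by omega, fun _ => ?_⟩
    by_cases hzk : k + 1 ≤ z
    · exact (h z hz hcz).1 hzk
    · have := (h z hz hcz).2 (by omega)
      rw [min_eq_right (show z ≤ k by omega), show z - k = 0 by omega] at this
      rw [min_eq_right (show z ≤ k + 1 by omega), show z - (k + 1) = 0 by omega]
      exact this

theorem wv_mul_longestMinRep_inv (hi : 1 ≤ i) (hin : i ≤ n) (w : Equiv.Perm (Fin (n + 1))) :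
    (∀ y < n + 1 - i, wv (w * (longestMinRep n i)⁻¹) y = wv w (i + y)) ∧
      ∀ κ < i, wv (w * (longestMinRep n i)⁻¹) (n + 1 - i + κ) = wv w κ := by
  have key : ∀ x y : Fin (n + 1), longestMinRep n i x = y →
      wv (w * (longestMinRep n i)⁻¹) y = wv w x := by
    rintro x _ rfl
    simp [wv_val]
  have hval : ∀ x : Fin (n + 1), (longestMinRep n i x).val = (x.val + (n + 1 - i)) % (n + 1) := by
    intro x
    simp [longestMinRep, Fin.val_add]
  constructor
  · intro y hy
    refine key ⟨i + y, by omega⟩ ⟨y, by omega⟩ (Fin.ext ?_)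
    rw [hval]
    simp only
    rw [show i + y + (n + 1 - i) = y + (n + 1) by omega, Nat.add_mod_right, Nat.mod_eq_of_lt (by omega)]
  · intro κ hκ
    refine key ⟨κ, by omega⟩ ⟨n + 1 - i + κ, by omega⟩ (Fin.ext ?_)
    rw [hval]
    simp only
    rw [Nat.mod_eq_of_lt (by omega), add_comm]

/-- The largest Kogan face of type `w w₀⁻¹`. -/
def schubertFace (n i m : ℕ) (w : Equiv.Perm (Fin (n + 1))) : Set (GTIndex n → ℝ) :=
  {s ∈ gtPolytope n (fun l => if l = n + 1 - i then m else 0) | ∀ k j, 1 ≤ j → j ≤ n + 1 - i →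
    k ≤ wv w (n + 1 - j) → k + j ≤ n + 1 → entry s k j = m}

/-- After all rows, the entry of row `k` whose position is the number of values at least `k` on the
places of `w` from `i` on (counted from 0) equals `m`. As `w` increases there, `k ≤ wv w (n + 1 -
j)` gives at least `j` such values. -/
theorem koganFace_subset (hi : 1 ≤ i) (hin : i ≤ n) (hw : IsMinRep n i w) {D : Finset (ℕ × ℕ)}
    (hD : koganType n D = w * (longestMinRep n i)⁻¹) :
    koganFace n (fun l => if l = n + 1 - i then m else 0) D ⊆ schubertFace n i m w := by
  intro s hs
  refine ⟨hs.1, fun k j hj hjd hk hkj => ?_⟩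
  have h := forced_rowsProd hi hin hs le_rfl
  rw [← koganType_eq, hD] at h
  have hcount : j ≤ upperCount (n + 1 - i) (w * (longestMinRep n i)⁻¹) k := by
    rw [upperCount, show j = (Finset.Ico (n + 1 - i - j) (n + 1 - i)).card by rw [Nat.card_Ico]; omega]
    refine Finset.card_le_card fun y hy => ?_
    rw [Finset.mem_Ico] at hy
    rw [Finset.mem_filter, Finset.mem_range]
    refine ⟨hy.2, ?_⟩
    rw [(wv_mul_longestMinRep_inv hi hin w).1 y hy.2]
    refine hk.trans ?_
    by_cases h : n + 1 - j = i + y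
    · rw [h]
    · exact (hw.lt_of_lt (by omega) (by omega) (by omega)).le
  have hkn : k ≤ n := by
    have := wv_lt w (n + 1 - j)
    omega
  have h₁ := (h k hkn (by omega)).2 (by omega)
  have h₂ := upperCount_le (show n + 1 - i ≤ n + 1 by omega) (w * (longestMinRep n i)⁻¹) k
  rw [min_eq_right hkn, Nat.sub_eq_zero_of_le hkn, add_zero] at h₁
  exact le_antisymm (entry_le hi hin hs.1 hj hkj)
    (h₁ ▸ entry_antitone hs.1 hj hcount (by omega))

end Kogan
end GTSchubert

namespace GTSchubert

/-! ### Uniqueness of the maximal Kogan face -/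

section Kogan

variable {n i m : ℕ} {w : Equiv.Perm (Fin (n + 1))}

theorem card_le_of_wv_lt (w : Equiv.Perm (Fin (n + 1))) {S : Finset ℕ} {z : ℕ}
    (hS : ∀ x ∈ S, x < n + 1 ∧ wv w x < z) : S.card ≤ z := by
  rw [← Finset.card_range z]
  exact Finset.card_le_card_of_injOn (wv w)
    (fun x hx => Finset.mem_coe.2 (Finset.mem_range.2 (hS x hx).2))
    fun x hx y hy h => wv_inj w (hS x hx).1 (hS y hy).1 h

theorem card_le_of_le_wv (w : Equiv.Perm (Fin (n + 1))) {S : Finset ℕ} {z : ℕ}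
    (hS : ∀ x ∈ S, x < n + 1 ∧ z ≤ wv w x) : S.card ≤ n + 1 - z := by
  rw [← Nat.card_Ico]
  exact Finset.card_le_card_of_injOn (wv w)
    (fun x hx => Finset.mem_coe.2 (Finset.mem_Ico.2 ⟨(hS x hx).2, wv_lt w x⟩))
    fun x hx y hy h => wv_inj w (hS x hx).1 (hS y hy).1 h

theorem card_Ico_union {a b c e : ℕ} (h : b ≤ c) :
    (Finset.Ico a b ∪ Finset.Ico c e).card = b - a + (e - c) := by
  rw [Finset.card_union_of_disjoint, Nat.card_Ico, Nat.card_Ico]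
  rw [Finset.disjoint_left]
  intro x hx hx'
  rw [Finset.mem_Ico] at hx hx'
  omega

/-- If `w κ` and `w (i + y)` are less than `z`, then so are `κ + y + 2` values of `w ∈ W^i`. -/
theorem IsMinRep.add_le_of_lt (hin : i ≤ n) (hw : IsMinRep n i w) {κ y z : ℕ} (hκ : κ < i)
    (hy : y < n + 1 - i) (h₁ : wv w κ < z) (h₂ : wv w (i + y) < z) : κ + 1 + (y + 1) ≤ z := by
  have := card_le_of_wv_lt w (S := Finset.Ico 0 (κ + 1) ∪ Finset.Ico i (i + y + 1)) (z := z) ?_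
  · rw [card_Ico_union (by omega)] at this
    omega
  · intro x hx
    rw [Finset.mem_union, Finset.mem_Ico, Finset.mem_Ico] at hx
    refine ⟨by omega, ?_⟩
    rcases hx with hx | hx
    · rcases (show x ≤ κ by omega).eq_or_lt with rfl | h
      · exact h₁
      · exact (hw.lt_of_lt h (by omega) (by omega)).trans h₁
    · rcases (show x ≤ i + y by omega).eq_or_lt with rfl | h
      · exact h₂
      · exact (hw.lt_of_lt h (by omega) (by omega)).trans h₂

/-- The places from `κ` to `i - 1` and those from `i + y` on all carry values at least `z`, and
there are only `n + 1 - z` of these. -/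
theorem IsMinRep.add_le_of_le (hin : i ≤ n) (hw : IsMinRep n i w) {κ y z : ℕ} (hκ : κ < i)
    (h₁ : z ≤ wv w κ) (h₂ : z ≤ wv w (i + y)) : z ≤ κ + y := by
  have := card_le_of_le_wv w (S := Finset.Ico κ i ∪ Finset.Ico (i + y) (n + 1)) (z := z) ?_
  · rw [card_Ico_union (by omega)] at this
    have := wv_lt w κ
    omega
  · intro x hx
    rw [Finset.mem_union, Finset.mem_Ico, Finset.mem_Ico] at hx
    refine ⟨by omega, ?_⟩
    rcases hx with hx | hx
    · rcases hx.1.eq_or_lt with rfl | h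
      · exact h₁
      · exact h₁.trans (hw.lt_of_lt h (by omega) (by omega)).le
    · rcases hx.1.eq_or_lt with rfl | h
      · exact h₂
      · exact h₂.trans (hw.lt_of_lt h (by omega) (by omega)).le

theorem IsMinRep.le_wv (hin : i ≤ n) (hw : IsMinRep n i w) {κ : ℕ} (hκ : κ < i) : κ ≤ wv w κ := by
  have := card_le_of_wv_lt w (S := Finset.Ico 0 κ) (z := wv w κ) fun x hx => by
    rw [Finset.mem_Ico] at hx
    exact ⟨by omega, hw.lt_of_lt hx.2 (by omega) (by omega)⟩
  rwa [Nat.card_Ico] at this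

theorem wv_mul (p q : Equiv.Perm (Fin (n + 1))) {y : ℕ} (hy : y < n + 1) :
    wv (p * q) y = wv p (wv q y) := by
  rw [wv_of_lt _ hy, wv_of_lt q hy, wv_val]
  rfl

/-- A row whose equations fill its first `L` places contributes a product of consecutive reflections
s_{k+1} s_{k+2} ⋯, which is a cycle. -/
theorem wv_rowProd {D : Finset (ℕ × ℕ)} {k L : ℕ} (hD : ∀ j, 1 ≤ j → ((k, j) ∈ D ↔ j ≤ L)) {N : ℕ}
    (hN : k + N ≤ n) {y : ℕ} (hy : y < n + 1) : wv (rowProd n D k N) y =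
      if y = k + min N L then k else if k ≤ y ∧ y < k + min N L then y + 1 else y := by
  induction N generalizing y with
  | zero =>
    have h : wv (rowProd n D k 0) y = y := wv_of_lt _ hy
    rw [h]
    split_ifs <;> omega
  | succ N ih =>
    rw [rowProd_succ]
    by_cases hNL : N + 1 ≤ L
    · rw [if_pos ((hD _ (by omega)).2 hNL), ← add_assoc, wv_mul_simpleRefl_succ _ (by omega)]
      have e₁ : min N L = N := by omega
      have e₂ : min (N + 1) L = N + 1 := by omega
      rw [e₂]
      split_ifs <;> rw [ih (by omega) (by omega), e₁] <;> split_ifs <;> omega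
    · rw [if_neg fun h => hNL ((hD _ (by omega)).1 h), mul_one, ih (by omega) hy,
        show min (N + 1) L = min N L by omega]

/-- The equations of the largest Kogan face of type `w w₀⁻¹`. -/
def schubertEqs (n i : ℕ) (w : Equiv.Perm (Fin (n + 1))) : Finset (ℕ × ℕ) :=
  (Finset.range (n + 1) ×ˢ Finset.range (n + 1)).filter fun q =>
    1 ≤ q.2 ∧ ∃ κ < i, wv w κ = q.1 ∧ q.1 + q.2 ≤ n + 1 - i + κ

theorem mem_schubertEqs (hin : i ≤ n) {k j : ℕ} (hj : 1 ≤ j) : (k, j) ∈ schubertEqs n i w ↔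
    ∃ κ < i, wv w κ = k ∧ k + j ≤ n + 1 - i + κ := by
  simp only [schubertEqs, Finset.mem_filter, Finset.mem_product, Finset.mem_range]
  refine ⟨fun h => h.2.2, fun h => ⟨?_, hj, h⟩⟩
  obtain ⟨κ, h₁, h₂, h₃⟩ := h
  omega

/-- Invariant of the first `k` rows: the values below `k` already sit where w w₀⁻¹ has them, `t` of
them coming from the first `i` places of `w` and `a` from the others; the open places keep their
order. Row `k` is empty unless `w` takes the value `k` on its first `i` places, and then its cycle
brings `n + 1 - i + t` down to `k`. -/
theorem wv_rowsProd_schubertEqs (hin : i ≤ n) (hw : IsMinRep n i w) {k : ℕ} (hk : k ≤ n) :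
    ∃ t a, t + a = k ∧ t ≤ i ∧ a ≤ n + 1 - i ∧
      (∀ κ < i, (κ < t → wv w κ < k ∧
          wv (rowsProd n (schubertEqs n i w) k) (n + 1 - i + κ) = wv w κ) ∧
        (t ≤ κ → k ≤ wv w κ ∧
          wv (rowsProd n (schubertEqs n i w) k) (n + 1 - i + κ) = n + 1 - i + κ)) ∧
      (∀ y < n + 1 - i, (y < a → wv w (i + y) < k ∧
          wv (rowsProd n (schubertEqs n i w) k) y = wv w (i + y)) ∧
        (a ≤ y → k ≤ wv w (i + y) ∧
          wv (rowsProd n (schubertEqs n i w) k) y = y + t)) := by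
  induction k with
  | zero =>
    have h : ∀ y < n + 1, wv (rowsProd n (schubertEqs n i w) 0) y = y := fun y hy => wv_of_lt _ hy
    refine ⟨0, 0, rfl, by omega, by omega, fun κ hκ => ⟨by omega, fun _ => ⟨by omega, ?_⟩⟩,
      fun y hy => ⟨by omega, fun _ => ⟨by omega, ?_⟩⟩⟩ <;> rw [h _ (by omega)]
    rfl
  | succ k ih =>
    obtain ⟨t, a, rfl, ht, ha, hκ, hy⟩ := ih (by omega)
    obtain ⟨x, hx, hxk⟩ : ∃ x < n + 1, wv w x = t + a :=
      ⟨(w.symm ⟨t + a, by omega⟩).val, Fin.is_lt _, by rw [wv_val, Equiv.apply_symm_apply]⟩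
    rw [rowsProd_succ]
    by_cases hxi : x < i
    · have hxt : x = t := by
        rcases lt_trichotomy x t with h | h | h
        · have := ((hκ x hxi).1 h).1
          omega
        · exact h
        · have := ((hκ t (by omega)).2 le_rfl).1
          have := hw.lt_of_lt h (by omega) (Or.inl hxi)
          omega
      subst hxt
      have hrow : ∀ y < n + 1,
          wv (rowProd n (schubertEqs n i w) (x + a) (n - (x + a))) y =
            if y = n + 1 - i + x then x + a else
              if x + a ≤ y ∧ y < n + 1 - i + x then y + 1 else y := by
        clear hκ hy ih
        intro y hy
        rw [wv_rowProd (L := n + 1 - (i + a)) (fun j hj => ?_) (by omega) hy,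
          show x + a + min (n - (x + a)) (n + 1 - (i + a)) = n + 1 - i + x by omega]
        rw [mem_schubertEqs hin hj]
        constructor
        · rintro ⟨κ, h₁, h₂, h₃⟩
          have := wv_inj w (x := κ) (y := x) (by omega) hx (h₂.trans hxk.symm)
          omega
        · exact fun h => ⟨x, hxi, hxk, by omega⟩
      refine ⟨x + 1, a, by omega, by omega, ha, fun κ hκi => ⟨fun h => ?_, fun h => ?_⟩,
        fun y hyd => ⟨fun h => ?_, fun h => ?_⟩⟩
      · rw [wv_mul _ _ (by omega)]
        rcases (show κ ≤ x by omega).eq_or_lt with rfl | h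
        · refine ⟨by omega, ?_⟩
          rw [((hκ κ hκi).2 le_rfl).2, hrow _ (by omega), if_pos rfl, hxk]
        · obtain ⟨h₁, h₂⟩ := (hκ κ hκi).1 h
          refine ⟨by omega, ?_⟩
          rw [h₂, hrow _ (wv_lt w κ)]
          split_ifs <;> omega
      · rw [wv_mul _ _ (by omega)]
        obtain ⟨h₁, h₂⟩ := (hκ κ hκi).2 (by omega)
        refine ⟨?_, ?_⟩
        · have := hw.lt_of_lt (show x < κ by omega) (by omega) (by omega)
          omega
        · rw [h₂, hrow _ (by omega)]
          split_ifs <;> omega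
      · rw [wv_mul _ _ (by omega)]
        obtain ⟨h₁, h₂⟩ := (hy y hyd).1 h
        refine ⟨by omega, ?_⟩
        rw [h₂, hrow _ (wv_lt w _)]
        split_ifs <;> omega
      · rw [wv_mul _ _ (by omega)]
        obtain ⟨h₁, h₂⟩ := (hy y hyd).2 h
        refine ⟨?_, ?_⟩
        · rcases h₁.eq_or_lt with h' | h'
          · have := wv_inj w hx (y := i + y) (by omega) (hxk.trans h')
            omega
          · omega
        · rw [h₂, hrow _ (by omega)]
          split_ifs <;> omega
    · obtain ⟨y₀, rfl⟩ : ∃ y₀, x = i + y₀ := ⟨x - i, by omega⟩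
      have hya : y₀ = a := by
        rcases lt_trichotomy y₀ a with h | h | h
        · have := ((hy y₀ (by omega)).1 h).1
          omega
        · exact h
        · have := ((hy a (by omega)).2 le_rfl).1
          have := hw.lt_of_lt (show i + a < i + y₀ by omega) (by omega) (by omega)
          omega
      subst hya
      have hrow : ∀ y < n + 1,
          wv (rowProd n (schubertEqs n i w) (t + y₀) (n - (t + y₀))) y = y := by
        intro y hy
        rw [wv_rowProd (L := 0) (fun j hj => ?_) (by omega) hy, Nat.min_zero]
        · split_ifs <;> omega
        rw [mem_schubertEqs hin hj]
        refine ⟨?_, by omega⟩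
        rintro ⟨κ, h₁, h₂, h₃⟩
        have := wv_inj w (x := κ) (y := i + y₀) (by omega) hx (h₂.trans hxk.symm)
        omega
      refine ⟨t, y₀ + 1, by omega, ht, by omega, fun κ hκi => ⟨fun h => ?_, fun h => ?_⟩,
        fun y hyd => ⟨fun h => ?_, fun h => ?_⟩⟩ <;>
        rw [wv_mul _ _ (by omega), hrow _ (wv_lt _ _)]
      · obtain ⟨h₁, h₂⟩ := (hκ κ hκi).1 h
        exact ⟨by omega, h₂⟩
      · obtain ⟨h₁, h₂⟩ := (hκ κ hκi).2 h
        refine ⟨?_, h₂⟩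
        rcases h₁.eq_or_lt with h' | h'
        · have := wv_inj w hx (y := κ) (by omega) (hxk.trans h')
          omega
        · omega
      · rcases (show y ≤ y₀ by omega).eq_or_lt with rfl | h
        · refine ⟨by omega, ?_⟩
          rw [((hy y hyd).2 le_rfl).2, hxk, add_comm]
        · obtain ⟨h₁, h₂⟩ := (hy y hyd).1 h
          exact ⟨by omega, h₂⟩
      · obtain ⟨h₁, h₂⟩ := (hy y hyd).2 (by omega)
        refine ⟨?_, h₂⟩
        have := hw.lt_of_lt (show i + y₀ < i + y by omega) (by omega) (by omega)
        omega

theorem koganType_schubertEqs (hi : 1 ≤ i) (hin : i ≤ n) (hw : IsMinRep n i w) :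
    koganType n (schubertEqs n i w) = w * (longestMinRep n i)⁻¹ := by
  rw [koganType_eq]
  obtain ⟨t, a, hta, ht, ha, hκ, hy⟩ := wv_rowsProd_schubertEqs hin hw le_rfl
  obtain ⟨e₁, e₂⟩ := wv_mul_longestMinRep_inv hi hin w
  refine Equiv.ext fun x => Fin.ext ?_
  rw [← wv_val, ← wv_val]
  by_cases hx : x.val < n + 1 - i
  · rw [e₁ _ hx]
    by_cases h : x.val < a
    · exact ((hy _ hx).1 h).2
    · obtain ⟨h₁, h₂⟩ := (hy _ hx).2 (by omega)
      rw [h₂]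
      have := wv_lt w (i + x)
      omega
  · obtain ⟨κ, hκx⟩ : ∃ κ, x.val = n + 1 - i + κ := ⟨x.val - (n + 1 - i), by omega⟩
    have hκi : κ < i := by omega
    rw [hκx, e₂ _ hκi]
    by_cases h : κ < t
    · exact ((hκ _ hκi).1 h).2
    · obtain ⟨h₁, h₂⟩ := (hκ _ hκi).2 (by omega)
      rw [h₂]
      have := wv_lt w κ
      omega

/-- Each of these equations joins two entries that are both frozen at `m`: counting the small values
of `w` shows that the freezing condition still holds one row further down. -/
theorem schubertFace_subset (hi : 1 ≤ i) (hin : i ≤ n) (hw : IsMinRep n i w) :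
    schubertFace n i m w ⊆
      koganFace n (fun l => if l = n + 1 - i then m else 0) (schubertEqs n i w) := by
  refine fun s hs => ⟨hs.1, fun p q hr hc hpq => ?_⟩
  have hp := p.2
  have hq := q.2
  change 1 ≤ p.col ∧ p.row + p.col ≤ n + 1 at hp
  change 1 ≤ q.col ∧ q.row + q.col ≤ n + 1 at hq
  rw [mem_schubertEqs hin hp.1] at hpq
  obtain ⟨κ, hκ, hκp, hle⟩ := hpq
  have h₁ := hw.le_wv hin hκ
  have h₂ : p.row + 1 ≤ wv w (n + 1 - p.col) := by
    by_contra! hcon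
    have := hw.add_le_of_lt hin (κ := κ) (y := n + 1 - i - p.col) (z := p.row + 1) hκ (by omega)
      (by omega) (by rwa [show i + (n + 1 - i - p.col) = n + 1 - p.col by omega])
    omega
  rw [← entry_eq s p, ← entry_eq s q, hr, hc, hs.2 _ _ hp.1 (by omega) (by omega) hp.2,
    hs.2 _ _ hp.1 (by omega) h₂ (by omega)]

/-- All Kogan faces of this type are contained in one of them. -/
theorem IsMaximalKoganFace.eq_schubertFace (hi : 1 ≤ i) (hin : i ≤ n) (hw : IsMinRep n i w)
    {F : Set (GTIndex n → ℝ)} (hF : IsMaximalKoganFace n i m w F) : F = schubertFace n i m w := by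
  obtain ⟨⟨D, hD, rfl⟩, hmax⟩ := hF
  have h := koganFace_subset (m := m) hi hin hw hD
  exact h.antisymm ((schubertFace_subset hi hin hw).trans
    (hmax ⟨_, koganType_schubertEqs hi hin hw, rfl⟩ (h.trans (schubertFace_subset hi hin hw))))

end Kogan
end GTSchubert

namespace GTSchubert

/-! ### The toric variety of the Kogan face as a model -/

section PolytopeModel

variable {ι I A : Type*} [Fintype ι] [Fintype I]

theorem isToricModel_polytopeVariety {P : Set (ι → ℝ)} {ex : A → I → ℕ} [Nonempty A]
    (e : A ≃ LatticePt P)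
    (h₁ : ∀ t : ι → ℂˣ, ∃ (h : I → ℂˣ) (c : ℂˣ), ∀ a, ∏ p, t p ^ (e a).1 p = c * mon h (ex a))
    (h₂ : ∀ h : I → ℂˣ, ∃ (t : ι → ℂˣ) (c : ℂˣ), ∀ a, mon h (ex a) = c * ∏ p, t p ^ (e a).1 p) :
    IsToricModel (polytopeVariety P) (polytopeTorus P) ex (LinearEquiv.funCongrLeft ℂ ℂ e) := by
  set Ψ := LinearEquiv.funCongrLeft ℂ ℂ e
  have hΨ : ∀ y a, Ψ y a = y (e a) := fun _ _ => rfl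
  have hρ : ∀ t (y : LatticePt P → ℂ) u,
      (polytopeTorus P t • y) u = ((∏ p, t p ^ u.1 p : ℂˣ) : ℂ) * y u := fun _ _ _ => rfl
  refine ⟨fun z => ⟨fun hz d f hf hv => ?_, fun hz d f hf hv => ?_⟩, fun t => ?_, fun h => ?_⟩
  · refine hz d (fun y => f (Ψ y)) (hf.comp_linear Ψ.toLinearMap) ?_
    rintro _ ⟨t, ht, rfl⟩
    refine ((hf.comp_linear Ψ.toLinearMap).map_rep_eq_zero ht).2 ?_
    obtain ⟨h, c, hc⟩ := h₁ t
    change f (Ψ _) = 0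
    rw [← (hf.map_smul_eq_zero c _).2 (hv h)]
    congr 1
    funext a
    rw [hΨ, hc, Units.val_mul]
    rfl
  · have := hz d (fun y => f (Ψ.symm y)) (hf.comp_linear Ψ.symm.toLinearMap) fun h => ?_
    · simpa using this
    · obtain ⟨t, c, hc⟩ := h₂ h
      have hne : (fun u : LatticePt P => ((∏ p, t p ^ u.1 p : ℂˣ) : ℂ)) ≠ 0 := fun h' =>
        (∏ p, t p ^ (e (Classical.arbitrary A)).1 p : ℂˣ).ne_zero (congrFun h' _)
      have := (hf.map_rep_eq_zero hne).1 (hv _ ⟨t, hne, rfl⟩)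
      rw [← (hf.map_smul_eq_zero c _).2 this]
      congr 1
      rw [LinearEquiv.symm_apply_eq]
      funext a
      rw [hΨ, hc, Units.val_mul]
      rfl
  · obtain ⟨h, c, hc⟩ := h₁ t
    refine ⟨h, c, fun y a => ?_⟩
    rw [hΨ, hΨ, hρ, hc, Units.val_mul]
  · obtain ⟨t, c, hc⟩ := h₂ h
    refine ⟨t, c⁻¹, fun y a => ?_⟩
    rw [hΨ, hΨ, hρ, hc, ← Units.val_mul, inv_mul_cancel_left]

end PolytopeModel

/-! ### Lattice points of the face as points of the order polytope -/

section KoganModel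

variable {n i m : ℕ} {w : Equiv.Perm (Fin (n + 1))}

/-- The position in a Gelfand–Tsetlin pattern of a cell of the diagram. -/
def cellIndex (hi : 1 ≤ i) (hin : i ≤ n) (c : diagram n i w) : GTIndex n :=
  ⟨(⟨i - c.1.1 + c.1.2, by have := (mem_diagram.1 c.2).1; omega⟩, ⟨n + 1 - i - c.1.2, by omega⟩),
    by have := (mem_diagram.1 c.2).1; change 1 ≤ n + 1 - i - c.1.2 ∧ i - c.1.1 + c.1.2 + (n + 1 - i - c.1.2) ≤ n + 1; omega⟩

theorem cellIndex_row (hi : 1 ≤ i) (hin : i ≤ n) (c : diagram n i w) :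
    (cellIndex hi hin c).row = i - c.1.1 + c.1.2 := rfl

theorem cellIndex_col (hi : 1 ≤ i) (hin : i ≤ n) (c : diagram n i w) :
    (cellIndex hi hin c).col = n + 1 - i - c.1.2 := rfl

/-- The cell at the position `(k, j)` of a Gelfand–Tsetlin pattern. -/
def indexCell (n i k j : ℕ) : ℕ × ℕ := (i + (n + 1 - i - j) - k, n + 1 - i - j)

theorem indexCell_cellIndex (hi : 1 ≤ i) (hin : i ≤ n) (c : diagram n i w) :
    indexCell n i (cellIndex hi hin c).row (cellIndex hi hin c).col = c.1 := by
  have := (mem_diagram.1 c.2).1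
  rw [cellIndex_row, cellIndex_col, indexCell]
  refine Prod.ext ?_ ?_ <;> dsimp only <;> omega

/-- The value of `x` at a cell, and `m` outside of the diagram. -/
def cellMax (m : ℕ) {D : Finset (ℕ × ℕ)} (x : D → ℕ) (c : ℕ × ℕ) : ℕ :=
  if h : c ∈ D then x ⟨c, h⟩ else m

theorem cellMax_le {D : Finset (ℕ × ℕ)} (x : OrderPt D m) (c : ℕ × ℕ) : cellMax m x.1 c ≤ m := by
  unfold cellMax
  split_ifs
  · exact x.2.2 _
  · exact le_rfl

theorem cellMax_mono {D : Finset (ℕ × ℕ)} (hD : IsLowerSet (D : Set (ℕ × ℕ))) (x : OrderPt D m)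
    {c c' : ℕ × ℕ} (h : c ≤ c') : cellMax m x.1 c ≤ cellMax m x.1 c' := by
  by_cases hc' : c' ∈ D
  · have hc : c ∈ D := hD h hc'
    rw [cellMax, cellMax, dif_pos hc, dif_pos hc']
    exact x.2.1 h
  · exact (cellMax_le x c).trans (by rw [cellMax, dif_neg hc'])

/-- The entry `(k, j)` of the pattern of an order polytope point. -/
def patternVal (n i m : ℕ) {D : Finset (ℕ × ℕ)} (x : D → ℕ) (k j : ℕ) : ℕ :=
  if n + 1 - i < j then 0 else cellMax m x (indexCell n i k j)

/-- The cell (r, s) is placed in row `i - r + s` of the pattern, so this identifies the free entries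
with the cells of the diagram. For an inversion at most `i - 1 - r + s` values lie below `wv w (i +
s)`, otherwise at least `i - r + s`. -/
theorem IsMinRep.lt_iff_row_le (hin : i ≤ n) (hw : IsMinRep n i w) {r s : ℕ} (hr : r < i)
    (hs : s < n + 1 - i) : (r, s) ∈ diagram n i w ↔ wv w (i + s) < i - r + s := by
  rw [mem_diagram]
  dsimp only
  constructor
  · rintro ⟨-, h⟩
    have := hw.add_le_of_le hin (κ := i - 1 - r) (y := s) (z := wv w (i + s)) (by omega) h.le le_rfl
    omega
  · intro h
    refine ⟨by omega, ?_⟩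
    by_contra! hcon
    have hne : wv w (i - 1 - r) ≠ wv w (i + s) := fun h => by
      have := wv_inj w (by omega) (by omega) h
      omega
    have := hw.add_le_of_lt hin (κ := i - 1 - r) (y := s) (z := wv w (i + s) + 1) (by omega) hs
      (by omega) (by omega)
    omega

variable {s : GTIndex n → ℝ}

theorem entry_row_antitone {lam : ℕ → ℕ} (hs : s ∈ gtPolytope n lam) {k k' j : ℕ} (hj : 1 ≤ j)
    (hkk' : k ≤ k') (h : k' + j ≤ n + 1) : entry s k' j ≤ entry s k j := by
  induction k', hkk' using Nat.le_induction with
  | base => exact le_rfl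
  | succ k' _ ih => exact (entry_succ_le hs hj h).trans (ih (by omega))

theorem entry_diagonal_le {lam : ℕ → ℕ} (hs : s ∈ gtPolytope n lam) {k j a : ℕ} (hj : 1 ≤ j)
    (h : k + a + j ≤ n + 1) : entry s k (j + a) ≤ entry s (k + a) j := by
  induction a generalizing j with
  | zero => exact le_rfl
  | succ a ih =>
    have h₁ := ih (j := j + 1) (by omega) (by omega)
    rw [show j + 1 + a = j + (a + 1) by omega] at h₁
    exact h₁.trans (entry_succ_right_le hs hj (by omega))

theorem patternVal_mem (hi : 1 ≤ i) (hin : i ≤ n) (hw : IsMinRep n i w)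
    (x : OrderPt (diagram n i w) m) :
    (fun p : GTIndex n => ((patternVal n i m x.1 p.row p.col : ℕ) : ℝ)) ∈
      schubertFace n i m w := by
  have hD := hw.isLowerSet_diagram hin
  refine ⟨⟨fun p hp => ?_, fun p q hr hc => ?_, fun p q hr hc => ?_⟩, fun k j hj hjd hk hkj => ?_⟩
  · have h := p.2
    change 1 ≤ p.col ∧ p.row + p.col ≤ n + 1 at h
    simp only [Nat.cast_ite, Nat.cast_zero, Finset.sum_ite_eq', Finset.mem_Icc]
    rw [patternVal]
    split_ifs with h₁ h₂ h₂
    · omega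
    · simp
    · rw [cellMax, dif_neg]
      intro hc
      have := (mem_diagram.1 hc).1
      simp only [indexCell] at this
      omega
    · omega
  · have h := q.2
    change 1 ≤ q.col ∧ q.row + q.col ≤ n + 1 at h
    rw [Nat.cast_le, patternVal, patternVal, hc]
    split_ifs with h₁
    · exact le_rfl
    · refine cellMax_mono hD x ⟨?_, le_rfl⟩
      simp only [indexCell]
      omega
  · have h := q.2
    change 1 ≤ q.col ∧ q.row + q.col ≤ n + 1 at h
    rw [Nat.cast_le, patternVal, patternVal]
    split_ifs with h₁ h₂
    · exact le_rfl
    · exact Nat.zero_le _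
    · omega
    · refine cellMax_mono hD x ⟨?_, ?_⟩ <;> simp only [indexCell] <;> omega
  · rw [entry_of_le _ ⟨hj, hkj⟩]
    simp only [GTIndex.row, GTIndex.col]
    rw [patternVal, if_neg (by omega), cellMax, dif_neg]
    intro hc
    have h₁ := (mem_diagram.1 hc).1
    simp only [indexCell] at h₁
    rw [indexCell, hw.lt_iff_row_le hin h₁.1 (by omega)] at hc
    rw [show i + (n + 1 - i - j) = n + 1 - j by omega] at hc h₁
    omega

/-- Outside the diagram nothing is free: the zeros of the top row propagate down the columns, its
values `m` along the diagonals to the entries with row plus column at most `n + 1 - i`, and the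
others are frozen. -/
theorem entry_eq_patternVal (hi : 1 ≤ i) (hin : i ≤ n) (hw : IsMinRep n i w)
    (hs : s ∈ schubertFace n i m w) (x : diagram n i w → ℕ)
    (hx : ∀ c, s (cellIndex hi hin c) = x c) (p : GTIndex n) :
    s p = patternVal n i m x p.row p.col := by
  have h := p.2
  change 1 ≤ p.col ∧ p.row + p.col ≤ n + 1 at h
  rw [patternVal]
  split_ifs with h₁
  · rw [← entry_eq s p, entry_eq_zero hi hin hs.1 h₁ h.2, Nat.cast_zero]
  · rw [cellMax]
    split_ifs with hc
    · rw [← hx]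
      congr 1
      have := (mem_diagram.1 hc).1
      refine Subtype.ext (Prod.ext (Fin.ext ?_) (Fin.ext ?_))
      · change p.row = i - (i + (n + 1 - i - p.col) - p.row) + (n + 1 - i - p.col)
        simp only [indexCell] at this
        omega
      · change p.col = n + 1 - i - (n + 1 - i - p.col)
        omega
    · rw [← entry_eq s p]
      by_cases hr : i + (n + 1 - i - p.col) - p.row < i
      · rw [indexCell, hw.lt_iff_row_le hin hr (by omega),
          show i + (n + 1 - i - p.col) = n + 1 - p.col by omega] at hc
        exact hs.2 _ _ h.1 (by omega) (by omega) h.2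
      · refine le_antisymm (entry_le hi hin hs.1 h.1 h.2) ?_
        have := entry_diagonal_le hs.1 (k := 0) (j := p.col) (a := p.row) h.1 (by omega)
        rwa [entry_top hi hin hs.1 (by omega) (by omega), if_pos (by omega), zero_add] at this

theorem entry_cellIndex_mono (hi : 1 ≤ i) (hin : i ≤ n) {lam : ℕ → ℕ} (hs : s ∈ gtPolytope n lam)
    {c c' : diagram n i w} (h : c ≤ c') : s (cellIndex hi hin c) ≤ s (cellIndex hi hin c') := by
  have h₁ := (mem_diagram.1 c.2).1
  have h₂ := (mem_diagram.1 c'.2).1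
  obtain ⟨h₃, h₄⟩ := (cell_le_iff c c').1 h
  rw [← entry_eq s, ← entry_eq s (cellIndex hi hin c'), cellIndex_row, cellIndex_col,
    cellIndex_row, cellIndex_col]
  have h₅ := entry_row_antitone hs (k := i - c'.1.1 + c.1.2) (k' := i - c.1.1 + c.1.2)
    (j := n + 1 - i - c.1.2) (by omega) (by omega) (by omega)
  have h₆ := entry_diagonal_le hs (k := i - c'.1.1 + c.1.2) (j := n + 1 - i - c'.1.2)
    (a := c'.1.2 - c.1.2) (by omega) (by omega)
  rw [show n + 1 - i - c'.1.2 + (c'.1.2 - c.1.2) = n + 1 - i - c.1.2 by omega,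
    show i - c'.1.1 + c.1.2 + (c'.1.2 - c.1.2) = i - c'.1.1 + c'.1.2 by omega] at h₆
  exact h₅.trans h₆

/-- The lattice points of the face are the lattice points of the order polytope. -/
def latticeEquiv (m : ℕ) (hi : 1 ≤ i) (hin : i ≤ n) (hw : IsMinRep n i w) :
    OrderPt (diagram n i w) m ≃ LatticePt (schubertFace n i m w) where
  toFun x := ⟨fun p => patternVal n i m x.1 p.row p.col, by
    simpa using patternVal_mem hi hin hw x⟩
  invFun u := ⟨fun c => (u.1 (cellIndex hi hin c)).toNat, fun c c' h =>
      Int.toNat_le_toNat (by exact_mod_cast entry_cellIndex_mono hi hin u.2.1 h), fun c => by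
    have h := (cellIndex hi hin c).2
    have := entry_le hi hin u.2.1 h.1 h.2
    have h' := entry_eq (fun p => (u.1 p : ℝ)) (cellIndex hi hin c)
    rw [GTIndex.row, GTIndex.col] at h'
    rw [h'] at this
    rw [Int.toNat_le]
    exact_mod_cast this⟩
  left_inv x := by
    refine Subtype.ext (funext fun c => ?_)
    simp only [Int.toNat_natCast]
    rw [patternVal, if_neg (by rw [cellIndex_col]; omega), indexCell_cellIndex, cellMax, dif_pos c.2]
  right_inv u := by
    refine Subtype.ext (funext fun p => ?_)
    have := entry_eq_patternVal hi hin hw u.2 (fun c => (u.1 (cellIndex hi hin c)).toNat)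
      (fun c => ?_) p
    · exact_mod_cast this.symm
    · have h := (cellIndex hi hin c).2
      have h₁ := entry_nonneg hi hin u.2.1 h.1 h.2
      have h' := entry_eq (fun p => (u.1 p : ℝ)) (cellIndex hi hin c)
      rw [GTIndex.row, GTIndex.col] at h'
      rw [h'] at h₁
      have h₂ : (0 : ℤ) ≤ u.1 (cellIndex hi hin c) := by exact_mod_cast h₁
      exact_mod_cast (Int.toNat_of_nonneg h₂).symm

theorem patternVal_eq_sum (x : diagram n i w → ℕ) (p : GTIndex n) :
    (patternVal n i m x p.row p.col : ℤ) = patternVal n i m (0 : diagram n i w → ℕ) p.row p.col +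
      ∑ c, (if indexCell n i p.row p.col = c.1 ∧ p.col ≤ n + 1 - i then 1 else 0) * (x c : ℤ) := by
  rw [patternVal, patternVal]
  split_ifs with h
  · rw [Finset.sum_eq_zero]
    · simp
    · intro c _
      rw [if_neg (by omega), zero_mul]
  · simp only [cellMax]
    split_ifs with hc
    · rw [Finset.sum_eq_single ⟨_, hc⟩]
      · rw [if_pos ⟨rfl, by omega⟩]
        simp
      · intro d _ hd
        rw [if_neg fun h => hd (Subtype.ext h.1.symm), zero_mul]
      · simp
    · rw [Finset.sum_eq_zero, add_zero]
      intro d _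
      rw [if_neg, zero_mul]
      rintro ⟨h, -⟩
      exact hc (h ▸ d.2)

theorem isToricModel_schubertFace (m : ℕ) (hi : 1 ≤ i) (hin : i ≤ n) (hw : IsMinRep n i w) :
    ∃ Ψ, IsToricModel (polytopeVariety (schubertFace n i m w))
      (polytopeTorus (schubertFace n i m w)) (fun x : OrderPt (diagram n i w) m => x.1) Ψ := by
  have hne : Nonempty (OrderPt (diagram n i w) m) :=
    ⟨⟨0, fun _ _ _ => le_rfl, fun _ => Nat.zero_le _⟩⟩
  refine ⟨_, isToricModel_polytopeVariety (latticeEquiv m hi hin hw) (fun t => ?_) fun h => ?_⟩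
  · obtain ⟨h, c, hc⟩ := exists_mon_of_affine
      (ex := fun (x : OrderPt (diagram n i w) m) (p : GTIndex n) => patternVal n i m x.1 p.row p.col)
      (ex' := fun x => x.1) _ _ (fun x p => patternVal_eq_sum x.1 p) t
    refine ⟨h, c, fun x => (hc x).symm ▸ ?_⟩
    simp [mon, latticeEquiv]
  · obtain ⟨t, c, hc⟩ := exists_mon_of_affine (I' := GTIndex n)
      (ex := fun (x : OrderPt (diagram n i w) m) => x.1)
      (ex' := fun x p => patternVal n i m x.1 p.row p.col) (fun _ => 0)
      (fun c p => if p = cellIndex hi hin c then 1 else 0) (fun x c => by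
        simp only [zero_add, ite_mul, one_mul, zero_mul, Finset.sum_ite_eq',
          Finset.mem_univ, if_true]
        rw [patternVal, if_neg (by rw [cellIndex_col]; omega), indexCell_cellIndex, cellMax,
          dif_pos c.2]) h
    refine ⟨t, c, fun x => (hc x).trans ?_⟩
    simp [mon, latticeEquiv]

end KoganModel
end GTSchubert

namespace GTSchubert

/-! ### The order polytope against the chain polytope of the diagram -/

section Comparison

variable {n i m : ℕ} {w : Equiv.Perm (Fin (n + 1))}

/-- The cut is at the inner cells. The cells below a cell of the first row or column stay in it and
form a chain, whereas two incomparable inner cells would force both (1,2) and (2,1) into the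
diagram. -/
theorem exists_transfer_diagram {D : Finset (ℕ × ℕ)} (hD : IsLowerSet (D : Set (ℕ × ℕ)))
    (h : ¬ ((1, 2) ∈ D ∧ (2, 1) ∈ D)) : ∃ e : OrderPt D m ≃ ChainPt D m,
      (∀ h : D → ℂˣ, ∃ (h' : D → ℂˣ) (k : ℂˣ), ∀ a, mon h a.1 = k * mon h' (e a).1) ∧
      (∀ h : D → ℂˣ, ∃ (h' : D → ℂˣ) (k : ℂˣ), ∀ a, mon h (e a).1 = k * mon h' a.1) := by
  have hmem : ∀ (c : D) (r s : ℕ), r ≤ c.1.1 → s ≤ c.1.2 → (r, s) ∈ D := fun c r s hr hs =>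
    hD (show (r, s) ≤ c.1 from ⟨hr, hs⟩) c.2
  refine exists_transfer {c : D | 1 ≤ c.1.1 ∧ 1 ≤ c.1.2} (fun c d hcd hc => ?_)
    (fun c hc d hd _ => ?_) fun c hc d hd e he _ => ?_
  · obtain ⟨h₁, h₂⟩ := (cell_le_iff c d).1 hcd
    exact ⟨hc.1.trans h₁, hc.2.trans h₂⟩
  · have h₁ := hmem c 1 2 hc.1
    have h₂ := hmem c 2 1
    have h₃ := hmem d 1 2 hd.1
    have h₄ := hmem d 2 1
    obtain ⟨hc₁, hc₂⟩ := hc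
    obtain ⟨hd₁, hd₂⟩ := hd
    by_contra hcon
    change ¬(c ≤ d ∨ d ≤ c) at hcon
    rw [cell_le_iff, cell_le_iff] at hcon
    refine h ⟨?_, ?_⟩
    · by_cases h' : 2 ≤ c.1.2
      · exact h₁ h'
      · exact h₃ (by omega)
    · by_cases h' : 2 ≤ c.1.1
      · exact h₂ h' hc₂
      · exact h₄ (by omega) hd₂
  · have h₁ := (cell_le_iff d c).1 hd
    have h₂ := (cell_le_iff e c).1 he
    rw [Set.mem_ofPred_eq] at hc
    change d ≤ e ∨ e ≤ d
    rw [cell_le_iff, cell_le_iff]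
    omega

/-- After cancelling |D|, the facet inequality bounds the number of maximal chains by that of inner
and maximal cells, against `card_lt_card_flag`. The converse is `exists_transfer_diagram`. -/
theorem toricIso_iff (hi : 1 ≤ i) (hin : i ≤ n) (hm : 1 ≤ m) (hw : IsMinRep n i w)
    {r : PosRoot n → PosRoot n → Prop} (hr : IsStrictTotalOrder _ r)
    (hrw : ExtendsHeightOrder w r) {F : Set (GTIndex n → ℝ)} (hF : IsMaximalKoganFace n i m w F) :
    ToricIso (polytopeVariety F) (polytopeTorus F) (toricSchubert n i m hin w r)
      (toricSchubertTorus n i m hin w r) ↔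
        ¬ ((1, 2) ∈ diagram n i w ∧ (2, 1) ∈ diagram n i w) := by
  rw [hF.eq_schubertFace hi hin hw]
  obtain ⟨Ψ, hΨ⟩ := isToricModel_schubertFace m hi hin hw
  obtain ⟨Ψ', hΨ'⟩ := exists_isToricModel_toricSchubert (m := m) hin hw hr hrw
  have hD := hw.isLowerSet_diagram hin
  refine ⟨fun iso h => ?_, fun h => ?_⟩
  · classical
    have hmem : ∀ r s, r ≤ 1 → s ≤ 2 → (r, s) ∈ diagram n i w := fun r s hr hs =>
      hD (show (r, s) ≤ (1, 2) from ⟨hr, hs⟩) h.1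
    have : Nonempty (diagram n i w) := ⟨⟨_, h.1⟩⟩
    have := Fintype.ofFinite (Flag (diagram n i w))
    have hle := (facetData_order hD ⟨_, h.1⟩ hm).card_le_of_toricIso (facetData_chain hm)
      (fun f f' hff => chainSlack_incomparable hm ⟨_, hmem 0 0 (by omega) (by omega)⟩
        (fun c => (cell_le_iff _ c).2 ⟨Nat.zero_le _, Nat.zero_le _⟩)
        ⟨⟨_, h.1⟩, lt_of_le_of_ne ((cell_le_iff _ _).2 ⟨Nat.zero_le _, Nat.zero_le _⟩)
          fun h => by simp at h⟩ f f' hff) hΨ hΨ' iso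
    have hlt := card_lt_card_flag hD h.1 h.2
    rw [Fintype.card_sum, Fintype.card_sum, Fintype.card_sum] at hle
    omega
  · obtain ⟨e, h₁, h₂⟩ := exists_transfer_diagram (m := m) hD h
    exact ToricIso.of_models hΨ hΨ' e h₁ h₂

end Comparison
end GTSchubert

end

theorem mainTheorem7 (n i m : ℕ) (hi : 1 ≤ i) (hin : i ≤ n) (hm : 1 ≤ m)
    (w : Equiv.Perm (Fin (n + 1))) (hw : GTSchubert.IsMinRep n i w)
    (r : GTSchubert.PosRoot n → GTSchubert.PosRoot n → Prop) (hr : IsStrictTotalOrder _ r)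
    (hrw : GTSchubert.ExtendsHeightOrder w r)
    (F : Set (GTSchubert.GTIndex n → ℝ)) (hF : GTSchubert.IsMaximalKoganFace n i m w F) :
    (GTSchubert.ToricIso (GTSchubert.polytopeVariety F) (GTSchubert.polytopeTorus F)
        (GTSchubert.toricSchubert n i m hin w r) (GTSchubert.toricSchubertTorus n i m hin w r) ↔
      GTSchubert.ell n i w (i - 2) < i + 1 ∨ GTSchubert.ell n i w (i - 1) < i + 2) ∧
    (GTSchubert.ToricIso (GTSchubert.polytopeVariety F) (GTSchubert.polytopeTorus F)
        (GTSchubert.toricSchubert n i m hin w r) (GTSchubert.toricSchubertTorus n i m hin w r) ↔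
      ¬ ∃ L : List ℕ, GTSchubert.IsReducedWordOf n w
        (L ++ [i - 1, i - 2, i + 1, i, i - 1, i + 2, i + 1, i])) := by
  have h := GTSchubert.toricIso_iff hi hin hm hw hr hrw hF
  exact ⟨h.trans (GTSchubert.ell_condition_iff hi hin hw).symm,
    h.trans (not_congr (GTSchubert.reducedWord_condition_iff hw)).symm⟩
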